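/- **Model.** For each sample size $n$ let $p=p_n$, $d=d_n$, $k=k_n\le d$ be integers and let $\beta^*=\beta^*_n\in\mathbb R^d\setminus\{0\}$. Let $f(x;\beta)$ ($x\in\mathbb R^p,\beta\in\mathbb R^d$) be a predictor that is $C^2$ in $\beta$, and let $q(y\mid z)>0$ be a conditional density with respect to a $\sigma$-finite reference measure. Put $\ell(y,z)=-\log q(y\mid z)$, assumed convex and $C^2$ in $z$, and write $\dot\ell,\ddot\ell$ for its first two derivatives in $z$. The training points $z_i=(x_i,y_i)$, $i\le n$, and the test point $z_{\rm new}=(x_{\rm new},y_{\rm new})$ are i.i.d. with $x_i\sim P_X$ and $y_i\mid x_i\sim q(\cdot\mid f(x_i;\beta^*))$. All objects ($p,d,k,\beta^*,f,q,P_X$) may vary with $n$. **Estimators.** $\hat\beta$ and $\hat\beta_{/i}$ are minimizers of $\sum_j\ell(y_j,f(x_j;\beta))$ and $\sum_{j\ne i}\ell(y_j,f(x_j;\beta))$. With $g_j=\nabla f(x_j,\hat\beta)$ and $b_j=f(x_j;\hat\beta)-g_j^\top\hat\beta$, $\breve\beta$ and $\breve\beta_{/i}$ are minimizers of $\sum_j\ell(y_j,g_j^\top\beta+b_j)$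 and $\sum_{j\ne i}\ell(y_j,g_j^\top\beta+b_j)$. Let $G(\beta)$ be the $n\times d$ matrix with rows $\nabla f(x_j,\beta)^\top$, $G=G(\hat\beta)$, $g_{\rm new}=\nabla f(x_{\rm new},\hat\beta)$, $\dot\ell_j=\dot\ell(y_j,g_j^\top\breve\beta+b_j)$, $\ddot\ell_j=\ddot\ell(y_j,g_j^\top\breve\beta+b_j)$. Let $S\in\mathbb R^{d\times k}$ have i.i.d. $N(0,1)$ entries, independent of all data, and let $\phi_j=S^\top g_j$, $\phi_{\rm new}=S^\top g_{\rm new}$, $\Phi=GS$. **Influences.** For a test point with feature $x_{\rm new}$ (either the independent $z_{\rm new}$ or $z_{\rm new}=z_i$), $$\mathcal I^{\rm TRAK}(z_i,z_{\rm new};k)=\frac{\dot\ell_i\,\phi_{\rm new}^\top(\Phi^\top{\rm diag}(\ddot\ell)\Phi)^{-1}\phi_i}{1-\ddot\ell_i\,\phi_i^\top(\Phi^\top{\rm diag}(\ddot\ell)\Phi)^{-1}\phi_i},\qquad \mathcal I^{\rm ALO}(z_i,z_{\rm new})=\frac{\dot\ell_i\,g_{\rm new}^\top(G^\top{\rm diag}(\ddot\ell)G)^{-1}g_i}{1-\ddot\ell_i\,g_i^\top(G^\top{\rm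 diag}(\ddot\ell)G)^{-1}g_i}.$$ **Assumptions** (all constants are positive and independent of $n,p,d,k$; ${\rm poly}(\log n)$ is a fixed power of $\log n$). * (P1) $x_i$ is centered and sub-Gaussian: $\mathbb E e^{t u^\top x_i}\le \exp(K\|u\|^2t^2/(2\|\beta^*\|^2))$ for all $t,u$; its covariance has eigenvalues in $[c\|\beta^*\|^{-2},C\|\beta^*\|^{-2}]$. * (P2) $g_{i,*}=\nabla f(x_i,\beta^*)$ is norm-sub-Gaussian: $\mathbb P(\|g_{i,*}-\mathbb E g_{i,*}\|\ge t)\le 2e^{-t^2/(2\sigma^2)}$ for all $t\ge0$; $\Sigma_g=\mathbb E g_{i,*}g_{i,*}^\top$ satisfies $\lambda_{\max}(\Sigma_g)\le C\lambda_{\min}(\Sigma_g)$ and $\lambda_{\max}(\Sigma_g)\le C\|\beta^*\|^{-2}$. Let $\breve\Delta_i$, $\hat\Delta_i$ be the triangles with vertices $\breve\beta,\breve\beta_{/i},\beta^*$ and $\hat\beta,\hat\beta_{/i},\beta^*$. With probability tending to $1$, the following hold for all $i\le n$: * (R0) the four kinds of minimizers exist, and $\breve\beta$ is the only minimizer of its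 objective; * (R1) $\|\nabla f(x,\beta)\|\le C_1{\rm poly}(\log n)$ for $\beta\in\breve\Delta_i\cup\hat\Delta_i$ and $x\in\{x_{\rm new},x_1,\dots,x_n\}$; * (R2) $\frac1n G^\top G\preceq C_2\|\beta^*\|^{-2}I$, and for $\beta\in\breve\Delta_i\cup\hat\Delta_i$: $\frac1nG(\beta)^\top G(\beta)\succeq c_1\|\beta^*\|^{-2}I$ and $c_2\|\beta^*\|^{-2}I\preceq\frac1n\nabla^2\sum_j\ell(y_j,f(x_j;\beta))\preceq C_3\|\beta^*\|^{-2}I$; also the Hessian of the linearized risk, $\frac1n G^\top{\rm diag}(\ddot\ell)G$, lies between $c_2\|\beta^*\|^{-2}I$ and $C_3\|\beta^*\|^{-2}I$; * (R3) $\|\nabla^2f(x_{\rm new},\beta)\|\le C_4\|\beta^*\|^{-2}$ for $\beta\in\hat\Delta_i$; * (R4) $|\dot\ell(y_i,f(x_i;\beta))|\le C_5{\rm poly}(\log n)$ for $\beta\in[\hat\beta_{/i},\hat\beta]\cup\{\beta^*\}$; $|\ddot\ell(y_i,f(x_i;\beta))|\le C_5{\rm poly}(\log n)$ for $\beta\in\{\beta^*,\hat\beta\}$;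 $\ddot\ell(y_i,f(x_i;\beta))\ge\mu$ for $\beta\in[\hat\beta_{/i},\hat\beta]$; * (R5) with $L=C_6\frac{\sqrt n}{\|\beta^*\|}\sqrt{{\rm poly}(\log n)}$ and Euclidean norms of vectors indexed by $j\ne i$: for $\beta\in[\breve\beta_{/i},\breve\beta]$, the vector with entries $\ddot\ell(y_j,g_j^\top\beta+b_j)-\ddot\ell(y_j,g_j^\top\breve\beta+b_j)$ has norm at most $L\|\breve\beta-\breve\beta_{/i}\|$ and that with entries $\ddot\ell(y_j,g_j^\top\beta+b_j)-\ddot\ell(y_j,g_j^\top\beta^*+b_j)$ has norm at most $L\|\breve\beta-\beta^*\|$; for $\beta\in[\hat\beta_{/i},\hat\beta]$, the vector with entries $\ddot\ell(y_j,f(x_j;\beta))-\ddot\ell(y_j,f(x_j;\beta^*))$ has norm at most $L\|\hat\beta-\beta^*\|$. **Theorem.** Let $\varepsilon>0$. There are constants $C^{\rm TRAK},c^{\rm TRAK}>0$, depending only on $\varepsilon$ and the constants in the assumptions, such that whenever the assumptions hold and $\|\beta^*\|^2\le n^{1-\varepsilon}$ for all large $n$: 1. (Independent test point.) With probability tending to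 $1$, uniformly in the choice of $i\le n$, $\mathcal I^{\rm TRAK}(z_i,z_{\rm new};k)$ is well defined (the matrix is invertible and the denominator is nonzero) and $$|\mathcal I^{\rm TRAK}(z_i,z_{\rm new};k)|\le C^{\rm TRAK}\frac{\|\beta^*\|\sqrt k}{n^{1-\varepsilon}\sqrt d}.$$ 2. (Test point $z_{\rm new}=z_i$.) If moreover $k\to\infty$, then with probability tending to $1$, uniformly in the choice of $i\le n$, $\mathcal I^{\rm TRAK}(z_i,z_i;k)$ and $\mathcal I^{\rm ALO}(z_i,z_i)$ are well defined and, unless $\mathcal I^{\rm ALO}(z_i,z_i)=0$, $$\left|\frac{\mathcal I^{\rm TRAK}(z_i,z_i;k)}{\mathcal I^{\rm ALO}(z_i,z_i)}\right|\ge c^{\rm TRAK}\frac kd.$$ "Uniformly in the choice of $i$" means that the largest failure probability over $i\le n$ tends to $0$. Moreover, there are absolute constants $C,c>0$ such that for all $k\le d$, every symmetric positive definite $A\in\mathbb R^{d\times d}$ with $\lambda_{\max}(A)/\lambda_{\min}(A)\le\kappa$, every $u\in\mathbb R^d\setminus\{0\}$ and every $\delta\in(0,1)$, if $S\in\mathbb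 R^{d\times k}$ has i.i.d. $N(0,1)$ entries, then with probability at least $1-Ce^{-c\delta^2k}$, $$\frac1\kappa(1-\delta)\frac kd\le\frac{u^\top S(S^\top AS)^{-1}S^\top u}{u^\top A^{-1}u}\le\min\Bigl(\kappa(1+\delta)\frac kd,\,1\Bigr).$$ -/

import Mathlib

open MeasureTheory ProbabilityTheory Filter Topology
open scoped Matrix ENNReal InnerProductSpace

noncomputable section

namespace TRAK

/-- Euclidean space `ℝ^m` with its Euclidean norm. -/
abbrev Vec (m : ℕ) : Type := EuclideanSpace ℝ (Fin m)

/-! ### The statistical model -/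

/-- A well-specified regression model: features `x ∈ ℝ^p` have law `px`, the response `y ∈ ℝ` has
conditional density `q y (f x βstar)` with respect to the reference measure `nu` (Lebesgue measure,
a counting measure, ...). The loss is the negative log-likelihood; it is convex in the prediction,
and both the loss and the predictor `f` are twice continuously differentiable. -/
structure Model where
  /-- number of features -/
  p : ℕ
  /-- number of parameters -/
  d : ℕ
  /-- true parameter -/
  betaStar : Vec d
  /-- predictor `f(x; β)` -/
  f : Vec p → Vec d → ℝ
  /-- law of the features -/
  px : Measure (Vec p)
  /-- reference measure for the responses -/
  nu : Measure ℝ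
  /-- conditional density `q(y | z)`, arguments in the order `y`, `z` -/
  q : ℝ → ℝ → ℝ
  betaStar_ne_zero : betaStar ≠ 0
  px_prob : IsProbabilityMeasure px
  nu_sigmaFinite : SigmaFinite nu
  f_measurable : Measurable (Function.uncurry f)
  f_contDiff : ∀ x, ContDiff ℝ 2 (f x)
  q_measurable : Measurable (Function.uncurry q)
  q_pos : ∀ y z, 0 < q y z
  q_lintegral : ∀ z, ∫⁻ y, ENNReal.ofReal (q y z) ∂nu = 1
  loss_contDiff : ∀ y, ContDiff ℝ 2 (fun z => -Real.log (q y z))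
  loss_convex : ∀ y, ConvexOn ℝ Set.univ (fun z => -Real.log (q y z))

namespace Model

variable (M : Model)

/-- A data point `(x, y)`. -/
abbrev Obs : Type := Vec M.p × ℝ

/-- Law of one data point: `x ~ px` and `y | x ~ q(· | f(x; βstar)) dnu`. -/
def law : Measure M.Obs :=
  (M.px.prod M.nu).withDensity fun z => ENNReal.ofReal (M.q z.2 (M.f z.1 M.betaStar))

/-- The loss `ℓ(y, z) = -log q(y | z)`. -/
def loss (y z : ℝ) : ℝ := -Real.log (M.q y z)

/-- First derivative of the loss in its second argument. -/
def dloss (y z : ℝ) : ℝ := deriv (M.loss y) z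

/-- Second derivative of the loss in its second argument. -/
def ddloss (y z : ℝ) : ℝ := deriv (deriv (M.loss y)) z

/-- The gradient `∇f(x, β)` in the parameter. -/
def grad (x : Vec M.p) (β : Vec M.d) : Vec M.d := gradient (M.f x) β

/-- The linearization at `b₀` of `β ↦ f(x; β)`, namely `gᵀ β + b` with
`g = ∇f(x, b₀)` and `b = f(x; b₀) - gᵀ b₀`. -/
def linPred (b₀ : Vec M.d) (x : Vec M.p) (β : Vec M.d) : ℝ :=
  ⟪M.grad x b₀, β⟫_ℝ + (M.f x b₀ - ⟪M.grad x b₀, b₀⟫_ℝ)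

variable {n : ℕ}

/-- Empirical risk over the data points with index in `s`. -/
def risk (D : Fin n → M.Obs) (s : Finset (Fin n)) (β : Vec M.d) : ℝ :=
  ∑ j ∈ s, M.loss (D j).2 (M.f (D j).1 β)

/-- Empirical risk of the model linearized at `b₀`, over the data points with index in `s`. -/
def linRisk (b₀ : Vec M.d) (D : Fin n → M.Obs) (s : Finset (Fin n)) (β : Vec M.d) : ℝ :=
  ∑ j ∈ s, M.loss (D j).2 (M.linPred b₀ (D j).1 β)

/-- `G(β)`, the `n × d` matrix with rows `∇f(x_j, β)`. -/
def gradMatrix (D : Fin n → M.Obs) (β : Vec M.d) : Matrix (Fin n) (Fin M.d) ℝ :=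
  Matrix.of fun j a => M.grad (D j).1 β a

/-- First loss derivatives `ℓ'(y_j, g_jᵀ β + b_j)` in the model linearized at `b₀`. -/
def linDloss (b₀ : Vec M.d) (D : Fin n → M.Obs) (β : Vec M.d) (j : Fin n) : ℝ :=
  M.dloss (D j).2 (M.linPred b₀ (D j).1 β)

/-- Second loss derivatives `ℓ''(y_j, g_jᵀ β + b_j)` in the model linearized at `b₀`. -/
def linDdloss (b₀ : Vec M.d) (D : Fin n → M.Obs) (β : Vec M.d) (j : Fin n) : ℝ :=
  M.ddloss (D j).2 (M.linPred b₀ (D j).1 β)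

end Model

/-! ### Estimators -/

/-- Measurable functions of the training sample of size `n`, meant as the full-sample and
leave-one-out estimators for the model (`hat`, `hatLOO`) and for the model linearized at `hat`
(`breve`, `breveLOO`). That they are risk minimizers is `Estimators.AreMinimizers`. -/
structure Estimators (M : Model) (n : ℕ) where
  hat : (Fin n → M.Obs) → Vec M.d
  hatLOO : Fin n → (Fin n → M.Obs) → Vec M.d
  breve : (Fin n → M.Obs) → Vec M.d
  breveLOO : Fin n → (Fin n → M.Obs) → Vec M.d
  hat_measurable : Measurable hat
  hatLOO_measurable : ∀ i, Measurable (hatLOO i)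
  breve_measurable : Measurable breve
  breveLOO_measurable : ∀ i, Measurable (breveLOO i)

/-- On the sample `D` the estimators minimize their empirical risks, and the linearized full-sample
risk has no other minimizer. -/
structure Estimators.AreMinimizers {M : Model} {n : ℕ} (T : Estimators M n)
    (D : Fin n → M.Obs) : Prop where
  hat : IsMinOn (M.risk D Finset.univ) Set.univ (T.hat D)
  hatLOO : ∀ i, IsMinOn (M.risk D (Finset.univ.erase i)) Set.univ (T.hatLOO i D)
  breve : IsMinOn (M.linRisk (T.hat D) D Finset.univ) Set.univ (T.breve D)
  breveLOO : ∀ i,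
    IsMinOn (M.linRisk (T.hat D) D (Finset.univ.erase i)) Set.univ (T.breveLOO i D)
  unique : ∀ β, IsMinOn (M.linRisk (T.hat D) D Finset.univ) Set.univ β → β = T.breve D

/-! ### Assumptions -/

/-- The constants in the assumptions; they do not vary with `n`, `p`, `d`. The factors
`poly(log n)` are `(log n)^deg` times a constant. -/
structure Consts where
  /-- bounds for the feature covariance, and sub-Gaussian constant of the features -/
  cX : ℝ
  CX : ℝ
  KX : ℝ
  /-- bound for gradients -/
  Cgrad : ℝ
  /-- eigenvalue bounds for `GᵀG / n` -/
  cG : ℝ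
  CG : ℝ
  /-- eigenvalue bounds for the empirical Hessians divided by `n` -/
  cH : ℝ
  CH : ℝ
  /-- bound for the Hessian of `f` -/
  Chess : ℝ
  /-- bound for loss derivatives, lower curvature bound, Lipschitz constant of `ℓ''` -/
  Closs : ℝ
  mu : ℝ
  Clip : ℝ
  /-- norm-sub-Gaussian parameter of the gradient and bound for its second moment matrix -/
  sigma : ℝ
  Csec : ℝ
  /-- degree of the polynomials in `log n` -/
  deg : ℕ
  pos : 0 < cX ∧ 0 < CX ∧ 0 < KX ∧ 0 < Cgrad ∧ 0 < cG ∧ 0 < CG ∧ 0 < cH ∧ 0 < CH ∧ 0 < Chess ∧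
    0 < Closs ∧ 0 < mu ∧ 0 < Clip ∧ 0 < sigma ∧ 0 < Csec

/-- All eigenvalues of the symmetric matrix `A` are at least `a`. -/
def EigLower {m : ℕ} (A : Matrix (Fin m) (Fin m) ℝ) (a : ℝ) : Prop :=
  ∀ v : Fin m → ℝ, a * (v ⬝ᵥ v) ≤ v ⬝ᵥ (A *ᵥ v)

/-- All eigenvalues of the symmetric matrix `A` are at most `a`. -/
def EigUpper {m : ℕ} (A : Matrix (Fin m) (Fin m) ℝ) (a : ℝ) : Prop :=
  ∀ v : Fin m → ℝ, v ⬝ᵥ (A *ᵥ v) ≤ a * (v ⬝ᵥ v)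

/-- The second derivative of `F`, as a bilinear form; its norm is the spectral norm of the Hessian
matrix. -/
def hess {m : ℕ} (F : Vec m → ℝ) (β : Vec m) : Vec m →L[ℝ] Vec m →L[ℝ] ℝ :=
  fderiv ℝ (fderiv ℝ F) β

/-- A random vector `X` is norm-sub-Gaussian with parameter `σ`. -/
def NormSubGaussian {Ω : Type*} [MeasurableSpace Ω] {m : ℕ} (X : Ω → Vec m) (σ : ℝ)
    (P : Measure Ω) : Prop :=
  AEMeasurable X P ∧ ∀ t : ℝ, 0 ≤ t →
    P {ω | t ≤ ‖X ω - ∫ ω', X ω' ∂P‖} ≤ ENNReal.ofReal (2 * Real.exp (-t ^ 2 / (2 * σ ^ 2)))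

/-- Assumptions on the law of one data point: sub-Gaussian design with covariance of order
`‖βstar‖⁻²`, and norm-sub-Gaussian gradients `∇f(x, βstar)` whose second moment matrix is
well conditioned and of order at most `‖βstar‖⁻²`. -/
structure Population (K : Consts) (M : Model) : Prop where
  design_mean : ∫ x, x ∂M.px = 0
  design_subGaussian : ∀ u : Vec M.p, HasSubgaussianMGF (fun x => ⟪u, x⟫_ℝ)
    (Real.toNNReal (K.KX * ‖u‖ ^ 2 / ‖M.betaStar‖ ^ 2)) M.px
  design_cov : ∀ u : Vec M.p,
    K.cX / ‖M.betaStar‖ ^ 2 * ‖u‖ ^ 2 ≤ Var[fun x => ⟪u, x⟫_ℝ; M.px] ∧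
    Var[fun x => ⟪u, x⟫_ℝ; M.px] ≤ K.CX / ‖M.betaStar‖ ^ 2 * ‖u‖ ^ 2
  grad_nSG : NormSubGaussian (fun x => M.grad x M.betaStar) K.sigma M.px
  grad_cond : ∀ u v : Vec M.d, ‖u‖ = 1 → ‖v‖ = 1 →
    ∫ x, ⟪u, M.grad x M.betaStar⟫_ℝ ^ 2 ∂M.px ≤
      K.Csec * ∫ x, ⟪v, M.grad x M.betaStar⟫_ℝ ^ 2 ∂M.px
  grad_second : ∀ u : Vec M.d, ‖u‖ = 1 →
    ∫ x, ⟪u, M.grad x M.betaStar⟫_ℝ ^ 2 ∂M.px ≤ K.Csec / ‖M.betaStar‖ ^ 2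

/-- Assumptions on the sample `D` and the test feature `xnew`, imposed with probability tending
to one. `triBreve i` and `triHat i` are the triangles spanned by the true parameter and the
full-sample and `i`-th leave-one-out estimators, of the linearized and of the original model. -/
structure Regular (K : Consts) {M : Model} {n : ℕ} (T : Estimators M n)
    (D : Fin n → M.Obs) (xnew : Vec M.p) : Prop where
  minimizers : T.AreMinimizers D
  /-- gradient bound -/
  grad_bound : ∀ i, ∀ β ∈ convexHull ℝ {T.breve D, T.breveLOO i D, M.betaStar} ∪
      convexHull ℝ {T.hat D, T.hatLOO i D, M.betaStar},
    ‖M.grad xnew β‖ ≤ K.Cgrad * Real.log n ^ K.deg ∧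
    ∀ j, ‖M.grad (D j).1 β‖ ≤ K.Cgrad * Real.log n ^ K.deg
  /-- Gram matrix of the gradients -/
  gram_upper : EigUpper ((M.gradMatrix D (T.hat D))ᵀ * M.gradMatrix D (T.hat D))
    (n * (K.CG / ‖M.betaStar‖ ^ 2))
  gram_lower : ∀ i, ∀ β ∈ convexHull ℝ {T.breve D, T.breveLOO i D, M.betaStar} ∪
      convexHull ℝ {T.hat D, T.hatLOO i D, M.betaStar},
    EigLower ((M.gradMatrix D β)ᵀ * M.gradMatrix D β) (n * (K.cG / ‖M.betaStar‖ ^ 2))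
  /-- Hessian of the empirical risk -/
  hess_risk : ∀ i, ∀ β ∈ convexHull ℝ {T.breve D, T.breveLOO i D, M.betaStar} ∪
      convexHull ℝ {T.hat D, T.hatLOO i D, M.betaStar}, ∀ v : Vec M.d,
    n * (K.cH / ‖M.betaStar‖ ^ 2) * ‖v‖ ^ 2 ≤ hess (M.risk D Finset.univ) β v v ∧
    hess (M.risk D Finset.univ) β v v ≤ n * (K.CH / ‖M.betaStar‖ ^ 2) * ‖v‖ ^ 2
  /-- Hessian of the linearized empirical risk at its minimizer -/
  hess_linRisk : ∀ v : Vec M.d,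
    n * (K.cH / ‖M.betaStar‖ ^ 2) * ‖v‖ ^ 2 ≤
      hess (M.linRisk (T.hat D) D Finset.univ) (T.breve D) v v ∧
    hess (M.linRisk (T.hat D) D Finset.univ) (T.breve D) v v ≤
      n * (K.CH / ‖M.betaStar‖ ^ 2) * ‖v‖ ^ 2
  /-- Hessian of the predictor at the test feature -/
  hess_f : ∀ i, ∀ β ∈ convexHull ℝ {T.hat D, T.hatLOO i D, M.betaStar},
    ‖hess (M.f xnew) β‖ ≤ K.Chess / ‖M.betaStar‖ ^ 2
  /-- first derivative of the loss -/
  dloss_bound : ∀ i, ∀ β ∈ segment ℝ (T.hatLOO i D) (T.hat D) ∪ {M.betaStar},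
    |M.dloss (D i).2 (M.f (D i).1 β)| ≤ K.Closs * Real.log n ^ K.deg
  /-- second derivative of the loss -/
  ddloss_star : ∀ i,
    |M.ddloss (D i).2 (M.f (D i).1 M.betaStar)| ≤ K.Closs * Real.log n ^ K.deg
  ddloss_hat : ∀ i,
    |M.ddloss (D i).2 (M.f (D i).1 (T.hat D))| ≤ K.Closs * Real.log n ^ K.deg
  ddloss_lower : ∀ i, ∀ β ∈ segment ℝ (T.hatLOO i D) (T.hat D),
    K.mu ≤ M.ddloss (D i).2 (M.f (D i).1 β)
  /-- Lipschitz-type conditions on the vectors of second derivatives with the `i`-th entry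
  removed -/
  lip_breve : ∀ i, ∀ β ∈ segment ℝ (T.breveLOO i D) (T.breve D),
    √(∑ j ∈ Finset.univ.erase i,
        (M.linDdloss (T.hat D) D β j - M.linDdloss (T.hat D) D (T.breve D) j) ^ 2) ≤
      K.Clip * (√n / ‖M.betaStar‖) * √(Real.log n ^ K.deg) * ‖T.breve D - T.breveLOO i D‖
  lip_breve_star : ∀ i, ∀ β ∈ segment ℝ (T.breveLOO i D) (T.breve D),
    √(∑ j ∈ Finset.univ.erase i,
        (M.linDdloss (T.hat D) D β j - M.linDdloss (T.hat D) D M.betaStar j) ^ 2) ≤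
      K.Clip * (√n / ‖M.betaStar‖) * √(Real.log n ^ K.deg) * ‖T.breve D - M.betaStar‖
  lip_hat_star : ∀ i, ∀ β ∈ segment ℝ (T.hatLOO i D) (T.hat D),
    √(∑ j ∈ Finset.univ.erase i,
        (M.ddloss (D j).2 (M.f (D j).1 β) - M.ddloss (D j).2 (M.f (D j).1 M.betaStar)) ^ 2) ≤
      K.Clip * (√n / ‖M.betaStar‖) * √(Real.log n ^ K.deg) * ‖T.hat D - M.betaStar‖

/-! ### Influence functions -/

/-- The matrix `Φᵀ diag(w) Φ`. -/
def weightedGram {n m : ℕ} (Φ : Matrix (Fin n) (Fin m) ℝ) (w : Fin n → ℝ) :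
    Matrix (Fin m) (Fin m) ℝ := Φᵀ * Matrix.diagonal w * Φ

/-- The denominator `1 - w_i φ_iᵀ (Φᵀ diag(w) Φ)⁻¹ φ_i`, with `φ_i` the `i`-th row of `Φ`. -/
def aloDenom {n m : ℕ} (Φ : Matrix (Fin n) (Fin m) ℝ) (w : Fin n → ℝ) (i : Fin n) : ℝ :=
  1 - w i * (Φ i ⬝ᵥ ((weightedGram Φ w)⁻¹ *ᵥ Φ i))

/-- The approximate leave-one-out influence with features `Φ`, first and second loss derivatives
`r` and `w`, test feature `φnew`. -/
def aloInfluence {n m : ℕ} (Φ : Matrix (Fin n) (Fin m) ℝ) (r w : Fin n → ℝ) (i : Fin n)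
    (φnew : Fin m → ℝ) : ℝ :=
  (r i * (φnew ⬝ᵥ ((weightedGram Φ w)⁻¹ *ᵥ Φ i))) / aloDenom Φ w i

/-- The matrix is invertible and the denominator does not vanish, so that `aloInfluence` is a
genuine quotient. -/
def AloDefined {n m : ℕ} (Φ : Matrix (Fin n) (Fin m) ℝ) (w : Fin n → ℝ) (i : Fin n) : Prop :=
  IsUnit (weightedGram Φ w).det ∧ aloDenom Φ w i ≠ 0

section Influence

variable {M : Model} {n : ℕ} (T : Estimators M n) (D : Fin n → M.Obs)

/-- `ℓ'(y_j, g_jᵀ β + b_j)` at the linearized estimator. -/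
def firstDeriv : Fin n → ℝ := M.linDloss (T.hat D) D (T.breve D)

/-- `ℓ''(y_j, g_jᵀ β + b_j)` at the linearized estimator. -/
def secondDeriv : Fin n → ℝ := M.linDdloss (T.hat D) D (T.breve D)

/-- Projected features `Φ = G S`, whose `j`-th row is `Sᵀ g_j`. -/
def projFeatures {k : ℕ} (S : Matrix (Fin M.d) (Fin k) ℝ) : Matrix (Fin n) (Fin k) ℝ :=
  M.gradMatrix D (T.hat D) * S

/-- The influence of the `i`-th data point on the prediction at `xnew`, without projection. -/
def influenceALO (i : Fin n) (xnew : Vec M.p) : ℝ :=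
  aloInfluence (M.gradMatrix D (T.hat D)) (firstDeriv T D) (secondDeriv T D) i
    (fun a => M.grad xnew (T.hat D) a)

/-- The influence of the `i`-th data point on the prediction at `xnew`, with projection matrix
`S`. -/
def influenceTRAK {k : ℕ} (S : Matrix (Fin M.d) (Fin k) ℝ) (i : Fin n) (xnew : Vec M.p) : ℝ :=
  aloInfluence (projFeatures T D S) (firstDeriv T D) (secondDeriv T D) i
    (Sᵀ *ᵥ fun a => M.grad xnew (T.hat D) a)

end Influence

/-! ### Probability laws -/

/-- Law of a `d × k` matrix with independent standard Gaussian entries. -/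
def gaussianMatrix (d k : ℕ) : Measure (Fin d → Fin k → ℝ) :=
  Measure.pi fun _ => Measure.pi fun _ => gaussianReal 0 1

/-- Joint law of a training sample of size `n` and a test point, all independent draws from the
model. -/
def dataLaw (M : Model) (n : ℕ) : Measure ((Fin n → M.Obs) × M.Obs) :=
  (Measure.pi fun _ : Fin n => M.law).prod M.law

/-- Joint law of the training sample, the test point and an independent Gaussian projection
matrix. -/
def fullLaw (M : Model) (n k : ℕ) :
    Measure (((Fin n → M.Obs) × M.Obs) × (Fin M.d → Fin k → ℝ)) :=
  (dataLaw M n).prod (gaussianMatrix M.d k)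

end TRAK

end

/-!
The three bounds compare a quadratic form `uᵀ S (Sᵀ A S)⁻¹ Sᵀ u` with `uᵀ A⁻¹ u`.

**Sketched quadratic forms.** For positive definite `A`, `wᵀ A⁻¹ w` is the maximum of
`2 wᵀ x - xᵀ A x`, and the sketched form is the same maximum over the range of `S`. Both are hence
antitone in `A`: up to the condition number, `A` may be replaced by the identity
(`sketch_ratio_bounds`), and for `A = 1` the sketched form is the squared length of the projection
of `u` to the range of `S`. The law of `S` is invariant under rotations, so the law of this length
depends on `‖u‖` only, and `u` may be replaced by a Gaussian vector independent of `S`. By Fubini's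
theorem the subspace may then be held fixed, and the claim is the concentration of the squared norms
of a standard Gaussian vector and of its projection (`gaussianMatrix_sketchForm_concentration`). A
trace computation together with the same invariance gives the mean `k / d ‖u‖²`, and Markov's
inequality an upper bound that needs no growth of `k` (`gaussianMatrix_sketchForm_markov`).

**Influences on a regular sample.** Linearization at the minimizer `hat` does not move the
minimizer: `hat` is a critical point of the convex linearized risk, whence `breve = hat`
(`breve_eq_hat`). So the matrix `H = Gᵀ diag(ℓ'') G` has all eigenvalues of order `n / ‖βstar‖²`,
the leverages are at most a power of `log n` times `‖βstar‖² / n`, and the denominators lie in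
`[1/2, 1]`. At a training point the ratio of the two influences is then a ratio of quadratic forms,
up to a factor `2` (`Regular.self_influence_ratio`).

At an independent test point the numerator is the inner product of `v = S (Sᵀ H S)⁻¹ Sᵀ g_i` with
the gradient at the test feature. The length of `v` is controlled by the projection of `g_i` to the
range of `S`, which yields the factor `√(k / d)`. The gradient at `βstar` is independent of `v`, so
that Chebyshev's inequality bounds its inner product with `v` by `‖v‖ / ‖βstar‖` up to a logarithm.
The change of the gradient from `βstar` to `hat` is at most `‖hat - βstar‖ / ‖βstar‖²`, and
`‖hat - βstar‖` is at most `‖βstar‖² / n` times the norm of the score at `βstar`. For the score a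
bound of order `n / ‖βstar‖` suffices (`Population.truncScore_bound`); no cancellation is needed for
it. This gives `Regular.test_influence_le`, and the powers of `log n` are absorbed by `n ^ ε`.
-/

noncomputable section

namespace TRAK

/-! ### Quadratic forms under a sketch -/

/-- The vector `S (Sᵀ A S)⁻¹ Sᵀ u`. -/
def sketchVec {d k : ℕ} (A : Matrix (Fin d) (Fin d) ℝ) (S : Matrix (Fin d) (Fin k) ℝ)
    (u : Fin d → ℝ) : Fin d → ℝ :=
  S *ᵥ ((Sᵀ * A * S)⁻¹ *ᵥ (Sᵀ *ᵥ u))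

/-- The quadratic form `uᵀ S (Sᵀ A S)⁻¹ Sᵀ u`. -/
def sketchForm {d k : ℕ} (A : Matrix (Fin d) (Fin d) ℝ) (S : Matrix (Fin d) (Fin k) ℝ)
    (u : Fin d → ℝ) : ℝ :=
  u ⬝ᵥ sketchVec A S u

lemma dotProduct_sketchVec {d k : ℕ} (A : Matrix (Fin d) (Fin d) ℝ) (S : Matrix (Fin d) (Fin k) ℝ)
    (u w : Fin d → ℝ) :
    (Sᵀ *ᵥ w) ⬝ᵥ ((Sᵀ * A * S)⁻¹ *ᵥ (Sᵀ *ᵥ u)) = w ⬝ᵥ sketchVec A S u := by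
  rw [sketchVec, Matrix.dotProduct_mulVec w S, Matrix.mulVec_transpose S w]

/-- Variational bound for the inverse: `wᵀ B⁻¹ w` is the maximum of `2 wᵀ x - xᵀ B x`. -/
lemma two_mul_dotProduct_sub_le {m : ℕ} {B : Matrix (Fin m) (Fin m) ℝ} (hB : B.PosDef)
    (w x : Fin m → ℝ) : 2 * (w ⬝ᵥ x) - x ⬝ᵥ (B *ᵥ x) ≤ w ⬝ᵥ (B⁻¹ *ᵥ w) := by
  have hu : IsUnit B.det := (Matrix.isUnit_iff_isUnit_det _).1 hB.isUnit
  set y := B⁻¹ *ᵥ w with hy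
  have hBy : B *ᵥ y = w := by
    rw [hy, Matrix.mulVec_mulVec, Matrix.mul_nonsing_inv _ hu, Matrix.one_mulVec]
  have hBT : Bᵀ = B := by
    have := hB.isHermitian.eq
    rwa [Matrix.conjTranspose_eq_transpose_of_trivial] at this
  have h0 := hB.posSemidef.dotProduct_mulVec_nonneg (x - y)
  have hs : y ⬝ᵥ (B *ᵥ x) = w ⬝ᵥ x := by
    rw [Matrix.dotProduct_mulVec, ← Matrix.mulVec_transpose, hBT, hBy]
  simp only [star_trivial, Matrix.mulVec_sub, sub_dotProduct, dotProduct_sub, hBy, hs] at h0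
  have h1 : x ⬝ᵥ w = w ⬝ᵥ x := dotProduct_comm _ _
  have h2 : y ⬝ᵥ w = w ⬝ᵥ y := dotProduct_comm _ _
  linarith

section Comparison

variable {d k : ℕ} {A : Matrix (Fin d) (Fin d) ℝ} {S : Matrix (Fin d) (Fin k) ℝ} {a b : ℝ}

lemma posDef_of_eigLower (hA : Aᵀ = A) (ha : 0 < a) (hl : EigLower A a) : A.PosDef := by
  refine Matrix.PosDef.of_dotProduct_mulVec_pos ?_ fun x hx => ?_
  · rw [Matrix.IsHermitian, Matrix.conjTranspose_eq_transpose_of_trivial, hA]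
  · have h1 : 0 < x ⬝ᵥ x := by simpa using Matrix.dotProduct_star_self_pos_iff.2 hx
    simpa using (mul_pos ha h1).trans_le (hl x)

lemma posDef_sketch (hA : A.PosDef) (hS : Function.Injective S.mulVec) :
    (Sᵀ * A * S).PosDef := by
  simpa using hA.conjTranspose_mul_mul_same hS

/-- The vector `v = S (Sᵀ A S)⁻¹ Sᵀ u` satisfies `vᵀ A v = uᵀ v`. -/
lemma sketchVec_quadForm (hA : A.PosDef) (hS : Function.Injective S.mulVec) (u : Fin d → ℝ) :
    sketchVec A S u ⬝ᵥ (A *ᵥ sketchVec A S u) = sketchForm A S u := by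
  have hu := (Matrix.isUnit_iff_isUnit_det _).1 (posDef_sketch hA hS).isUnit
  set y := (Sᵀ * A * S)⁻¹ *ᵥ (Sᵀ *ᵥ u) with hy
  have h1 : (Sᵀ * A * S) *ᵥ y = Sᵀ *ᵥ u := by
    rw [hy, Matrix.mulVec_mulVec, Matrix.mul_nonsing_inv _ hu, Matrix.one_mulVec]
  have hv : sketchVec A S u = S *ᵥ y := rfl
  have h2 : Sᵀ *ᵥ (A *ᵥ (S *ᵥ y)) = Sᵀ *ᵥ u := by
    rw [← h1, Matrix.mulVec_mulVec, Matrix.mulVec_mulVec]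
  have h3 : ∀ w : Fin d → ℝ, (S *ᵥ y) ⬝ᵥ w = y ⬝ᵥ (Sᵀ *ᵥ w) := fun w => by
    rw [Matrix.dotProduct_mulVec, Matrix.vecMul_transpose]
  rw [sketchForm, hv, h3, h2, ← h3, dotProduct_comm]

/-- The sketched form is the maximum of `2 uᵀ v - vᵀ A v` over the range of the sketch. -/
lemma le_sketchForm (hA : A.PosDef) (hS : Function.Injective S.mulVec) (u : Fin d → ℝ)
    (x : Fin k → ℝ) :
    2 * (u ⬝ᵥ (S *ᵥ x)) - (S *ᵥ x) ⬝ᵥ (A *ᵥ (S *ᵥ x)) ≤ sketchForm A S u := by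
  have h := two_mul_dotProduct_sub_le (posDef_sketch hA hS) (Sᵀ *ᵥ u) x
  rw [dotProduct_sketchVec] at h
  have h1 : (Sᵀ *ᵥ u) ⬝ᵥ x = u ⬝ᵥ (S *ᵥ x) := by
    rw [Matrix.dotProduct_mulVec, Matrix.mulVec_transpose]
  have h2 : x ⬝ᵥ ((Sᵀ * A * S) *ᵥ x) = (S *ᵥ x) ⬝ᵥ (A *ᵥ (S *ᵥ x)) := by
    rw [← Matrix.mulVec_mulVec, ← Matrix.mulVec_mulVec, Matrix.dotProduct_mulVec x,
      Matrix.vecMul_transpose]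
  rwa [h1, h2] at h

lemma sketchForm_nonneg (hA : A.PosDef) (hS : Function.Injective S.mulVec) (u : Fin d → ℝ) :
    0 ≤ sketchForm A S u := by
  simpa using le_sketchForm hA hS u 0

lemma sketchForm_le (hA : A.PosDef) (hS : Function.Injective S.mulVec) (u : Fin d → ℝ) :
    sketchForm A S u ≤ u ⬝ᵥ (A⁻¹ *ᵥ u) := by
  have h := two_mul_dotProduct_sub_le hA u (sketchVec A S u)
  rw [sketchVec_quadForm hA hS] at h
  have : u ⬝ᵥ sketchVec A S u = sketchForm A S u := rfl
  linarith

lemma sketchForm_one_le (hA : A.PosDef) (hS : Function.Injective S.mulVec) (hb : 0 < b)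
    (hu : EigUpper A b) (u : Fin d → ℝ) : sketchForm 1 S u / b ≤ sketchForm A S u := by
  set y := (Sᵀ * (1 : Matrix (Fin d) (Fin d) ℝ) * S)⁻¹ *ᵥ (Sᵀ *ᵥ u) with hy
  have h := le_sketchForm hA hS u (b⁻¹ • y)
  have hv : sketchVec 1 S u = S *ᵥ y := rfl
  have h1 := sketchVec_quadForm (Matrix.PosDef.one (n := Fin d) (R := ℝ)) hS u
  have h2 := hu (S *ᵥ y)
  rw [Matrix.one_mulVec] at h1
  simp only [Matrix.mulVec_smul, dotProduct_smul, smul_dotProduct, smul_eq_mul, ← hv] at h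
  have h3 : u ⬝ᵥ sketchVec 1 S u = sketchForm 1 S u := rfl
  rw [← hv, h1] at h2
  rw [h3] at h
  refine le_trans ?_ h
  have h4 : b⁻¹ * (b⁻¹ * (sketchVec 1 S u ⬝ᵥ A *ᵥ sketchVec 1 S u)) ≤
      b⁻¹ * (b⁻¹ * (b * sketchForm 1 S u)) := by gcongr
  have h5 : b⁻¹ * (b⁻¹ * (b * sketchForm 1 S u)) = sketchForm 1 S u / b := by field_simp
  have h6 : b⁻¹ * sketchForm 1 S u = sketchForm 1 S u / b := by field_simp
  rw [h6]
  linarith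

lemma sketchForm_le_one (hA : A.PosDef) (hS : Function.Injective S.mulVec) (ha : 0 < a)
    (hl : EigLower A a) (u : Fin d → ℝ) : sketchForm A S u ≤ sketchForm 1 S u / a := by
  set y := (Sᵀ * A * S)⁻¹ *ᵥ (Sᵀ *ᵥ u) with hy
  have h := le_sketchForm (Matrix.PosDef.one (n := Fin d) (R := ℝ)) hS u (a • y)
  have hv : sketchVec A S u = S *ᵥ y := rfl
  have h1 := sketchVec_quadForm hA hS u
  have h2 := hl (sketchVec A S u)
  simp only [Matrix.one_mulVec, Matrix.mulVec_smul, dotProduct_smul, smul_dotProduct, smul_eq_mul,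
    ← hv] at h
  have h3 : u ⬝ᵥ sketchVec A S u = sketchForm A S u := rfl
  rw [h1] at h2
  rw [h3] at h
  rw [le_div_iff₀ ha]
  nlinarith

lemma sketchVec_sq_le (hA : A.PosDef) (hS : Function.Injective S.mulVec) (ha : 0 < a)
    (hl : EigLower A a) (u : Fin d → ℝ) :
    sketchVec A S u ⬝ᵥ sketchVec A S u ≤ sketchForm 1 S u / a ^ 2 := by
  have h1 := sketchVec_quadForm hA hS u
  have h2 := hl (sketchVec A S u)
  have h3 := sketchForm_le_one hA hS ha hl u
  rw [h1] at h2
  rw [le_div_iff₀ ha] at h3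
  rw [le_div_iff₀ (by positivity)]
  nlinarith

lemma inv_quadForm_le (hA : A.PosDef) (ha : 0 < a) (hl : EigLower A a) (u : Fin d → ℝ) :
    u ⬝ᵥ (A⁻¹ *ᵥ u) ≤ (u ⬝ᵥ u) / a := by
  have hI : Function.Injective (1 : Matrix (Fin d) (Fin d) ℝ).mulVec := fun x y h => by
    simpa using h
  simpa [sketchForm, sketchVec] using sketchForm_le_one hA hI ha hl u

lemma le_inv_quadForm (hA : A.PosDef) (hb : 0 < b) (hu : EigUpper A b) (u : Fin d → ℝ) :
    (u ⬝ᵥ u) / b ≤ u ⬝ᵥ (A⁻¹ *ᵥ u) := by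
  have hI : Function.Injective (1 : Matrix (Fin d) (Fin d) ℝ).mulVec := fun x y h => by
    simpa using h
  simpa [sketchForm, sketchVec] using sketchForm_one_le hA hI hb hu u

end Comparison

section Eigenvalues

variable {d : ℕ} {A : Matrix (Fin d) (Fin d) ℝ}

lemma quadForm_eq_sum_eigenvalues (hA : A.IsHermitian) (v : Fin d → ℝ) :
    v ⬝ᵥ (A *ᵥ v) = ∑ i, hA.eigenvalues i * ⟪hA.eigenvectorBasis i, WithLp.toLp 2 v⟫_ℝ ^ 2 := by
  have h := (hA.eigenvectorBasis).sum_inner_mul_inner (WithLp.toLp 2 v) (WithLp.toLp 2 (A *ᵥ v))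
  have h1 : ⟪WithLp.toLp 2 v, WithLp.toLp 2 (A *ᵥ v)⟫_ℝ = v ⬝ᵥ (A *ᵥ v) := by
    simp [EuclideanSpace.inner_toLp_toLp, dotProduct_comm]
  rw [← h1, ← h]
  refine Finset.sum_congr rfl fun i _ => ?_
  have h2 : ⟪hA.eigenvectorBasis i, WithLp.toLp 2 (A *ᵥ v)⟫_ℝ =
      hA.eigenvalues i * ⟪hA.eigenvectorBasis i, WithLp.toLp 2 v⟫_ℝ := by
    have hT : Aᵀ = A := by
      have := hA.eq
      rwa [Matrix.conjTranspose_eq_transpose_of_trivial] at this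
    have h3 := hA.mulVec_eigenvectorBasis i
    simp only [EuclideanSpace.inner_eq_star_dotProduct, star_trivial]
    rw [dotProduct_comm, Matrix.dotProduct_mulVec, ← Matrix.mulVec_transpose, hT, h3,
      smul_dotProduct, dotProduct_comm, smul_eq_mul]
  rw [h2, real_inner_comm]
  ring

lemma dotProduct_self_eq_sum_eigenvectorBasis (hA : A.IsHermitian) (v : Fin d → ℝ) :
    v ⬝ᵥ v = ∑ i, ⟪hA.eigenvectorBasis i, WithLp.toLp 2 v⟫_ℝ ^ 2 := by
  have h := (hA.eigenvectorBasis).sum_sq_inner_right (WithLp.toLp 2 v)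
  rw [h, EuclideanSpace.real_norm_sq_eq]
  simp [dotProduct, sq]

lemma eigLower_of_eigenvalues (hA : A.IsHermitian) {a : ℝ}
    (h : ∀ i, a ≤ hA.eigenvalues i) : EigLower A a := fun v => by
  rw [quadForm_eq_sum_eigenvalues hA, dotProduct_self_eq_sum_eigenvectorBasis hA, Finset.mul_sum]
  exact Finset.sum_le_sum fun i _ => mul_le_mul_of_nonneg_right (h i) (sq_nonneg _)

lemma eigUpper_of_eigenvalues (hA : A.IsHermitian) {b : ℝ}
    (h : ∀ i, hA.eigenvalues i ≤ b) : EigUpper A b := fun v => by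
  rw [quadForm_eq_sum_eigenvalues hA, dotProduct_self_eq_sum_eigenvectorBasis hA, Finset.mul_sum]
  exact Finset.sum_le_sum fun i _ => mul_le_mul_of_nonneg_right (h i) (sq_nonneg _)

end Eigenvalues

/-! ### Concentration of the squared norm of a standard Gaussian vector -/

/-- Elementary bound that turns the moment generating function of a chi-square variable into a
sub-Gaussian one near zero. -/
lemma exp_neg_le_one_sub {t : ℝ} (ht : |t| ≤ 1 / 2) : Real.exp (-(t + t ^ 2)) ≤ 1 - t := by
  have ht' := abs_le.1 ht
  have key : 1 ≤ (1 - t) * Real.exp (t + t ^ 2) := by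
    rcases le_or_gt t 0 with h | h
    · have h1 := Real.add_one_le_exp (t + t ^ 2)
      have h2 : (1 - t) * (t + t ^ 2 + 1) ≤ (1 - t) * Real.exp (t + t ^ 2) :=
        mul_le_mul_of_nonneg_left h1 (by linarith)
      have h3 : t ^ 3 ≤ 0 := by
        have := mul_nonneg (sq_nonneg t) (neg_nonneg.2 h)
        nlinarith
      nlinarith
    · have h1 := Real.quadratic_le_exp_of_nonneg (x := t + t ^ 2) (by positivity)
      have h2 := mul_le_mul_of_nonneg_left h1 (show (0 : ℝ) ≤ 1 - t by linarith)
      have h3 : 0 ≤ t ^ 2 * ((1 + t) ^ 2 * (1 - t) / 2 - t) := by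
        refine mul_nonneg (sq_nonneg t) ?_
        nlinarith [mul_nonneg (sq_nonneg t) h.le, mul_pos h h, mul_nonneg h.le (sub_nonneg.2 ht'.2)]
      nlinarith
  rw [Real.exp_neg, inv_le_iff_one_le_mul₀ (Real.exp_pos _)]
  linarith

lemma gaussian_exp_sq {t : ℝ} (ht : t < 1) :
    Integrable (fun x : ℝ => Real.exp (t / 2 * x ^ 2)) (gaussianReal 0 1) ∧
    ∫ x, Real.exp (t / 2 * x ^ 2) ∂gaussianReal 0 1 = (√(1 - t))⁻¹ := by
  have hb : 0 < (1 - t) / 2 := by linarith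
  have hpdf : ∀ x : ℝ, gaussianPDFReal 0 1 x * Real.exp (t / 2 * x ^ 2) =
      (√(2 * Real.pi))⁻¹ * Real.exp (-((1 - t) / 2) * x ^ 2) := fun x => by
    rw [gaussianPDFReal_def]
    simp only [NNReal.coe_one, mul_one, sub_zero]
    rw [mul_assoc, ← Real.exp_add]
    congr 2
    ring
  constructor
  · rw [gaussianReal_of_var_ne_zero 0 one_ne_zero]
    rw [integrable_withDensity_iff (measurable_gaussianPDF 0 1)
      (ae_of_all _ fun _ => gaussianPDF_lt_top)]
    simp only [toReal_gaussianPDF]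
    refine ((integrable_exp_neg_mul_sq hb).const_mul (√(2 * Real.pi))⁻¹).congr
      (ae_of_all _ fun x => ?_)
    simp only
    rw [← hpdf x, mul_comm]
  · rw [integral_gaussianReal_eq_integral_smul one_ne_zero]
    simp only [smul_eq_mul, hpdf]
    rw [integral_const_mul, integral_gaussian, ← Real.sqrt_inv, ← Real.sqrt_mul (by positivity),
      ← Real.sqrt_inv]
    congr 1
    have : (1 - t) ≠ 0 := by linarith
    field_simp

section Norm

variable {E : Type*} [NormedAddCommGroup E] [InnerProductSpace ℝ E] [FiniteDimensional ℝ E]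
  [MeasurableSpace E] [BorelSpace E]

/-- The moment generating function of `‖x‖² / 2` under a standard Gaussian measure. -/
lemma stdGaussian_exp_norm_sq {t : ℝ} (ht : |t| ≤ 1 / 2) :
    Integrable (fun x : E => Real.exp (t / 2 * ‖x‖ ^ 2)) (stdGaussian E) ∧
    ∫ x, Real.exp (t / 2 * ‖x‖ ^ 2) ∂stdGaussian E ≤
      Real.exp (Module.finrank ℝ E * ((t + t ^ 2) / 2)) := by
  have ht1 : t < 1 := by linarith [(abs_le.1 ht).2]
  set e := stdOrthonormalBasis ℝ E
  have hT : Measurable fun x : Fin (Module.finrank ℝ E) → ℝ => ∑ i, x i • e i := by fun_prop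
  have hn : ∀ x : Fin (Module.finrank ℝ E) → ℝ,
      Real.exp (t / 2 * ‖∑ i, x i • e i‖ ^ 2) = ∏ i, Real.exp (t / 2 * x i ^ 2) := fun x => by
    rw [← Real.exp_sum, ← Finset.mul_sum, ← real_inner_self_eq_norm_sq,
      e.orthonormal.inner_sum]
    simp [sq]
  have hm : AEStronglyMeasurable (fun x : E => Real.exp (t / 2 * ‖x‖ ^ 2))
      (Measure.map (fun x : Fin (Module.finrank ℝ E) → ℝ => ∑ i, x i • e i)
        (Measure.pi fun _ => gaussianReal 0 1)) := by
    apply Continuous.aestronglyMeasurable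
    fun_prop
  have hint : Integrable (fun x : Fin (Module.finrank ℝ E) → ℝ => ∏ i, Real.exp (t / 2 * x i ^ 2))
      (Measure.pi fun _ => gaussianReal 0 1) :=
    Integrable.fintype_prod (f := fun _ y => Real.exp (t / 2 * y ^ 2))
      fun _ => (gaussian_exp_sq ht1).1
  constructor
  · rw [stdGaussian, integrable_map_measure hm hT.aemeasurable]
    refine hint.congr (ae_of_all _ fun x => ?_)
    simp only [Function.comp, hn]
  · rw [stdGaussian, integral_map hT.aemeasurable hm]
    simp only [hn]
    rw [integral_fintype_prod_eq_prod (fun _ y => Real.exp (t / 2 * y ^ 2))]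
    simp only [(gaussian_exp_sq ht1).2, Finset.prod_const, Finset.card_univ, Fintype.card_fin]
    rw [Real.exp_nat_mul]
    refine pow_le_pow_left₀ (by positivity) ?_ _
    rw [inv_le_comm₀ (Real.sqrt_pos.2 (by linarith)) (Real.exp_pos _), ← Real.exp_neg]
    refine Real.le_sqrt_of_sq_le ?_
    rw [← Real.exp_nat_mul]
    convert exp_neg_le_one_sub ht using 2
    push_cast
    ring

/-- Upper tail of the squared norm of a standard Gaussian vector, by the Chernoff bound with
parameter `δ / 4`. -/
lemma stdGaussian_norm_sq_ge {δ : ℝ} (h0 : 0 < δ) (h1 : δ < 1) :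
    stdGaussian E {x | (1 + δ) * Module.finrank ℝ E ≤ ‖x‖ ^ 2} ≤
      ENNReal.ofReal (Real.exp (-(δ ^ 2 / 8 * Module.finrank ℝ E))) := by
  have ht : |δ / 2| ≤ 1 / 2 := by rw [abs_of_pos (by linarith)]; linarith
  obtain ⟨hi, hle⟩ := stdGaussian_exp_norm_sq (E := E) ht
  have h := measure_ge_le_exp_mul_mgf (μ := stdGaussian E) (X := fun x : E => ‖x‖ ^ 2)
    ((1 + δ) * Module.finrank ℝ E) (t := δ / 2 / 2) (by positivity) hi
  rw [← ofReal_measureReal]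
  refine ENNReal.ofReal_le_ofReal (h.trans ?_)
  refine (mul_le_mul_of_nonneg_left hle (Real.exp_pos _).le).trans ?_
  rw [← Real.exp_add]
  refine Real.exp_le_exp.2 (le_of_eq ?_)
  ring

/-- Lower tail of the squared norm of a standard Gaussian vector, by the Chernoff bound with
parameter `-δ / 4`. -/
lemma stdGaussian_norm_sq_le {δ : ℝ} (h0 : 0 < δ) (h1 : δ < 1) :
    stdGaussian E {x | ‖x‖ ^ 2 ≤ (1 - δ) * Module.finrank ℝ E} ≤
      ENNReal.ofReal (Real.exp (-(δ ^ 2 / 8 * Module.finrank ℝ E))) := by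
  have ht : |-(δ / 2)| ≤ 1 / 2 := by rw [abs_neg, abs_of_pos (by linarith)]; linarith
  obtain ⟨hi, hle⟩ := stdGaussian_exp_norm_sq (E := E) ht
  have h := measure_le_le_exp_mul_mgf (μ := stdGaussian E) (X := fun x : E => ‖x‖ ^ 2)
    ((1 - δ) * Module.finrank ℝ E) (t := -(δ / 2) / 2) (by linarith) hi
  rw [← ofReal_measureReal]
  refine ENNReal.ofReal_le_ofReal (h.trans ?_)
  refine (mul_le_mul_of_nonneg_left hle (Real.exp_pos _).le).trans ?_
  rw [← Real.exp_add]
  refine Real.exp_le_exp.2 (le_of_eq ?_)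
  ring

/-- The orthogonal projection of a standard Gaussian vector to a subspace is a standard Gaussian
vector of the subspace. -/
lemma stdGaussian_map_orthogonalProjectionOnto (W : Submodule ℝ E) :
    (stdGaussian E).map W.orthogonalProjectionOnto = stdGaussian W := by
  have : IsProbabilityMeasure ((stdGaussian E).map W.orthogonalProjectionOnto) :=
    Measure.isProbabilityMeasure_map (by fun_prop)
  apply Measure.ext_of_charFun
  ext t
  have h : charFun ((stdGaussian E).map W.orthogonalProjectionOnto) t =
      charFun (stdGaussian E) (t : E) := by
    rw [charFun_apply, charFun_apply, integral_map (by fun_prop)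
      (Continuous.aestronglyMeasurable (by fun_prop))]
    refine integral_congr_ae (ae_of_all _ fun x => ?_)
    simp only
    rw [Submodule.inner_orthogonalProjectionOnto_eq_of_mem_right]
  rw [h, charFun_stdGaussian, charFun_stdGaussian]
  simp

/-- A proper subspace is a null set for a standard Gaussian measure. -/
lemma stdGaussian_submodule (W : Submodule ℝ E) (hW : W ≠ ⊤) : stdGaussian E (W : Set E) = 0 := by
  obtain ⟨v, hv, hv0⟩ : ∃ v ∈ Wᗮ, v ≠ 0 :=
    Submodule.exists_mem_ne_zero_of_ne_bot (by rwa [Ne, Submodule.orthogonal_eq_bot_iff])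
  have hmap := IsGaussian.map_eq_gaussianReal (μ := stdGaussian E) (innerSL ℝ v)
  rw [variance_dual_stdGaussian] at hmap
  have hne : (‖innerSL ℝ v‖ ^ 2).toNNReal ≠ 0 := by
    rw [innerSL_apply_norm]
    simpa using hv0
  have hsub : (W : Set E) ⊆ innerSL ℝ v ⁻¹' {0} := fun w hw => by
    simpa using Submodule.inner_left_of_mem_orthogonal hw hv
  refine measure_mono_null hsub ?_
  rw [← Measure.map_apply (innerSL ℝ v).measurable (measurableSet_singleton 0), hmap]
  have := nullSingletonClass_gaussianReal (μ := ∫ x, innerSL ℝ v x ∂stdGaussian E) hne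
  exact measure_singleton _

end Norm

/-! ### Gaussian matrices: symmetries and rank -/

instance (d k : ℕ) : IsProbabilityMeasure (gaussianMatrix d k) := by
  unfold gaussianMatrix; infer_instance

lemma gaussianMatrix_transpose (d k : ℕ) :
    MeasurePreserving (fun (S : Fin d → Fin k → ℝ) (j : Fin k) (i : Fin d) => S i j)
      (gaussianMatrix d k) (gaussianMatrix k d) := by
  refine ⟨by fun_prop, ?_⟩
  let τ : (Fin d → Fin k → ℝ) →L[ℝ] (Fin k → Fin d → ℝ) :=
    ContinuousLinearMap.pi fun j => ContinuousLinearMap.pi fun i =>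
      (ContinuousLinearMap.proj (R := ℝ) (φ := fun _ : Fin k => ℝ) j).comp
        (ContinuousLinearMap.proj (R := ℝ) (φ := fun _ : Fin d => Fin k → ℝ) i)
  have hτ : (fun (S : Fin d → Fin k → ℝ) (j : Fin k) (i : Fin d) => S i j) = τ := rfl
  rw [hτ]
  have : IsProbabilityMeasure ((gaussianMatrix d k).map τ) :=
    Measure.isProbabilityMeasure_map (by fun_prop)
  apply Measure.ext_of_charFunDual
  ext L
  rw [charFunDual_map]
  unfold gaussianMatrix
  simp only [charFunDual_pi]
  rw [Finset.prod_comm]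
  refine Finset.prod_congr rfl fun j _ => Finset.prod_congr rfl fun i _ => ?_
  congr 1
  ext
  simp only [ContinuousLinearMap.comp_apply, ContinuousLinearMap.single_apply]
  congr 1
  ext j' i'
  simp only [τ, ContinuousLinearMap.pi_apply, ContinuousLinearMap.comp_apply,
    ContinuousLinearMap.proj_apply, Pi.single_apply]
  split_ifs <;> simp_all

/-- A linear isometry of `ℝ^d` acting on the columns of a `d × k` matrix. -/
def actCols {d k : ℕ} (f : Vec d ≃ₗᵢ[ℝ] Vec d) (S : Fin d → Fin k → ℝ) : Fin d → Fin k → ℝ :=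
  fun i j => f (WithLp.toLp 2 fun i' => S i' j) i

lemma gaussian_measurePreserving_isometry {d : ℕ} (f : Vec d ≃ₗᵢ[ℝ] Vec d) :
    MeasurePreserving (fun x : Fin d → ℝ => WithLp.ofLp (f (WithLp.toLp 2 x)))
      (Measure.pi fun _ => gaussianReal 0 1) (Measure.pi fun _ => gaussianReal 0 1) := by
  have h1 : MeasurePreserving (WithLp.toLp 2 : (Fin d → ℝ) → Vec d)
      (Measure.pi fun _ => gaussianReal 0 1) (stdGaussian (Vec d)) :=
    ⟨by fun_prop, map_pi_eq_stdGaussian⟩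
  have h2 : MeasurePreserving f (stdGaussian (Vec d)) (stdGaussian (Vec d)) :=
    ⟨f.continuous.measurable, stdGaussian_map f⟩
  have h3 : MeasurePreserving (WithLp.ofLp : Vec d → (Fin d → ℝ)) (stdGaussian (Vec d))
      (Measure.pi fun _ => gaussianReal 0 1) := by
    refine ⟨by fun_prop, ?_⟩
    rw [← map_pi_eq_stdGaussian, Measure.map_map (by fun_prop) (by fun_prop)]
    exact Measure.map_id
  exact h3.comp (h2.comp h1)

/-- The law of a Gaussian matrix is invariant under rotations of its columns. -/
lemma gaussianMatrix_actCols {d k : ℕ} (f : Vec d ≃ₗᵢ[ℝ] Vec d) :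
    MeasurePreserving (actCols (k := k) f) (gaussianMatrix d k) (gaussianMatrix d k) := by
  have h : MeasurePreserving
      (fun (V : Fin k → Fin d → ℝ) j => WithLp.ofLp (f (WithLp.toLp 2 (V j))))
      (gaussianMatrix k d) (gaussianMatrix k d) :=
    measurePreserving_pi _ _ fun _ => gaussian_measurePreserving_isometry f
  exact (gaussianMatrix_transpose k d).comp (h.comp (gaussianMatrix_transpose d k))

lemma gaussian_pi_submodule {d : ℕ} (W : Submodule ℝ (Fin d → ℝ)) (hW : W ≠ ⊤) :
    (Measure.pi fun _ : Fin d => gaussianReal 0 1) (W : Set (Fin d → ℝ)) = 0 := by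
  set e := WithLp.linearEquiv 2 ℝ (Fin d → ℝ)
  have hW' : W.comap e.toLinearMap ≠ ⊤ := fun h => hW <| by
    rw [eq_top_iff]
    intro x _
    have : e.symm x ∈ W.comap e.toLinearMap := by rw [h]; trivial
    simpa using this
  have h := stdGaussian_submodule (E := Vec d) _ hW'
  rw [← map_pi_eq_stdGaussian, Measure.map_apply (by fun_prop)
    (Submodule.closed_of_finiteDimensional _).measurableSet] at h
  exact h

/-- Independent standard Gaussian vectors, at most as many as the dimension, are almost surely
linearly independent. -/
lemma ae_linearIndependent_gaussian {d : ℕ} : ∀ k : ℕ, k ≤ d →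
    ∀ᵐ V ∂gaussianMatrix k d, LinearIndependent ℝ V := by
  intro k
  induction k with
  | zero => intro _; exact ae_of_all _ fun V => linearIndependent_empty_type
  | succ k ih =>
    intro hk
    have ih' := ih (by omega)
    have hmp := measurePreserving_piFinSuccAbove
      (fun _ : Fin (k + 1) => Measure.pi fun _ : Fin d => gaussianReal 0 1) 0
    have hs : MeasurableSet {z : (Fin k → Fin d → ℝ) × (Fin d → ℝ) |
        LinearIndependent ℝ (Fin.cons z.2 z.1 : Fin (k + 1) → Fin d → ℝ)} := by
      have ho : IsOpen {V : Fin (k + 1) → Fin d → ℝ | LinearIndependent ℝ V} :=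
        isOpen_setOfPred_linearIndependent
      refine (ho.preimage ?_).measurableSet
      refine continuous_pi fun i => ?_
      refine Fin.cases ?_ (fun i => ?_) i
      · simpa using continuous_snd
      · simp only [Fin.cons_succ]
        fun_prop
    have hprod : ∀ᵐ z ∂(gaussianMatrix k d).prod (Measure.pi fun _ : Fin d => gaussianReal 0 1),
        LinearIndependent ℝ (Fin.cons z.2 z.1 : Fin (k + 1) → Fin d → ℝ) := by
      refine (Measure.ae_prod_mem_iff_ae_ae_mem hs).2 ?_
      filter_upwards [ih'] with V hV
      have hspan : Submodule.span ℝ (Set.range V) ≠ ⊤ := fun h => by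
        have h1 := finrank_range_le_card (R := ℝ) V
        rw [Set.finrank, h, finrank_top] at h1
        simp at h1
        omega
      have h0 := gaussian_pi_submodule _ hspan
      rw [ae_iff]
      refine measure_mono_null (fun x hx => ?_) h0
      by_contra hx'
      exact hx (linearIndependent_finCons.2 ⟨hV, hx'⟩)
    have hswap := Measure.measurePreserving_swap
      (μ := Measure.pi fun _ : Fin d => gaussianReal 0 1) (ν := gaussianMatrix k d)
    have := (hswap.comp hmp).quasiMeasurePreserving.ae hprod
    unfold gaussianMatrix
    filter_upwards [this] with V hV
    convert hV using 1
    ext i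
    refine Fin.cases ?_ (fun i => ?_) i
    all_goals simp [MeasurableEquiv.piFinSuccAbove]
    all_goals rfl

/-- A Gaussian matrix with at least as many rows as columns almost surely has full column rank. -/
lemma ae_injective_gaussianMatrix {d k : ℕ} (hk : k ≤ d) :
    ∀ᵐ S ∂gaussianMatrix d k, Function.Injective (Matrix.of S).mulVec := by
  filter_upwards [(gaussianMatrix_transpose d k).quasiMeasurePreserving.ae
    (ae_linearIndependent_gaussian k hk)] with S hS
  exact Matrix.mulVec_injective_iff.2 hS

/-! ### Measurability of sketched quantities -/

section Measurability

variable {α : Type*} [MeasurableSpace α]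

lemma measurable_det {m : ℕ} {f : α → Matrix (Fin m) (Fin m) ℝ}
    (hf : ∀ i j, Measurable fun a => f a i j) : Measurable fun a => (f a).det := by
  simp only [Matrix.det_apply]
  refine Finset.measurable_sum _ fun σ _ => ?_
  exact (Finset.measurable_prod _ fun i _ => hf _ _).const_smul _

lemma measurable_inv_apply {m : ℕ} {f : α → Matrix (Fin m) (Fin m) ℝ}
    (hf : ∀ i j, Measurable fun a => f a i j) (i j : Fin m) :
    Measurable fun a => (f a)⁻¹ i j := by
  simp only [Matrix.inv_def, Matrix.smul_apply, Matrix.adjugate_apply, Ring.inverse_eq_inv',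
    smul_eq_mul]
  refine (measurable_det hf).inv.mul (measurable_det fun i' j' => ?_)
  simp only [Matrix.updateRow_apply]
  split_ifs
  · exact measurable_const
  · exact hf _ _

lemma measurable_mul_apply {l m n : ℕ} {f : α → Matrix (Fin l) (Fin m) ℝ}
    {g : α → Matrix (Fin m) (Fin n) ℝ} (hf : ∀ i j, Measurable fun a => f a i j)
    (hg : ∀ i j, Measurable fun a => g a i j) (i : Fin l) (j : Fin n) :
    Measurable fun a => (f a * g a) i j := by
  simp only [Matrix.mul_apply]
  exact Finset.measurable_sum _ fun x _ => (hf i x).mul (hg x j)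

lemma measurable_mulVec_apply {l m : ℕ} {f : α → Matrix (Fin l) (Fin m) ℝ}
    {g : α → Fin m → ℝ} (hf : ∀ i j, Measurable fun a => f a i j)
    (hg : ∀ i, Measurable fun a => g a i) (i : Fin l) :
    Measurable fun a => (f a *ᵥ g a) i := by
  simp only [Matrix.mulVec, dotProduct]
  exact Finset.measurable_sum _ fun x _ => (hf i x).mul (hg x)

lemma measurable_sketchVec_apply {d k : ℕ} {A : α → Matrix (Fin d) (Fin d) ℝ}
    {S : α → Matrix (Fin d) (Fin k) ℝ} {u : α → Fin d → ℝ}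
    (hA : ∀ i j, Measurable fun a => A a i j) (hS : ∀ i j, Measurable fun a => S a i j)
    (hu : ∀ i, Measurable fun a => u a i) (i : Fin d) :
    Measurable fun a => sketchVec (A a) (S a) (u a) i := by
  have hST : ∀ i j, Measurable fun a => (S a)ᵀ i j := fun i j => hS j i
  exact measurable_mulVec_apply hS (measurable_mulVec_apply (measurable_inv_apply
    (measurable_mul_apply (measurable_mul_apply hST hA) hS)) (measurable_mulVec_apply hST hu)) i

lemma measurable_sketchForm {d k : ℕ} {A : α → Matrix (Fin d) (Fin d) ℝ}
    {S : α → Matrix (Fin d) (Fin k) ℝ} {u : α → Fin d → ℝ}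
    (hA : ∀ i j, Measurable fun a => A a i j) (hS : ∀ i j, Measurable fun a => S a i j)
    (hu : ∀ i, Measurable fun a => u a i) : Measurable fun a => sketchForm (A a) (S a) (u a) := by
  simp only [sketchForm, dotProduct]
  exact Finset.measurable_sum _ fun x _ => (hu x).mul (measurable_sketchVec_apply hA hS hu x)

end Measurability

/-! ### Random projections of a fixed vector -/

lemma sketchForm_one_eq {d k : ℕ} (S : Matrix (Fin d) (Fin k) ℝ) (u : Fin d → ℝ) :
    sketchForm 1 S u = (Sᵀ *ᵥ u) ⬝ᵥ ((Sᵀ * S)⁻¹ *ᵥ (Sᵀ *ᵥ u)) := by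
  rw [sketchForm, ← dotProduct_sketchVec, Matrix.mul_one]

lemma sketchForm_smul {d k : ℕ} (A : Matrix (Fin d) (Fin d) ℝ) (S : Matrix (Fin d) (Fin k) ℝ)
    (c : ℝ) (u : Fin d → ℝ) : sketchForm A S (c • u) = c ^ 2 * sketchForm A S u := by
  simp only [sketchForm, sketchVec, Matrix.mulVec_smul, smul_dotProduct, dotProduct_smul,
    smul_eq_mul]
  ring

lemma sum_mul_eq_inner {d : ℕ} (x y : Vec d) : ∑ i, x i * y i = ⟪x, y⟫_ℝ := by
  simp [PiLp.inner_apply, mul_comm]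

/-- Rotating the sketch and the vector together does not change the sketched form. -/
lemma sketchForm_one_actCols {d k : ℕ} (f : Vec d ≃ₗᵢ[ℝ] Vec d) (S : Fin d → Fin k → ℝ)
    (u : Fin d → ℝ) :
    sketchForm 1 (Matrix.of (actCols f S)) (WithLp.ofLp (f (WithLp.toLp 2 u))) =
      sketchForm 1 (Matrix.of S) u := by
  have h1 : (Matrix.of (actCols f S))ᵀ * Matrix.of (actCols f S) =
      (Matrix.of S)ᵀ * Matrix.of S := by
    ext j j'
    simp only [Matrix.mul_apply, Matrix.transpose_apply, Matrix.of_apply, actCols]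
    rw [sum_mul_eq_inner, f.inner_map_map, ← sum_mul_eq_inner]
  have h2 : (Matrix.of (actCols f S))ᵀ *ᵥ (WithLp.ofLp (f (WithLp.toLp 2 u))) =
      (Matrix.of S)ᵀ *ᵥ u := by
    ext j
    simp only [Matrix.mulVec, dotProduct, Matrix.transpose_apply, Matrix.of_apply, actCols]
    rw [sum_mul_eq_inner, f.inner_map_map, ← sum_mul_eq_inner]
  rw [sketchForm_one_eq, sketchForm_one_eq, h1, h2]

lemma norm_toLp_sq {d : ℕ} (u : Fin d → ℝ) : ‖WithLp.toLp 2 u‖ ^ 2 = u ⬝ᵥ u := by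
  rw [EuclideanSpace.real_norm_sq_eq]
  simp [dotProduct, sq]

lemma measurable_sketchForm_one {d k : ℕ} :
    Measurable fun z : (Fin d → Fin k → ℝ) × (Fin d → ℝ) =>
      sketchForm 1 (Matrix.of z.1) z.2 :=
  measurable_sketchForm (α := (Fin d → Fin k → ℝ) × (Fin d → ℝ)) (A := fun _ => 1)
    (S := fun z => Matrix.of z.1) (u := fun z => z.2) (fun _ _ => measurable_const)
    (fun i j => by simp only [Matrix.of_apply]; fun_prop) (fun i => by fun_prop)

/-- The law of the sketched form of `u` depends on the length of `u` only. -/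
lemma lintegral_sketchForm_congr {d k : ℕ} {u u' : Fin d → ℝ} (h : u ⬝ᵥ u = u' ⬝ᵥ u')
    {F : ℝ → ℝ≥0∞} (hF : Measurable F) :
    ∫⁻ S, F (sketchForm 1 (Matrix.of S) u) ∂gaussianMatrix d k =
      ∫⁻ S, F (sketchForm 1 (Matrix.of S) u') ∂gaussianMatrix d k := by
  have hn : ‖(WithLp.toLp 2 u : Vec d)‖ = ‖(WithLp.toLp 2 u' : Vec d)‖ := by
    rw [← sq_eq_sq₀ (norm_nonneg _) (norm_nonneg _), norm_toLp_sq, norm_toLp_sq, h]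
  obtain ⟨f, hf⟩ : ∃ f : Vec d ≃ₗᵢ[ℝ] Vec d, f (WithLp.toLp 2 u) = WithLp.toLp 2 u' :=
    ⟨_, Submodule.reflection_sub hn⟩
  have hm : Measurable fun S : Fin d → Fin k → ℝ => F (sketchForm 1 (Matrix.of S) u') :=
    hF.comp (measurable_sketchForm_one.comp (measurable_id.prodMk measurable_const))
  rw [← (gaussianMatrix_actCols f).lintegral_comp hm]
  refine lintegral_congr fun S => ?_
  have := sketchForm_one_actCols f S u
  rw [hf] at this
  exact congrArg F this.symm

/-- The sketched form of the identity is the squared length of the orthogonal projection to the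
range of the sketch. -/
lemma exists_sketchForm_eq_norm_proj {d k : ℕ} {S : Matrix (Fin d) (Fin k) ℝ}
    (hS : Function.Injective S.mulVec) :
    ∃ W : Submodule ℝ (Vec d), Module.finrank ℝ W = k ∧
      ∀ u, sketchForm 1 S u = ‖W.orthogonalProjectionOnto (WithLp.toLp 2 u)‖ ^ 2 := by
  let T : (Fin k → ℝ) →ₗ[ℝ] Vec d :=
    (WithLp.linearEquiv 2 ℝ (Fin d → ℝ)).symm.toLinearMap ∘ₗ S.mulVecLin
  have hT : ∀ x, T x = WithLp.toLp 2 (S *ᵥ x) := fun x => rfl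
  have hTi : Function.Injective T := fun x y hxy => hS (by
    have := congrArg WithLp.ofLp hxy
    simpa [hT] using this)
  refine ⟨LinearMap.range T, ?_, fun u => ?_⟩
  · rw [LinearMap.finrank_range_of_inj hTi]
    simp
  · have hpd := posDef_sketch (Matrix.PosDef.one (n := Fin d) (R := ℝ)) hS
    have hu := (Matrix.isUnit_iff_isUnit_det _).1 hpd.isUnit
    set y := (Sᵀ * (1 : Matrix (Fin d) (Fin d) ℝ) * S)⁻¹ *ᵥ (Sᵀ *ᵥ u) with hy
    have hy1 : Sᵀ *ᵥ (S *ᵥ y) = Sᵀ *ᵥ u := by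
      rw [Matrix.mulVec_mulVec]
      have h1 : (Sᵀ * (1 : Matrix (Fin d) (Fin d) ℝ) * S) *ᵥ y = Sᵀ *ᵥ u := by
        rw [hy, Matrix.mulVec_mulVec, Matrix.mul_nonsing_inv _ hu, Matrix.one_mulVec]
      rwa [Matrix.mul_one] at h1
    have hproj : (LinearMap.range T).starProjection (WithLp.toLp 2 u) = T y := by
      refine Submodule.eq_starProjection_of_mem_of_inner_eq_zero (LinearMap.mem_range_self T y) ?_
      rintro _ ⟨x, rfl⟩
      rw [hT, hT, ← WithLp.toLp_sub, EuclideanSpace.inner_toLp_toLp, star_trivial,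
        dotProduct_comm, Matrix.dotProduct_mulVec, ← Matrix.mulVec_transpose,
        Matrix.mulVec_sub, hy1]
      simp
    have h2 := Submodule.re_inner_starProjection_eq_normSq (K := LinearMap.range T) (𝕜 := ℝ)
      (WithLp.toLp 2 u)
    rw [← h2, hproj, hT]
    simp only [RCLike.re_to_real, EuclideanSpace.inner_toLp_toLp, star_trivial]
    rfl

/-- For a fixed subspace `W` of dimension `k`, the relative squared length of the projection of a
Gaussian vector to `W` is close to `k / d`: numerator and denominator concentrate separately, each
up to a factor `1 ± δ / 3`. -/
lemma gaussian_proj_concentration {d : ℕ} (W : Submodule ℝ (Vec d)) {δ : ℝ} (h0 : 0 < δ)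
    (h1 : δ < 1) :
    stdGaussian (Vec d) {x |
      ¬ ((1 - δ) * (Module.finrank ℝ W / d) * ‖x‖ ^ 2 ≤ ‖W.orthogonalProjectionOnto x‖ ^ 2 ∧
        ‖W.orthogonalProjectionOnto x‖ ^ 2 ≤ (1 + δ) * (Module.finrank ℝ W / d) * ‖x‖ ^ 2)} ≤
      ENNReal.ofReal (4 * Real.exp (-(δ ^ 2 / 72 * Module.finrank ℝ W))) := by
  set k := Module.finrank ℝ W with hk
  have hkd : k ≤ d := by simpa using Submodule.finrank_le W
  have ha0 : 0 < δ / 3 := by positivity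
  have ha1 : δ / 3 < 1 := by linarith
  set r := Real.exp (-(δ ^ 2 / 72 * k)) with hr
  have hfd : Module.finrank ℝ (Vec d) = d := by simp
  have hmap : ∀ s : Set W, MeasurableSet s →
      stdGaussian (Vec d) (W.orthogonalProjectionOnto ⁻¹' s) = stdGaussian W s := fun s hs => by
    rw [← stdGaussian_map_orthogonalProjectionOnto W, Measure.map_apply (by fun_prop) hs]
  have e1 : Real.exp (-((δ / 3) ^ 2 / 8 * k)) = r := by rw [hr]; congr 1; ring
  have e2 : Real.exp (-((δ / 3) ^ 2 / 8 * d)) ≤ r := by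
    rw [hr]
    refine Real.exp_le_exp.2 ?_
    have : (k : ℝ) ≤ d := by exact_mod_cast hkd
    nlinarith [sq_nonneg δ]
  have b1 : stdGaussian (Vec d) (W.orthogonalProjectionOnto ⁻¹' {x | (1 + δ / 3) * k ≤ ‖x‖ ^ 2}) ≤
      ENNReal.ofReal r := by
    rw [hmap _ (measurableSet_le (by fun_prop) (by fun_prop)), ← e1]
    exact stdGaussian_norm_sq_ge ha0 ha1
  have b2 : stdGaussian (Vec d) (W.orthogonalProjectionOnto ⁻¹' {x | ‖x‖ ^ 2 ≤ (1 - δ / 3) * k}) ≤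
      ENNReal.ofReal r := by
    rw [hmap _ (measurableSet_le (by fun_prop) (by fun_prop)), ← e1]
    exact stdGaussian_norm_sq_le ha0 ha1
  have b3 : stdGaussian (Vec d) {x | (1 + δ / 3) * d ≤ ‖x‖ ^ 2} ≤ ENNReal.ofReal r := by
    have := stdGaussian_norm_sq_ge (E := Vec d) ha0 ha1
    rw [hfd] at this
    exact this.trans (ENNReal.ofReal_le_ofReal e2)
  have b4 : stdGaussian (Vec d) {x | ‖x‖ ^ 2 ≤ (1 - δ / 3) * d} ≤ ENNReal.ofReal r := by
    have := stdGaussian_norm_sq_le (E := Vec d) ha0 ha1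
    rw [hfd] at this
    exact this.trans (ENNReal.ofReal_le_ofReal e2)
  have hr0 : 0 ≤ r := (Real.exp_pos _).le
  have hsum : ENNReal.ofReal (4 * r) = ENNReal.ofReal r + ENNReal.ofReal r + ENNReal.ofReal r +
      ENNReal.ofReal r := by
    rw [← ENNReal.ofReal_add hr0 hr0, ← ENNReal.ofReal_add (by positivity) hr0,
      ← ENNReal.ofReal_add (by positivity) hr0]
    congr 1
    ring
  rw [hsum]
  refine (measure_mono ?_).trans ((measure_union_le _ _).trans (add_le_add
    ((measure_union_le _ _).trans (add_le_add ((measure_union_le _ _).trans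
      (add_le_add b1 b2)) b3)) b4))
  intro x hx
  by_contra hcon
  simp only [Set.mem_union, Set.mem_preimage, Set.mem_ofPred_eq, not_or, not_le] at hcon
  obtain ⟨⟨⟨c1, c2⟩, c3⟩, c4⟩ := hcon
  refine hx ?_
  rcases Nat.eq_zero_or_pos d with hd | hd
  · have : k = 0 := by omega
    have hk0 : (k : ℝ) = 0 := by exact_mod_cast this
    rw [hk0] at c1 c2
    linarith
  have hd' : (0 : ℝ) < d := by exact_mod_cast hd
  have hk' : (0 : ℝ) ≤ k := Nat.cast_nonneg k
  have hkd0 : (0 : ℝ) ≤ k / d := by positivity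
  have hkk : (k : ℝ) / d * d = k := by field_simp
  constructor
  · have h3 : (1 - δ) * (k / d) * ‖x‖ ^ 2 ≤ (1 - δ) * (k / d) * ((1 + δ / 3) * d) :=
      mul_le_mul_of_nonneg_left c3.le (mul_nonneg (by linarith) hkd0)
    have h4 : (1 - δ) * (k / d) * ((1 + δ / 3) * d) = (1 - δ) * (1 + δ / 3) * k := by
      rw [← hkk]; ring_nf; field_simp
    have h5 : (1 - δ) * (1 + δ / 3) * k ≤ (1 - δ / 3) * k := by
      refine mul_le_mul_of_nonneg_right ?_ hk'
      nlinarith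
    linarith
  · have h3 : (1 + δ) * (k / d) * ((1 - δ / 3) * d) ≤ (1 + δ) * (k / d) * ‖x‖ ^ 2 :=
      mul_le_mul_of_nonneg_left c4.le (mul_nonneg (by linarith) hkd0)
    have h4 : (1 + δ) * (k / d) * ((1 - δ / 3) * d) = (1 + δ) * (1 - δ / 3) * k := by
      rw [← hkk]; ring_nf; field_simp
    have h5 : (1 + δ / 3) * k ≤ (1 + δ) * (1 - δ / 3) * k := by
      refine mul_le_mul_of_nonneg_right ?_ hk'
      nlinarith
    linarith

/-- Concentration of the squared length of the projection of a fixed vector to a random subspace.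
By rotation invariance the fixed vector may be replaced by a Gaussian vector independent of the
sketch, whose projection to the given range of the sketch is again Gaussian. -/
lemma gaussianMatrix_sketchForm_concentration {d k : ℕ} (hkd : k ≤ d) {u : Fin d → ℝ} (hu : u ≠ 0)
    {δ : ℝ} (h0 : 0 < δ) (h1 : δ < 1) :
    gaussianMatrix d k {S | ¬ ((1 - δ) * (k / d) * (u ⬝ᵥ u) ≤ sketchForm 1 (Matrix.of S) u ∧
        sketchForm 1 (Matrix.of S) u ≤ (1 + δ) * (k / d) * (u ⬝ᵥ u))} ≤
      ENNReal.ofReal (4 * Real.exp (-(δ ^ 2 / 72 * k))) := by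
  set γ : Measure (Fin d → ℝ) := Measure.pi fun _ => gaussianReal 0 1 with hγ
  set B : Set ((Fin d → Fin k → ℝ) × (Fin d → ℝ)) := {z |
    ¬ ((1 - δ) * (k / d) * (z.2 ⬝ᵥ z.2) ≤ sketchForm 1 (Matrix.of z.1) z.2 ∧
        sketchForm 1 (Matrix.of z.1) z.2 ≤ (1 + δ) * (k / d) * (z.2 ⬝ᵥ z.2))} with hB
  have hdot : Measurable fun z : (Fin d → Fin k → ℝ) × (Fin d → ℝ) => z.2 ⬝ᵥ z.2 := by
    simp only [dotProduct]; fun_prop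
  have hBm : MeasurableSet B :=
    ((measurableSet_le (hdot.const_mul _) measurable_sketchForm_one).inter
      (measurableSet_le measurable_sketchForm_one (hdot.const_mul _))).compl
  have hdpos : 0 < u ⬝ᵥ u := by simpa using Matrix.dotProduct_star_self_pos_iff.2 hu
  -- the probability of the bad event is the same for every nonzero vector
  have hsame : ∀ g : Fin d → ℝ, g ≠ 0 → gaussianMatrix d k ((fun S => (S, g)) ⁻¹' B) =
      gaussianMatrix d k ((fun S => (S, u)) ⁻¹' B) := fun g hg => by
    have hgpos : 0 < g ⬝ᵥ g := by simpa using Matrix.dotProduct_star_self_pos_iff.2 hg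
    set c := √(u ⬝ᵥ u / (g ⬝ᵥ g)) with hc
    have hcpos : 0 < c := Real.sqrt_pos.2 (by positivity)
    have hc2 : c ^ 2 = u ⬝ᵥ u / (g ⬝ᵥ g) := Real.sq_sqrt (by positivity)
    have hcg : c ^ 2 * (g ⬝ᵥ g) = u ⬝ᵥ u := by rw [hc2]; field_simp
    set R : Set ℝ := (Set.Icc ((1 - δ) * (k / d) * (u ⬝ᵥ u)) ((1 + δ) * (k / d) * (u ⬝ᵥ u)))ᶜ
    have hR : MeasurableSet R := measurableSet_Icc.compl
    have key := lintegral_sketchForm_congr (k := k) (u := c • g) (u' := u)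
      (by rw [smul_dotProduct, dotProduct_smul, smul_eq_mul, smul_eq_mul, ← mul_assoc, ← sq, hcg])
      (F := R.indicator 1) (measurable_one.indicator hR)
    have hm : ∀ w : Fin d → ℝ, Measurable fun S : Fin d → Fin k → ℝ =>
        sketchForm 1 (Matrix.of S) w := fun w =>
      measurable_sketchForm_one.comp (measurable_id.prodMk measurable_const)
    have hind : ∀ w : Fin d → ℝ, ∫⁻ S, R.indicator 1 (sketchForm 1 (Matrix.of S) w)
        ∂gaussianMatrix d k = gaussianMatrix d k {S | sketchForm 1 (Matrix.of S) w ∈ R} :=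
      fun w => by
        have h := lintegral_indicator_one (μ := gaussianMatrix d k) (hm w hR)
        exact h
    rw [hind, hind] at key
    rw [show ((fun S => (S, u)) ⁻¹' B) = {S | sketchForm 1 (Matrix.of S) u ∈ R} from rfl, ← key]
    congr 1
    ext S
    simp only [hB, Set.mem_preimage, Set.mem_ofPred_eq, R, Set.mem_compl_iff, Set.mem_Icc,
      sketchForm_smul]
    have hc2pos : 0 < c ^ 2 := by positivity
    rw [← hcg, not_iff_not]
    refine and_congr ?_ ?_
    · rw [show (1 - δ) * (k / d) * (c ^ 2 * (g ⬝ᵥ g)) = c ^ 2 * ((1 - δ) * (k / d) * (g ⬝ᵥ g)) by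
        ring, mul_le_mul_iff_right₀ hc2pos]
    · rw [show (1 + δ) * (k / d) * (c ^ 2 * (g ⬝ᵥ g)) = c ^ 2 * ((1 + δ) * (k / d) * (g ⬝ᵥ g)) by
        ring, mul_le_mul_iff_right₀ hc2pos]
  have hne : ∀ᵐ g ∂γ, g ≠ 0 := by
    have hbot : (⊥ : Submodule ℝ (Fin d → ℝ)) ≠ ⊤ := fun h => hu <| by
      have : u ∈ (⊥ : Submodule ℝ (Fin d → ℝ)) := by rw [h]; trivial
      simpa using this
    have := gaussian_pi_submodule _ hbot
    rw [Submodule.bot_coe] at this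
    rw [ae_iff]
    simp only [ne_eq, not_not]
    exact this
  have hγS : (gaussianMatrix d k).prod γ B = gaussianMatrix d k ((fun S => (S, u)) ⁻¹' B) := by
    rw [Measure.prod_apply_symm hBm, lintegral_congr_ae (hne.mono fun g hg => hsame g hg)]
    simp
  change gaussianMatrix d k ((fun S => (S, u)) ⁻¹' B) ≤ _
  rw [← hγS, Measure.prod_apply hBm]
  calc ∫⁻ S, γ (Prod.mk S ⁻¹' B) ∂gaussianMatrix d k
      ≤ ∫⁻ _, ENNReal.ofReal (4 * Real.exp (-(δ ^ 2 / 72 * k))) ∂gaussianMatrix d k := by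
        refine lintegral_mono_ae ?_
        filter_upwards [ae_injective_gaussianMatrix hkd] with S hS
        obtain ⟨W, hWk, hW⟩ := exists_sketchForm_eq_norm_proj hS
        have h := gaussian_proj_concentration W h0 h1
        rw [hWk, ← map_pi_eq_stdGaussian, Measure.map_apply (by fun_prop)] at h
        · refine le_trans (measure_mono ?_) h
          intro g hg
          simpa only [Set.mem_preimage, Set.mem_ofPred_eq, norm_toLp_sq, ← hW, hB] using hg
        · have m1 : Measurable fun x : Vec d => ‖x‖ ^ 2 := by fun_prop
          have m2 : Measurable fun x : Vec d => ‖W.orthogonalProjectionOnto x‖ ^ 2 := by fun_prop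
          exact ((measurableSet_le (m1.const_mul _) m2).inter
            (measurableSet_le m2 (m1.const_mul _))).compl
    _ = _ := by simp

/-- The trace of the projection to the range of the sketch is its rank. -/
lemma sum_sketchForm_single {d k : ℕ} {S : Matrix (Fin d) (Fin k) ℝ}
    (hS : Function.Injective S.mulVec) : ∑ a, sketchForm 1 S (Pi.single a 1) = k := by
  have hu := (Matrix.isUnit_iff_isUnit_det _).1
    (posDef_sketch (Matrix.PosDef.one (n := Fin d) (R := ℝ)) hS).isUnit
  have h : ∀ a, sketchForm 1 S (Pi.single a 1) =
      (S * ((Sᵀ * (1 : Matrix (Fin d) (Fin d) ℝ) * S)⁻¹ * Sᵀ)) a a := fun a => by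
    rw [sketchForm, sketchVec, Matrix.mulVec_mulVec, Matrix.mulVec_mulVec]
    simp [Matrix.mul_assoc]
  simp only [h]
  change Matrix.trace _ = _
  rw [Matrix.trace_mul_comm, Matrix.mul_assoc]
  rw [Matrix.mul_one] at hu ⊢
  rw [Matrix.nonsing_inv_mul _ hu]
  simp

/-- The expected squared length of the projection of `u` to a random `k`-dimensional subspace. -/
lemma lintegral_sketchForm {d k : ℕ} (hkd : k ≤ d) (hd : d ≠ 0) (u : Fin d → ℝ) :
    ∫⁻ S, ENNReal.ofReal (sketchForm 1 (Matrix.of S) u) ∂gaussianMatrix d k =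
      ENNReal.ofReal (k / d * (u ⬝ᵥ u)) := by
  have hn : 0 ≤ u ⬝ᵥ u := norm_toLp_sq u ▸ sq_nonneg _
  have h1 : ∀ a : Fin d, ∫⁻ S, ENNReal.ofReal (sketchForm 1 (Matrix.of S) u) ∂gaussianMatrix d k =
      ∫⁻ S, ENNReal.ofReal (u ⬝ᵥ u * sketchForm 1 (Matrix.of S) (Pi.single a 1))
        ∂gaussianMatrix d k := fun a => by
    rw [lintegral_sketchForm_congr (u' := √(u ⬝ᵥ u) • Pi.single a 1) _ ENNReal.measurable_ofReal]
    · simp only [sketchForm_smul, Real.sq_sqrt hn]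
    · simp [Real.mul_self_sqrt hn]
  have h2 : (d : ℝ≥0∞) * ∫⁻ S, ENNReal.ofReal (sketchForm 1 (Matrix.of S) u) ∂gaussianMatrix d k =
      ENNReal.ofReal (u ⬝ᵥ u * k) := by
    have : (d : ℝ≥0∞) * ∫⁻ S, ENNReal.ofReal (sketchForm 1 (Matrix.of S) u) ∂gaussianMatrix d k =
        ∑ a : Fin d, ∫⁻ S, ENNReal.ofReal (u ⬝ᵥ u * sketchForm 1 (Matrix.of S) (Pi.single a 1))
        ∂gaussianMatrix d k := by
      rw [← Finset.sum_congr rfl fun a _ => h1 a]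
      simp
    rw [this, ← lintegral_finsetSum]
    · have hae : ∀ᵐ S ∂gaussianMatrix d k, ∑ a : Fin d, ENNReal.ofReal
          (u ⬝ᵥ u * sketchForm 1 (Matrix.of S) (Pi.single a 1)) = ENNReal.ofReal (u ⬝ᵥ u * k) := by
        filter_upwards [ae_injective_gaussianMatrix hkd] with S hS
        rw [← ENNReal.ofReal_sum_of_nonneg, ← Finset.mul_sum, sum_sketchForm_single hS]
        exact fun a _ => mul_nonneg hn (sketchForm_nonneg Matrix.PosDef.one hS _)
      rw [lintegral_congr_ae hae]
      simp
    · intro a _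
      exact ENNReal.measurable_ofReal.comp ((measurable_sketchForm_one.comp
        (measurable_id.prodMk measurable_const)).const_mul _)
  have hd0 : (d : ℝ≥0∞) ≠ 0 := by exact_mod_cast hd
  have hd' : (d : ℝ) ≠ 0 := by exact_mod_cast hd
  rw [← ENNReal.mul_right_inj hd0 (ENNReal.natCast_ne_top d), h2, ← ENNReal.ofReal_natCast,
    ← ENNReal.ofReal_mul (Nat.cast_nonneg d)]
  congr 1
  field_simp

lemma gaussianMatrix_sketchForm_markov {d k : ℕ} (hkd : k ≤ d) (hd : d ≠ 0) (u : Fin d → ℝ) {t : ℝ}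
    (ht : 0 < t) :
    gaussianMatrix d k {S | t * (k / d * (u ⬝ᵥ u)) < sketchForm 1 (Matrix.of S) u} ≤
      ENNReal.ofReal (1 / t) := by
  have hn : 0 ≤ u ⬝ᵥ u := norm_toLp_sq u ▸ sq_nonneg _
  have hm : Measurable fun S : Fin d → Fin k → ℝ =>
      ENNReal.ofReal (sketchForm 1 (Matrix.of S) u) :=
    ENNReal.measurable_ofReal.comp (measurable_sketchForm_one.comp
      (measurable_id.prodMk measurable_const))
  set m := (k : ℝ) / d * (u ⬝ᵥ u) with hmdef
  have hm0 : 0 ≤ m := by positivity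
  have hE := lintegral_sketchForm hkd hd u
  rw [← hmdef] at hE
  rcases hm0.eq_or_lt with h | h
  · rw [← h, ENNReal.ofReal_zero, lintegral_eq_zero_iff hm] at hE
    refine le_of_eq_of_le ?_ zero_le
    rw [← nonpos_iff_eq_zero, ← (ae_iff.1 hE)]
    refine measure_mono fun S hS => ?_
    simp only [Set.mem_ofPred_eq, ← h, mul_zero] at hS
    simpa using hS
  · have h1 := meas_ge_le_lintegral_div (μ := gaussianMatrix d k) hm.aemeasurable
      (ε := ENNReal.ofReal (t * m)) (by simpa using mul_pos ht h) ENNReal.ofReal_ne_top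
    rw [hE, ← ENNReal.ofReal_div_of_pos (mul_pos ht h),
      show m / (t * m) = 1 / t by field_simp] at h1
    refine le_trans (measure_mono fun S hS => ?_) h1
    exact ENNReal.ofReal_le_ofReal (le_of_lt hS)

/-- Deterministic comparison: the ratio of the sketched to the full quadratic form is, up to the
condition number, the squared relative length of the projection of `u` to the range of `S`. -/
lemma sketch_ratio_bounds {d k : ℕ} {A : Matrix (Fin d) (Fin d) ℝ} (hA : A.PosDef)
    {S : Matrix (Fin d) (Fin k) ℝ} (hS : Function.Injective S.mulVec) {a b κ : ℝ} (ha : 0 < a)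
    (hb : 0 < b) (hl : EigLower A a) (hu : EigUpper A b) (hκ : b / a ≤ κ) {u : Fin d → ℝ}
    (hu0 : u ≠ 0) :
    1 / κ * (sketchForm 1 S u / (u ⬝ᵥ u)) ≤ sketchForm A S u / (u ⬝ᵥ (A⁻¹ *ᵥ u)) ∧
    sketchForm A S u / (u ⬝ᵥ (A⁻¹ *ᵥ u)) ≤ κ * (sketchForm 1 S u / (u ⬝ᵥ u)) ∧
    sketchForm A S u / (u ⬝ᵥ (A⁻¹ *ᵥ u)) ≤ 1 := by
  have hpos : 0 < u ⬝ᵥ u := by simpa using Matrix.dotProduct_star_self_pos_iff.2 hu0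
  have hκ0 : 0 < κ := (div_pos hb ha).trans_le hκ
  have q0 := sketchForm_nonneg (Matrix.PosDef.one (n := Fin d) (R := ℝ)) hS u
  have i1 := le_inv_quadForm hA hb hu u
  have i2 := inv_quadForm_le hA ha hl u
  have i0 : 0 < u ⬝ᵥ (A⁻¹ *ᵥ u) := (div_pos hpos hb).trans_le i1
  have s1 := sketchForm_one_le hA hS hb hu u
  have s2 := sketchForm_le_one hA hS ha hl u
  have hba : b ≤ κ * a := (div_le_iff₀ ha).1 hκ
  refine ⟨?_, ?_, div_le_one_of_le₀ (sketchForm_le hA hS u) i0.le⟩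
  · rw [le_div_iff₀ i0]
    refine le_trans ?_ s1
    calc 1 / κ * (sketchForm 1 S u / (u ⬝ᵥ u)) * (u ⬝ᵥ (A⁻¹ *ᵥ u))
        ≤ 1 / κ * (sketchForm 1 S u / (u ⬝ᵥ u)) * ((u ⬝ᵥ u) / a) := by gcongr
      _ = sketchForm 1 S u / (κ * a) := by field_simp
      _ ≤ sketchForm 1 S u / b := by gcongr
  · rw [div_le_iff₀ i0]
    refine s2.trans ?_
    calc sketchForm 1 S u / a = κ * (sketchForm 1 S u / (κ * a)) := by field_simp
      _ ≤ κ * (sketchForm 1 S u / b) := by gcongr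
      _ = κ * (sketchForm 1 S u / (u ⬝ᵥ u)) * ((u ⬝ᵥ u) / b) := by field_simp
      _ ≤ κ * (sketchForm 1 S u / (u ⬝ᵥ u)) * (u ⬝ᵥ (A⁻¹ *ᵥ u)) := by gcongr

/-- Up to the condition number `κ`, a Gaussian sketch scales the quadratic form of the inverse by
`k / d`. -/
theorem gaussian_sketch_ratio (d k : ℕ) (A : Matrix (Fin d) (Fin d) ℝ) (hA : A.PosDef)
    (κ δ : ℝ) (u : Fin d → ℝ) (hkd : k ≤ d)
    (hκ : ∀ a b, hA.isHermitian.eigenvalues a / hA.isHermitian.eigenvalues b ≤ κ)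
    (h0 : 0 < δ) (h1 : δ < 1) (hu : u ≠ 0) :
    gaussianMatrix d k {S : Fin d → Fin k → ℝ |
          ¬ (1 / κ * (1 - δ) * (k / d) ≤
              (((Matrix.of S)ᵀ *ᵥ u) ⬝ᵥ
                (((Matrix.of S)ᵀ * A * Matrix.of S)⁻¹ *ᵥ ((Matrix.of S)ᵀ *ᵥ u))) /
                (u ⬝ᵥ (A⁻¹ *ᵥ u)) ∧
            (((Matrix.of S)ᵀ *ᵥ u) ⬝ᵥ
                (((Matrix.of S)ᵀ * A * Matrix.of S)⁻¹ *ᵥ ((Matrix.of S)ᵀ *ᵥ u))) /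
                (u ⬝ᵥ (A⁻¹ *ᵥ u)) ≤
              min (κ * (1 + δ) * (k / d)) 1)}
          ≤ ENNReal.ofReal (4 * Real.exp (-(1 / 72 * δ ^ 2 * k))) := by
  have hd : Nonempty (Fin d) := by
    obtain ⟨i, -⟩ := Function.ne_iff.1 hu
    exact ⟨i⟩
  obtain ⟨i₀, hi₀⟩ := Finite.exists_min hA.isHermitian.eigenvalues
  obtain ⟨i₁, hi₁⟩ := Finite.exists_max hA.isHermitian.eigenvalues
  have ha := hA.eigenvalues_pos i₀
  have hb := hA.eigenvalues_pos i₁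
  have hl := eigLower_of_eigenvalues hA.isHermitian hi₀
  have hU := eigUpper_of_eigenvalues hA.isHermitian hi₁
  have hκ0 : 0 < κ := (div_pos hb ha).trans_le (hκ i₁ i₀)
  have hpos : 0 < u ⬝ᵥ u := by simpa using Matrix.dotProduct_star_self_pos_iff.2 hu
  have hc := gaussianMatrix_sketchForm_concentration hkd hu h0 h1
  rw [show (1 : ℝ) / 72 * δ ^ 2 * k = δ ^ 2 / 72 * k by ring]
  refine le_trans (measure_mono_ae ?_) hc
  filter_upwards [ae_injective_gaussianMatrix hkd] with S hS hbad
  by_contra hgood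
  refine hbad ?_
  have hgood' := not_not.1 hgood
  obtain ⟨g1, g2⟩ := hgood'
  obtain ⟨r1, r2, r3⟩ := sketch_ratio_bounds hA hS ha hb hl hU (hκ i₁ i₀) hu
  rw [dotProduct_sketchVec]
  change _ ≤ sketchForm A (Matrix.of S) u / _ ∧ sketchForm A (Matrix.of S) u / _ ≤ _
  refine ⟨le_trans ?_ r1, le_min (r2.trans ?_) r3⟩
  · rw [mul_assoc]
    refine mul_le_mul_of_nonneg_left ?_ (by positivity)
    rwa [le_div_iff₀ hpos]
  · rw [mul_assoc]
    refine mul_le_mul_of_nonneg_left ?_ hκ0.le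
    rwa [div_le_iff₀ hpos]

/-! ### Second order calculus along lines -/

lemma hasDerivAt_affine (a b t : ℝ) : HasDerivAt (fun t : ℝ => a + t * b) b t := by
  simpa using ((hasDerivAt_id' t).mul_const b).const_add a

section Lines

variable {m : ℕ} {F : Vec m → ℝ}

lemma hasDerivAt_line (x v : Vec m) (t : ℝ) : HasDerivAt (fun t : ℝ => x + t • v) v t := by
  simpa using ((hasDerivAt_id t).smul_const v).const_add x

lemma hasDerivAt_comp_line (hF : ContDiff ℝ 2 F) (x v : Vec m) (t : ℝ) :
    HasDerivAt (fun t : ℝ => F (x + t • v)) (fderiv ℝ F (x + t • v) v) t :=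
  ((hF.differentiable (by norm_num)) (x + t • v)).hasFDerivAt.comp_hasDerivAt t
    (hasDerivAt_line x v t)

lemma differentiable_fderiv (hF : ContDiff ℝ 2 F) : Differentiable ℝ (fderiv ℝ F) :=
  (hF.fderiv_right (m := 1) (by norm_num)).differentiable (by norm_num)

lemma hasDerivAt_fderiv_line (hF : ContDiff ℝ 2 F) (x v : Vec m) (t : ℝ) :
    HasDerivAt (fun t : ℝ => fderiv ℝ F (x + t • v) v) (hess F (x + t • v) v v) t := by
  have h := (differentiable_fderiv hF (x + t • v)).hasFDerivAt.comp_hasDerivAt t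
    (hasDerivAt_line x v t)
  simpa [hess] using h.clm_apply (hasDerivAt_const t v)

/-- If the Hessian is bounded below by `c` on the segment from `x` to a critical point `y`, then
`c ‖y - x‖` is bounded by the gradient at `x`. -/
lemma norm_sub_le_of_hess_lower (hF : ContDiff ℝ 2 F) {x y g : Vec m} {c : ℝ}
    (hg : ∀ v, fderiv ℝ F x v = ⟪g, v⟫_ℝ) (hy : fderiv ℝ F y = 0)
    (hess_le : ∀ β ∈ segment ℝ x y, ∀ v, c * ‖v‖ ^ 2 ≤ hess F β v v) :
    c * ‖y - x‖ ≤ ‖g‖ := by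
  set v := y - x with hv
  obtain ⟨s, hs, hs'⟩ := exists_hasDerivAt_eq_slope (fun t : ℝ => fderiv ℝ F (x + t • v) v)
    (fun t => hess F (x + t • v) v v) zero_lt_one
    (fun t _ => (hasDerivAt_fderiv_line hF x v t).continuousAt.continuousWithinAt)
    (fun t _ => hasDerivAt_fderiv_line hF x v t)
  have hmem : x + s • v ∈ segment ℝ x y := by
    rw [segment_eq_image']
    exact ⟨s, ⟨hs.1.le, hs.2.le⟩, rfl⟩
  have h1 := hess_le _ hmem v
  rw [hs'] at h1
  have hxy : x + v = y := by rw [hv]; abel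
  simp only [one_smul, zero_smul, add_zero, hxy, hy, hg, zero_apply,
    sub_zero, div_one, zero_sub] at h1
  have h2 : -⟪g, v⟫_ℝ ≤ ‖g‖ * ‖v‖ := (neg_le_abs _).trans (abs_real_inner_le_norm g v)
  rcases (norm_nonneg v).eq_or_lt with h0 | h0
  · rw [← h0]; simp
  · have h3 : c * ‖v‖ * ‖v‖ ≤ ‖g‖ * ‖v‖ := by nlinarith
    exact le_of_mul_le_mul_right h3 h0

lemma norm_gradient_sub_le (hF : ContDiff ℝ 2 F) {x y : Vec m} {c : ℝ}
    (hess_le : ∀ β ∈ segment ℝ x y, ‖hess F β‖ ≤ c) :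
    ‖gradient F y - gradient F x‖ ≤ c * ‖y - x‖ := by
  have h := Convex.norm_image_sub_le_of_norm_hasFDerivWithin_le (f := fderiv ℝ F)
    (f' := fun β => hess F β) (s := segment ℝ x y) (C := c)
    (fun β _ => (differentiable_fderiv hF β).hasFDerivAt.hasFDerivWithinAt) hess_le
    (convex_segment x y) (left_mem_segment ℝ x y) (right_mem_segment ℝ x y)
  rwa [← toDual_gradient, ← toDual_gradient, ← map_sub, LinearIsometryEquiv.norm_map] at h

end Lines

/-! ### Empirical risks -/

namespace Model

variable (M : Model)

lemma hasDerivAt_loss (y z : ℝ) : HasDerivAt (M.loss y) (M.dloss y z) z :=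
  (((M.loss_contDiff y).differentiable (by norm_num)) z).hasDerivAt

lemma hasDerivAt_dloss (y z : ℝ) : HasDerivAt (M.dloss y) (M.ddloss y z) z := by
  have h : ContDiff ℝ 1 (deriv (M.loss y)) :=
    ((contDiff_succ_iff_deriv (n := 1)).1 (M.loss_contDiff y)).2.2
  exact ((h.differentiable (by norm_num)) z).hasDerivAt

/-- A convex loss lies above its tangent lines. -/
lemma loss_tangent (y z w : ℝ) : M.loss y z + M.dloss y z * (w - z) ≤ M.loss y w := by
  have hc : ConvexOn ℝ Set.univ (M.loss y) := M.loss_convex y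
  have hd := M.hasDerivAt_loss y z
  rcases lt_trichotomy z w with h | h | h
  · have h1 := hc.le_slope_of_hasDerivAt (Set.mem_univ _) (Set.mem_univ _) h hd
    rw [slope_def_field, le_div_iff₀ (sub_pos.2 h)] at h1
    linarith
  · subst h; simp
  · have h1 := hc.slope_le_of_hasDerivAt (Set.mem_univ _) (Set.mem_univ _) h hd
    rw [slope_def_field, div_le_iff₀ (sub_pos.2 h)] at h1
    linarith

lemma fderiv_f (x : Vec M.p) (β v : Vec M.d) : fderiv ℝ (M.f x) β v = ⟪M.grad x β, v⟫_ℝ := by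
  rw [← toDual_gradient]
  rfl

lemma linPred_self (b₀ : Vec M.d) (x : Vec M.p) : M.linPred b₀ x b₀ = M.f x b₀ := by
  simp [linPred]

lemma linPred_add (b₀ : Vec M.d) (x : Vec M.p) (β v : Vec M.d) :
    M.linPred b₀ x (β + v) = M.linPred b₀ x β + ⟪M.grad x b₀, v⟫_ℝ := by
  simp only [linPred, inner_add_right]
  ring

variable {n : ℕ}

lemma contDiff_risk (D : Fin n → M.Obs) (s : Finset (Fin n)) : ContDiff ℝ 2 (M.risk D s) :=
  ContDiff.sum fun j _ => (M.loss_contDiff (D j).2).comp (M.f_contDiff (D j).1)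

lemma contDiff_linRisk (b₀ : Vec M.d) (D : Fin n → M.Obs) (s : Finset (Fin n)) :
    ContDiff ℝ 2 (M.linRisk b₀ D s) :=
  ContDiff.sum fun j _ => (M.loss_contDiff (D j).2).comp
    ((contDiff_const.inner ℝ contDiff_id).add contDiff_const)

/-- The gradient of the empirical risk at `β`. -/
def score (D : Fin n → M.Obs) (β : Vec M.d) : Vec M.d :=
  ∑ j, M.dloss (D j).2 (M.f (D j).1 β) • M.grad (D j).1 β

lemma inner_score (D : Fin n → M.Obs) (β v : Vec M.d) :
    ⟪M.score D β, v⟫_ℝ = ∑ j, M.dloss (D j).2 (M.f (D j).1 β) * ⟪M.grad (D j).1 β, v⟫_ℝ := by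
  simp [score, sum_inner, real_inner_smul_left]

lemma fderiv_risk (D : Fin n → M.Obs) (β v : Vec M.d) :
    fderiv ℝ (M.risk D Finset.univ) β v = ⟪M.score D β, v⟫_ℝ := by
  have h : HasFDerivAt (M.risk D Finset.univ)
      (∑ j, M.dloss (D j).2 (M.f (D j).1 β) • fderiv ℝ (M.f (D j).1) β) β :=
    HasFDerivAt.fun_sum fun j _ => (M.hasDerivAt_loss _ _).comp_hasFDerivAt β
      (((M.f_contDiff (D j).1).differentiable (by norm_num)) β).hasFDerivAt
  rw [h.fderiv, inner_score]
  simp [fderiv_f]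

lemma fderiv_linRisk_line (b₀ : Vec M.d) (D : Fin n → M.Obs) (β v : Vec M.d) (t : ℝ) :
    fderiv ℝ (M.linRisk b₀ D Finset.univ) (β + t • v) v =
      ∑ j, M.dloss (D j).2 (M.linPred b₀ (D j).1 β + t * ⟪M.grad (D j).1 b₀, v⟫_ℝ) *
        ⟪M.grad (D j).1 b₀, v⟫_ℝ := by
  refine (hasDerivAt_comp_line (M.contDiff_linRisk b₀ D Finset.univ) β v t).unique ?_
  have he : (fun t : ℝ => M.linRisk b₀ D Finset.univ (β + t • v)) = fun t : ℝ =>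
      ∑ j, M.loss (D j).2 (M.linPred b₀ (D j).1 β + t * ⟪M.grad (D j).1 b₀, v⟫_ℝ) := by
    ext t
    simp only [linRisk, linPred_add, real_inner_smul_right]
  rw [he]
  refine HasDerivAt.fun_sum fun j _ => ?_
  exact (M.hasDerivAt_loss _ _).comp t (hasDerivAt_affine _ _ t)

/-- The Hessian of the linearized empirical risk. -/
lemma hess_linRisk_apply (b₀ : Vec M.d) (D : Fin n → M.Obs) (β v : Vec M.d) :
    hess (M.linRisk b₀ D Finset.univ) β v v =
      ∑ j, M.linDdloss b₀ D β j * ⟪M.grad (D j).1 b₀, v⟫_ℝ ^ 2 := by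
  have h := hasDerivAt_fderiv_line (M.contDiff_linRisk b₀ D Finset.univ) β v 0
  simp only [fderiv_linRisk_line, zero_smul, add_zero] at h
  refine h.unique (HasDerivAt.fun_sum fun j _ => ?_)
  have h2 : HasDerivAt (M.dloss (D j).2) (M.linDdloss b₀ D β j)
      (M.linPred b₀ (D j).1 β + 0 * ⟪M.grad (D j).1 b₀, v⟫_ℝ) := by
    rw [zero_mul, add_zero]
    exact M.hasDerivAt_dloss _ _
  rw [sq, ← mul_assoc]
  exact (h2.comp (0 : ℝ) (hasDerivAt_affine _ _ 0)).mul_const _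

end Model

section Estimators

variable {M : Model} {n : ℕ} {T : Estimators M n} {D : Fin n → M.Obs}

lemma Estimators.AreMinimizers.fderiv_hat (h : T.AreMinimizers D) :
    fderiv ℝ (M.risk D Finset.univ) (T.hat D) = 0 :=
  (h.hat.isLocalMin univ_mem).fderiv_eq_zero

/-- The linearized model has the same full-sample estimator as the original one: the estimator is a
critical point of the convex linearized risk. -/
lemma Estimators.AreMinimizers.breve_eq_hat (h : T.AreMinimizers D) : T.breve D = T.hat D := by
  refine (h.unique _ fun β _ => ?_).symm
  have h0 : ∑ j, M.dloss (D j).2 (M.f (D j).1 (T.hat D)) *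
      ⟪M.grad (D j).1 (T.hat D), β - T.hat D⟫_ℝ = 0 := by
    rw [← M.inner_score, ← M.fderiv_risk, h.fderiv_hat]
    rfl
  simp only [Set.mem_ofPred_eq, Model.linRisk, Model.linPred_self]
  calc ∑ j, M.loss (D j).2 (M.f (D j).1 (T.hat D))
      = ∑ j, (M.loss (D j).2 (M.f (D j).1 (T.hat D)) + M.dloss (D j).2 (M.f (D j).1 (T.hat D)) *
          ⟪M.grad (D j).1 (T.hat D), β - T.hat D⟫_ℝ) := by
        rw [Finset.sum_add_distrib, h0, add_zero]
    _ ≤ ∑ j, M.loss (D j).2 (M.linPred (T.hat D) (D j).1 β) := by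
        refine Finset.sum_le_sum fun j _ => ?_
        have h1 := M.loss_tangent (D j).2 (M.f (D j).1 (T.hat D))
          (M.linPred (T.hat D) (D j).1 β)
        have h2 := M.linPred_add (T.hat D) (D j).1 (T.hat D) (β - T.hat D)
        rw [add_sub_cancel, M.linPred_self] at h2
        rwa [h2, add_sub_cancel_left, ← h2] at h1

end Estimators

section WeightedGram

variable {n m : ℕ} (Φ : Matrix (Fin n) (Fin m) ℝ) (w : Fin n → ℝ)

lemma weightedGram_transpose : (weightedGram Φ w)ᵀ = weightedGram Φ w := by
  simp [weightedGram, Matrix.transpose_mul, Matrix.mul_assoc]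

lemma weightedGram_quadForm (v : Fin m → ℝ) :
    v ⬝ᵥ (weightedGram Φ w *ᵥ v) = ∑ j, w j * (Φ j ⬝ᵥ v) ^ 2 := by
  rw [weightedGram, ← Matrix.mulVec_mulVec, ← Matrix.mulVec_mulVec, Matrix.dotProduct_mulVec,
    Matrix.vecMul_transpose]
  simp only [dotProduct, Matrix.mulVec_diagonal]
  refine Finset.sum_congr rfl fun j _ => ?_
  simp only [Matrix.mulVec, dotProduct]
  ring

lemma weightedGram_mul {k : ℕ} (S : Matrix (Fin m) (Fin k) ℝ) :
    weightedGram (Φ * S) w = Sᵀ * weightedGram Φ w * S := by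
  simp [weightedGram, Matrix.transpose_mul, Matrix.mul_assoc]

end WeightedGram

/-! ### Influences on a regular sample -/

lemma dotProduct_eq_inner {m : ℕ} (x y : Vec m) :
    WithLp.ofLp x ⬝ᵥ WithLp.ofLp y = ⟪x, y⟫_ℝ :=
  sum_mul_eq_inner x y

lemma dotProduct_self_eq_norm_sq {m : ℕ} (x : Vec m) :
    WithLp.ofLp x ⬝ᵥ WithLp.ofLp x = ‖x‖ ^ 2 := by
  rw [dotProduct_eq_inner, real_inner_self_eq_norm_sq]

lemma mul_row {n m k : ℕ} (Φ : Matrix (Fin n) (Fin m) ℝ) (S : Matrix (Fin m) (Fin k) ℝ)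
    (i : Fin n) : (Φ * S) i = Sᵀ *ᵥ Φ i := by
  ext a
  simp [Matrix.mul_apply, Matrix.mulVec, dotProduct, mul_comm]

lemma aloDenom_mul {n m k : ℕ} (Φ : Matrix (Fin n) (Fin m) ℝ) (w : Fin n → ℝ)
    (S : Matrix (Fin m) (Fin k) ℝ) (i : Fin n) :
    aloDenom (Φ * S) w i = 1 - w i * sketchForm (weightedGram Φ w) S (Φ i) := by
  rw [aloDenom, weightedGram_mul, mul_row, dotProduct_sketchVec, sketchForm]

lemma aloInfluence_mul {n m k : ℕ} (Φ : Matrix (Fin n) (Fin m) ℝ) (r w : Fin n → ℝ)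
    (S : Matrix (Fin m) (Fin k) ℝ) (i : Fin n) (φ : Fin m → ℝ) :
    aloInfluence (Φ * S) r w i (Sᵀ *ᵥ φ) =
      r i * (φ ⬝ᵥ sketchVec (weightedGram Φ w) S (Φ i)) / aloDenom (Φ * S) w i := by
  rw [aloInfluence, weightedGram_mul, mul_row, dotProduct_sketchVec]

namespace Regular

variable {K : Consts} {M : Model} {n : ℕ} {T : Estimators M n} {D : Fin n → M.Obs} {xnew : Vec M.p}

lemma quadForm_eq_hess (T : Estimators M n) (D : Fin n → M.Obs) (v : Fin M.d → ℝ) :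
    v ⬝ᵥ (weightedGram (M.gradMatrix D (T.hat D)) (secondDeriv T D) *ᵥ v) =
      hess (M.linRisk (T.hat D) D Finset.univ) (T.breve D) (WithLp.toLp 2 v)
        (WithLp.toLp 2 v) := by
  rw [weightedGram_quadForm, M.hess_linRisk_apply]
  refine Finset.sum_congr rfl fun j _ => ?_
  rw [← dotProduct_eq_inner]
  rfl

lemma eigLower (h : Regular K T D xnew) :
    EigLower (weightedGram (M.gradMatrix D (T.hat D)) (secondDeriv T D))
      (n * (K.cH / ‖M.betaStar‖ ^ 2)) := fun v => by
  rw [quadForm_eq_hess, ← norm_toLp_sq]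
  exact (h.hess_linRisk _).1

lemma eigUpper (h : Regular K T D xnew) :
    EigUpper (weightedGram (M.gradMatrix D (T.hat D)) (secondDeriv T D))
      (n * (K.CH / ‖M.betaStar‖ ^ 2)) := fun v => by
  rw [quadForm_eq_hess, ← norm_toLp_sq]
  exact (h.hess_linRisk _).2

lemma norm_betaStar_pos (M : Model) : 0 < ‖M.betaStar‖ := norm_pos_iff.2 M.betaStar_ne_zero

lemma curvature_pos (K : Consts) (M : Model) (hn : 0 < n) :
    0 < (n : ℝ) * (K.cH / ‖M.betaStar‖ ^ 2) := by
  obtain ⟨-, -, -, -, -, -, h, -⟩ := K.pos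
  have h1 : (0 : ℝ) < n := by exact_mod_cast hn
  have h2 := norm_betaStar_pos M
  positivity

lemma posDef (h : Regular K T D xnew) (hn : 0 < n) :
    (weightedGram (M.gradMatrix D (T.hat D)) (secondDeriv T D)).PosDef :=
  posDef_of_eigLower (weightedGram_transpose _ _) (curvature_pos K M hn) h.eigLower

lemma secondDeriv_eq (h : Regular K T D xnew) (i : Fin n) :
    secondDeriv T D i = M.ddloss (D i).2 (M.f (D i).1 (T.hat D)) := by
  rw [secondDeriv, Model.linDdloss, h.minimizers.breve_eq_hat, M.linPred_self]

lemma firstDeriv_abs_le (h : Regular K T D xnew) (i : Fin n) :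
    |firstDeriv T D i| ≤ K.Closs * Real.log n ^ K.deg := by
  rw [firstDeriv, Model.linDloss, h.minimizers.breve_eq_hat, M.linPred_self]
  exact h.dloss_bound i _ (Or.inl (right_mem_segment ℝ _ _))

lemma secondDeriv_pos (h : Regular K T D xnew) (i : Fin n) : 0 < secondDeriv T D i := by
  obtain ⟨-, -, -, -, -, -, -, -, -, -, hmu, -⟩ := K.pos
  rw [h.secondDeriv_eq]
  exact hmu.trans_le (h.ddloss_lower i _ (right_mem_segment ℝ _ _))

lemma secondDeriv_le (h : Regular K T D xnew) (i : Fin n) :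
    secondDeriv T D i ≤ K.Closs * Real.log n ^ K.deg := by
  rw [h.secondDeriv_eq]
  exact (le_abs_self _).trans (h.ddloss_hat i)

lemma hat_mem (T : Estimators M n) (D : Fin n → M.Obs) (i : Fin n) : T.hat D ∈
    convexHull ℝ {T.breve D, T.breveLOO i D, M.betaStar} ∪
      convexHull ℝ {T.hat D, T.hatLOO i D, M.betaStar} :=
  Or.inr (subset_convexHull ℝ _ (by simp))

lemma segment_subset (T : Estimators M n) (D : Fin n → M.Obs) (i : Fin n) :
    segment ℝ M.betaStar (T.hat D) ⊆ convexHull ℝ {T.hat D, T.hatLOO i D, M.betaStar} :=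
  (convex_convexHull ℝ _).segment_subset (subset_convexHull ℝ _ (by simp))
    (subset_convexHull ℝ _ (by simp))

lemma norm_grad_hat_le (h : Regular K T D xnew) (i : Fin n) :
    ‖M.grad (D i).1 (T.hat D)‖ ≤ K.Cgrad * Real.log n ^ K.deg :=
  (h.grad_bound i _ (hat_mem T D i)).2 i

/-- The leverage of a training point is small. -/
lemma leverage_le (h : Regular K T D xnew) (i : Fin n) :
    secondDeriv T D i * (M.gradMatrix D (T.hat D) i ⬝ᵥ
      ((weightedGram (M.gradMatrix D (T.hat D)) (secondDeriv T D))⁻¹ *ᵥ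
        M.gradMatrix D (T.hat D) i)) ≤
      K.Closs * Real.log n ^ K.deg * (K.Cgrad * Real.log n ^ K.deg) ^ 2 /
        (n * (K.cH / ‖M.betaStar‖ ^ 2)) := by
  have hn : 0 < n := i.pos
  have ha := curvature_pos K M hn
  have h1 := inv_quadForm_le (h.posDef hn) ha h.eigLower (M.gradMatrix D (T.hat D) i)
  have h2 : M.gradMatrix D (T.hat D) i ⬝ᵥ M.gradMatrix D (T.hat D) i ≤
      (K.Cgrad * Real.log n ^ K.deg) ^ 2 := by
    rw [show M.gradMatrix D (T.hat D) i = WithLp.ofLp (M.grad (D i).1 (T.hat D)) from rfl,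
      dotProduct_self_eq_norm_sq]
    exact pow_le_pow_left₀ (norm_nonneg _) (h.norm_grad_hat_le i) 2
  have h3 := (h.secondDeriv_pos i).le
  calc _ ≤ secondDeriv T D i * ((K.Cgrad * Real.log n ^ K.deg) ^ 2 /
        (n * (K.cH / ‖M.betaStar‖ ^ 2))) := by
        refine mul_le_mul_of_nonneg_left (h1.trans ?_) h3
        gcongr
    _ ≤ K.Closs * Real.log n ^ K.deg * ((K.Cgrad * Real.log n ^ K.deg) ^ 2 /
        (n * (K.cH / ‖M.betaStar‖ ^ 2))) :=
        mul_le_mul_of_nonneg_right (h.secondDeriv_le i) (by positivity)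
    _ = _ := by rw [mul_div_assoc]

section Influence

variable {k : ℕ} {S : Matrix (Fin M.d) (Fin k) ℝ}

lemma aloDenom_mem (h : Regular K T D xnew) (i : Fin n)
    (hη : K.Closs * Real.log n ^ K.deg * (K.Cgrad * Real.log n ^ K.deg) ^ 2 /
        (n * (K.cH / ‖M.betaStar‖ ^ 2)) ≤ 1 / 2) :
    1 / 2 ≤ aloDenom (M.gradMatrix D (T.hat D)) (secondDeriv T D) i := by
  have h1 := (h.leverage_le i).trans hη
  rw [aloDenom]
  linarith

lemma aloDenom_proj_mem (h : Regular K T D xnew) (i : Fin n)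
    (hη : K.Closs * Real.log n ^ K.deg * (K.Cgrad * Real.log n ^ K.deg) ^ 2 /
        (n * (K.cH / ‖M.betaStar‖ ^ 2)) ≤ 1 / 2)
    (hS : Function.Injective S.mulVec) :
    1 / 2 ≤ aloDenom (projFeatures T D S) (secondDeriv T D) i ∧
      aloDenom (projFeatures T D S) (secondDeriv T D) i ≤ 1 := by
  have hn : 0 < n := i.pos
  have h1 := (h.leverage_le i).trans hη
  have h2 := sketchForm_le (h.posDef hn) hS (M.gradMatrix D (T.hat D) i)
  have h3 := sketchForm_nonneg (h.posDef hn) hS (M.gradMatrix D (T.hat D) i)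
  have h4 := (h.secondDeriv_pos i).le
  have h5 := mul_le_mul_of_nonneg_left h2 h4
  have h6 := mul_nonneg h4 h3
  rw [projFeatures, aloDenom_mul]
  constructor <;> linarith

lemma aloDefined (h : Regular K T D xnew) (i : Fin n)
    (hη : K.Closs * Real.log n ^ K.deg * (K.Cgrad * Real.log n ^ K.deg) ^ 2 /
        (n * (K.cH / ‖M.betaStar‖ ^ 2)) ≤ 1 / 2) :
    AloDefined (M.gradMatrix D (T.hat D)) (secondDeriv T D) i := by
  refine ⟨(Matrix.isUnit_iff_isUnit_det _).1 (h.posDef i.pos).isUnit, ?_⟩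
  have := h.aloDenom_mem i hη
  linarith

lemma aloDefined_proj (h : Regular K T D xnew) (i : Fin n)
    (hη : K.Closs * Real.log n ^ K.deg * (K.Cgrad * Real.log n ^ K.deg) ^ 2 /
        (n * (K.cH / ‖M.betaStar‖ ^ 2)) ≤ 1 / 2)
    (hS : Function.Injective S.mulVec) :
    AloDefined (projFeatures T D S) (secondDeriv T D) i := by
  refine ⟨?_, ?_⟩
  · rw [projFeatures, weightedGram_mul]
    exact (Matrix.isUnit_iff_isUnit_det _).1 (posDef_sketch (h.posDef i.pos) hS).isUnit
  · have := (h.aloDenom_proj_mem i hη hS).1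
    linarith

/-- Lower bound for the ratio of the influences at a training point, when the range of the sketch
captures a share `k / (2 d)` of the squared norm of the gradient. -/
lemma self_influence_ratio (h : Regular K T D xnew) (i : Fin n)
    (hη : K.Closs * Real.log n ^ K.deg * (K.Cgrad * Real.log n ^ K.deg) ^ 2 /
        (n * (K.cH / ‖M.betaStar‖ ^ 2)) ≤ 1 / 2)
    (hS : Function.Injective S.mulVec)
    (hq : 1 / 2 * ((k : ℝ) / M.d) * (M.gradMatrix D (T.hat D) i ⬝ᵥ M.gradMatrix D (T.hat D) i) ≤
      sketchForm 1 S (M.gradMatrix D (T.hat D) i))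
    (hne : influenceALO T D i (D i).1 ≠ 0) :
    K.cH / (4 * K.CH) * ((k : ℝ) / M.d) ≤
      |influenceTRAK T D S i (D i).1 / influenceALO T D i (D i).1| := by
  obtain ⟨-, -, -, -, -, -, hcH, hCH, -⟩ := K.pos
  have hn : 0 < n := i.pos
  have hn' : (0 : ℝ) < n := by exact_mod_cast hn
  have hb := norm_betaStar_pos M
  have ha := curvature_pos K M hn
  set H := weightedGram (M.gradMatrix D (T.hat D)) (secondDeriv T D) with hH
  set u := M.gradMatrix D (T.hat D) i with hu
  have eT : influenceTRAK T D S i (D i).1 = firstDeriv T D i * sketchForm H S u /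
      aloDenom (projFeatures T D S) (secondDeriv T D) i := by
    rw [influenceTRAK, projFeatures, aloInfluence_mul]
    rfl
  have eA : influenceALO T D i (D i).1 = firstDeriv T D i * (u ⬝ᵥ (H⁻¹ *ᵥ u)) /
      aloDenom (M.gradMatrix D (T.hat D)) (secondDeriv T D) i := rfl
  obtain ⟨dT1, dT2⟩ := h.aloDenom_proj_mem i hη hS
  have dA := h.aloDenom_mem i hη
  set t := aloDenom (projFeatures T D S) (secondDeriv T D) i
  set s := aloDenom (M.gradMatrix D (T.hat D)) (secondDeriv T D) i
  rw [eA] at hne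
  have hr : firstDeriv T D i ≠ 0 := fun h0 => hne (by rw [h0]; simp)
  have hu0 : u ≠ 0 := fun h0 => hne (by rw [h0]; simp)
  have hpos : 0 < u ⬝ᵥ u := by simpa using Matrix.dotProduct_star_self_pos_iff.2 hu0
  have hB : 0 < (n : ℝ) * (K.CH / ‖M.betaStar‖ ^ 2) := by positivity
  have hκ : (n : ℝ) * (K.CH / ‖M.betaStar‖ ^ 2) / (n * (K.cH / ‖M.betaStar‖ ^ 2)) ≤
      K.CH / K.cH := le_of_eq (by field_simp)
  obtain ⟨r1, -, -⟩ := sketch_ratio_bounds (h.posDef hn) hS ha hB h.eigLower h.eigUpper hκ hu0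
  have i0 : 0 < u ⬝ᵥ (H⁻¹ *ᵥ u) :=
    (div_pos hpos hB).trans_le (le_inv_quadForm (h.posDef hn) hB h.eigUpper u)
  rw [eT, eA]
  have e1 : firstDeriv T D i * sketchForm H S u / t /
      (firstDeriv T D i * (u ⬝ᵥ (H⁻¹ *ᵥ u)) / s) =
      sketchForm H S u / (u ⬝ᵥ (H⁻¹ *ᵥ u)) * (s / t) := by
    have ht : t ≠ 0 := by linarith
    have hs : s ≠ 0 := by linarith
    field_simp
  rw [e1]
  have q1 : 1 / 2 * ((k : ℝ) / M.d) ≤ sketchForm 1 S u / (u ⬝ᵥ u) := by rwa [le_div_iff₀ hpos]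
  have st : 1 / 2 ≤ s / t := by
    rw [le_div_iff₀ (by linarith)]
    linarith
  have hkd : 0 ≤ (k : ℝ) / M.d := by positivity
  refine le_trans ?_ (le_abs_self _)
  calc K.cH / (4 * K.CH) * ((k : ℝ) / M.d)
      = 1 / (K.CH / K.cH) * (1 / 2 * ((k : ℝ) / M.d)) * (1 / 2) := by field_simp; ring
    _ ≤ sketchForm H S u / (u ⬝ᵥ (H⁻¹ *ᵥ u)) * (s / t) := by
        refine mul_le_mul (le_trans ?_ r1) st (by norm_num) ?_
        · exact mul_le_mul_of_nonneg_left q1 (by positivity)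
        · exact div_nonneg (sketchForm_nonneg (h.posDef hn) hS u) i0.le

/-- The estimation error is bounded by the score at the true parameter. -/
lemma norm_hat_sub_le (h : Regular K T D xnew) (i : Fin n) :
    n * (K.cH / ‖M.betaStar‖ ^ 2) * ‖T.hat D - M.betaStar‖ ≤ ‖M.score D M.betaStar‖ :=
  norm_sub_le_of_hess_lower (M.contDiff_risk D Finset.univ) (M.fderiv_risk D M.betaStar)
    h.minimizers.fderiv_hat
    fun β hβ v => (h.hess_risk i β (Or.inr (segment_subset T D i hβ)) v).1

lemma norm_grad_new_sub_le (h : Regular K T D xnew) (i : Fin n) :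
    ‖M.grad xnew (T.hat D) - M.grad xnew M.betaStar‖ ≤
      K.Chess / ‖M.betaStar‖ ^ 2 * ‖T.hat D - M.betaStar‖ :=
  norm_gradient_sub_le (M.f_contDiff xnew) fun β hβ => h.hess_f i β (segment_subset T D i hβ)

/-- Upper bound for the influence at a test feature `xnew`: the score is at most of order
`n / ‖βstar‖` up to logarithms, the range of the sketch captures at most a share `(k / d) log n` of
the squared norm of the gradient, and the gradient at `xnew` and the true parameter is in typical
position. -/
lemma test_influence_le (h : Regular K T D xnew) (i : Fin n)
    (hη : K.Closs * Real.log n ^ K.deg * (K.Cgrad * Real.log n ^ K.deg) ^ 2 /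
        (n * (K.cH / ‖M.betaStar‖ ^ 2)) ≤ 1 / 2)
    (hL : 1 ≤ Real.log n) (hS : Function.Injective S.mulVec) {A : ℝ} (hA : 0 ≤ A)
    (hscore : ‖M.score D M.betaStar‖ ≤
      A * Real.log n ^ (2 * K.deg + 1) * (n / ‖M.betaStar‖))
    (hq : sketchForm 1 S (M.gradMatrix D (T.hat D) i) ≤ Real.log n * ((k : ℝ) / M.d *
      (M.gradMatrix D (T.hat D) i ⬝ᵥ M.gradMatrix D (T.hat D) i)))
    (hnew : |⟪WithLp.toLp 2 (sketchVec (weightedGram (M.gradMatrix D (T.hat D)) (secondDeriv T D)) S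
        (M.gradMatrix D (T.hat D) i)), M.grad xnew M.betaStar⟫_ℝ| ≤
      Real.log n * (√K.Csec / ‖M.betaStar‖) * ‖(WithLp.toLp 2 (sketchVec
        (weightedGram (M.gradMatrix D (T.hat D)) (secondDeriv T D)) S
        (M.gradMatrix D (T.hat D) i)) : Vec M.d)‖) :
    |influenceTRAK T D S i xnew| ≤
      2 * K.Closs * K.Cgrad / K.cH * (√K.Csec + K.Chess * A / K.cH) *
        Real.log n ^ (4 * K.deg + 2) * (‖M.betaStar‖ / n * √((k : ℝ) / M.d)) := by
  obtain ⟨-, -, -, hCg, -, -, hcH, hCH, hChess, hCl, -⟩ := K.pos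
  have hn : 0 < n := i.pos
  have hn' : (0 : ℝ) < n := by exact_mod_cast hn
  have hb := norm_betaStar_pos M
  have ha := curvature_pos K M hn
  set H := weightedGram (M.gradMatrix D (T.hat D)) (secondDeriv T D) with hH
  set u := M.gradMatrix D (T.hat D) i with hu
  set v : Vec M.d := WithLp.toLp 2 (sketchVec H S u) with hv
  set L := Real.log n with hLdef
  set b := ‖M.betaStar‖ with hbdef
  set ρ := √((k : ℝ) / M.d) with hρ
  have hL0 : 0 < L := by linarith
  have hρ0 : 0 ≤ ρ := Real.sqrt_nonneg _
  have hρ2 : ρ ^ 2 = (k : ℝ) / M.d := Real.sq_sqrt (by positivity)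
  have huu : u ⬝ᵥ u ≤ (K.Cgrad * L ^ K.deg) ^ 2 := by
    rw [show u = WithLp.ofLp (M.grad (D i).1 (T.hat D)) from rfl, dotProduct_self_eq_norm_sq]
    exact pow_le_pow_left₀ (norm_nonneg _) (h.norm_grad_hat_le i) 2
  have hvn : ‖v‖ ≤ ρ * L * (K.Cgrad * L ^ K.deg) * (b ^ 2 / (n * K.cH)) := by
    have h1 := sketchVec_sq_le (h.posDef hn) hS ha h.eigLower u
    rw [← norm_toLp_sq] at h1
    refine abs_le_of_sq_le_sq' ?_ (by positivity) |>.2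
    refine h1.trans ((div_le_div_of_nonneg_right hq (by positivity)).trans ?_)
    have e : (ρ * L * (K.Cgrad * L ^ K.deg) * (b ^ 2 / (n * K.cH))) ^ 2 =
        L ^ 2 * (ρ ^ 2 * (K.Cgrad * L ^ K.deg) ^ 2) / (n * (K.cH / b ^ 2)) ^ 2 := by
      field_simp
    rw [e, hρ2]
    have hLL : L ≤ L ^ 2 := by nlinarith
    have huu0 : 0 ≤ u ⬝ᵥ u := norm_toLp_sq u ▸ sq_nonneg _
    gcongr
  have hhat : ‖T.hat D - M.betaStar‖ ≤ A / K.cH * L ^ (2 * K.deg + 1) * b := by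
    have h1 := (h.norm_hat_sub_le i).trans hscore
    rw [← le_div_iff₀' ha] at h1
    refine h1.trans (le_of_eq ?_)
    field_simp
  have hgrad : |⟪v, M.grad xnew (T.hat D)⟫_ℝ| ≤
      (√K.Csec + K.Chess * A / K.cH) * L ^ (2 * K.deg + 1) / b * ‖v‖ := by
    have h1 : ⟪v, M.grad xnew (T.hat D)⟫_ℝ = ⟪v, M.grad xnew M.betaStar⟫_ℝ +
        ⟪v, M.grad xnew (T.hat D) - M.grad xnew M.betaStar⟫_ℝ := by
      rw [inner_sub_right]; ring
    have h2 : |⟪v, M.grad xnew (T.hat D) - M.grad xnew M.betaStar⟫_ℝ| ≤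
        ‖v‖ * (K.Chess / b ^ 2 * (A / K.cH * L ^ (2 * K.deg + 1) * b)) := by
      refine (abs_real_inner_le_norm _ _).trans ?_
      refine mul_le_mul_of_nonneg_left ((h.norm_grad_new_sub_le i).trans ?_) (norm_nonneg _)
      gcongr
    have h3 : L * (√K.Csec / b) * ‖v‖ ≤ L ^ (2 * K.deg + 1) * (√K.Csec / b) * ‖v‖ := by
      have : L ^ 1 ≤ L ^ (2 * K.deg + 1) := pow_le_pow_right₀ hL (by omega)
      rw [pow_one] at this
      gcongr
    rw [h1]
    refine (abs_add_le _ _).trans ((add_le_add (hnew.trans h3) h2).trans (le_of_eq ?_))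
    field_simp
  have eT : influenceTRAK T D S i xnew = firstDeriv T D i * ⟪v, M.grad xnew (T.hat D)⟫_ℝ /
      aloDenom (projFeatures T D S) (secondDeriv T D) i := by
    rw [influenceTRAK, projFeatures, aloInfluence_mul, ← dotProduct_eq_inner, dotProduct_comm]
  obtain ⟨dT1, -⟩ := h.aloDenom_proj_mem i hη hS
  set t := aloDenom (projFeatures T D S) (secondDeriv T D) i
  have hr := h.firstDeriv_abs_le i
  have hsec : 0 ≤ √K.Csec := Real.sqrt_nonneg _
  rw [eT, abs_div, abs_mul, abs_of_pos (show 0 < t by linarith), div_le_iff₀ (by linarith)]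
  calc |firstDeriv T D i| * |⟪v, M.grad xnew (T.hat D)⟫_ℝ|
      ≤ (K.Closs * L ^ K.deg) * ((√K.Csec + K.Chess * A / K.cH) * L ^ (2 * K.deg + 1) / b *
          (ρ * L * (K.Cgrad * L ^ K.deg) * (b ^ 2 / (n * K.cH)))) := by
        refine mul_le_mul hr (hgrad.trans ?_) (abs_nonneg _) (by positivity)
        exact mul_le_mul_of_nonneg_left hvn (by positivity)
    _ = 2 * K.Closs * K.Cgrad / K.cH * (√K.Csec + K.Chess * A / K.cH) *
        L ^ (4 * K.deg + 2) * (b / n * ρ) * (1 / 2) := by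
        rw [show 4 * K.deg + 2 = K.deg + (2 * K.deg + 1) + 1 + K.deg by ring, pow_add, pow_add,
          pow_add]
        field_simp
        ring
    _ ≤ _ := mul_le_mul_of_nonneg_left dT1 (by positivity)

end Influence

end Regular

/-! ### Measurability of derivatives -/

/-- Joint measurability of a derivative, as a limit of difference quotients with increments
`1 / (m + 1)`. -/
lemma measurable_deriv_of_measurable {α : Type*} [MeasurableSpace α] {g : α → ℝ → ℝ}
    (hg : Measurable (Function.uncurry g)) (hd : ∀ a, Differentiable ℝ (g a)) :
    Measurable fun z : α × ℝ => deriv (g z.1) z.2 := by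
  have hseq : Tendsto (fun m : ℕ => 1 / ((m : ℝ) + 1)) atTop (𝓝[≠] 0) := by
    refine tendsto_nhdsWithin_iff.2 ⟨tendsto_one_div_add_atTop_nhds_zero_nat, ?_⟩
    refine Eventually.of_forall fun m => ?_
    have : (0 : ℝ) < 1 / ((m : ℝ) + 1) := by positivity
    exact this.ne'
  refine measurable_of_tendsto_metrizable (f := fun (m : ℕ) (z : α × ℝ) =>
    (1 / ((m : ℝ) + 1))⁻¹ • (g z.1 (z.2 + 1 / ((m : ℝ) + 1)) - g z.1 z.2)) (fun m => ?_)
    (tendsto_pi_nhds.2 fun z => (hd z.1 z.2).hasDerivAt.tendsto_slope_zero.comp hseq)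
  have h1 : Measurable fun z : α × ℝ => g z.1 (z.2 + 1 / ((m : ℝ) + 1)) :=
    hg.comp (measurable_fst.prodMk (measurable_snd.add_const _))
  have h2 : Measurable fun z : α × ℝ => g z.1 z.2 := hg
  exact (h1.sub h2).const_smul (1 / ((m : ℝ) + 1))⁻¹

namespace Model

variable (M : Model)

lemma measurable_loss : Measurable (Function.uncurry M.loss) :=
  (Real.measurable_log.comp M.q_measurable).neg

lemma measurable_dloss : Measurable (Function.uncurry M.dloss) :=
  measurable_deriv_of_measurable M.measurable_loss fun y z =>
    (M.hasDerivAt_loss y z).differentiableAt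

lemma measurable_ddloss : Measurable (Function.uncurry M.ddloss) :=
  measurable_deriv_of_measurable M.measurable_dloss fun y z =>
    (M.hasDerivAt_dloss y z).differentiableAt

/-- Each coordinate of the gradient is the derivative along a coordinate line. -/
lemma measurable_grad : Measurable (Function.uncurry M.grad) := by
  have hc : ∀ a, Measurable fun z : Vec M.p × Vec M.d => M.grad z.1 z.2 a := fun a => by
    have h1 : Measurable (Function.uncurry fun (z : Vec M.p × Vec M.d) (t : ℝ) =>
        M.f z.1 (z.2 + t • EuclideanSpace.single a 1)) :=
      M.f_measurable.comp ((measurable_fst.comp measurable_fst).prodMk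
        ((measurable_snd.comp measurable_fst).add (measurable_snd.smul_const _)))
    have h2 := measurable_deriv_of_measurable h1 fun z t =>
      (hasDerivAt_comp_line (M.f_contDiff z.1) z.2 (EuclideanSpace.single a 1) t).differentiableAt
    have h3 := h2.comp (measurable_id.prodMk (measurable_const (a := (0 : ℝ))))
    convert h3 using 1
    ext z
    have h4 := (hasDerivAt_comp_line (M.f_contDiff z.1) z.2 (EuclideanSpace.single a 1) 0).deriv
    simp only [Function.comp, id]
    rw [h4, zero_smul, add_zero, M.fderiv_f]
    simp [EuclideanSpace.inner_single_right]
  exact (WithLp.measurable_toLp 2 _).comp (measurable_pi_lambda _ hc)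

lemma measurable_grad_star : Measurable fun x => M.grad x M.betaStar :=
  M.measurable_grad.comp (measurable_id.prodMk measurable_const)

lemma measurable_dloss_star :
    Measurable fun z : M.Obs => M.dloss z.2 (M.f z.1 M.betaStar) :=
  M.measurable_dloss.comp (measurable_snd.prodMk (M.f_measurable.comp
    (measurable_fst.prodMk measurable_const)))

/-! ### The law of the data -/

instance : IsProbabilityMeasure M.px := M.px_prob

instance : SigmaFinite M.nu := M.nu_sigmaFinite

lemma law_map_fst : M.law.map Prod.fst = M.px := by
  have hm : Measurable fun z : M.Obs => ENNReal.ofReal (M.q z.2 (M.f z.1 M.betaStar)) :=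
    ENNReal.measurable_ofReal.comp (M.q_measurable.comp (measurable_snd.prodMk
      (M.f_measurable.comp (measurable_fst.prodMk measurable_const))))
  ext s hs
  rw [Measure.map_apply measurable_fst hs, law, withDensity_apply _ (measurable_fst hs),
    show (Prod.fst ⁻¹' s : Set M.Obs) = s ×ˢ Set.univ by ext; simp,
    ← Measure.prod_restrict, Measure.restrict_univ, lintegral_prod _ hm.aemeasurable]
  simp [M.q_lintegral]

lemma measurePreserving_fst_law : MeasurePreserving Prod.fst M.law M.px :=
  ⟨measurable_fst, M.law_map_fst⟩

instance : IsProbabilityMeasure M.law := by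
  have : IsProbabilityMeasure (M.law.map Prod.fst) := by
    rw [M.law_map_fst]; infer_instance
  exact Measure.isProbabilityMeasure_of_map (μ := M.law) Prod.fst

end Model

instance (M : Model) (n : ℕ) : IsProbabilityMeasure (dataLaw M n) := by
  unfold dataLaw; infer_instance

instance (M : Model) (n k : ℕ) : IsProbabilityMeasure (fullLaw M n k) := by
  unfold fullLaw; infer_instance

/-! ### Second moment bounds -/

section Moments

variable {Ω : Type*} [MeasurableSpace Ω] {P : Measure Ω}

/-- Chebyshev's inequality for the uncentered second moment. -/
lemma measure_lt_abs_le [IsFiniteMeasure P] {Y : Ω → ℝ} (hY : Integrable (fun ω => Y ω ^ 2) P)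
    {a t : ℝ} (ha : ∫ ω, Y ω ^ 2 ∂P ≤ a) (ht : 0 < t) :
    P {ω | t < |Y ω|} ≤ ENNReal.ofReal (a / t ^ 2) := by
  have h := mul_meas_ge_le_integral_of_nonneg (ae_of_all P fun ω => sq_nonneg (Y ω)) hY (t ^ 2)
  have ht2 : 0 < t ^ 2 := by positivity
  rw [← le_div_iff₀' ht2] at h
  refine le_trans (measure_mono fun ω hω => ?_) (ENNReal.le_ofReal_iff_toReal_le
    (measure_ne_top _ _) ?_ |>.2 (h.trans (div_le_div_of_nonneg_right ha ht2.le)))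
  · have h1 : t < |Y ω| := hω
    have h2 : t ^ 2 ≤ |Y ω| ^ 2 := pow_le_pow_left₀ ht.le h1.le 2
    rwa [sq_abs] at h2
  · exact div_nonneg ((integral_nonneg fun ω => sq_nonneg (Y ω)).trans ha) ht2.le

lemma sq_integral_abs_le [IsProbabilityMeasure P] {Y : Ω → ℝ} (hY : MemLp Y 2 P) :
    (∫ ω, |Y ω| ∂P) ^ 2 ≤ ∫ ω, Y ω ^ 2 ∂P := by
  have h := variance_eq_sub (hY.abs)
  have h0 := variance_nonneg |Y| P
  rw [h] at h0
  simp only [Pi.pow_apply, Pi.abs_apply, sq_abs] at h0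
  linarith

/-- Second moment of the sum of independent copies of a random variable. -/
lemma integral_sum_sq_pi_le [IsProbabilityMeasure P] {n : ℕ} {X : Ω → ℝ} (hX : MemLp X 2 P) :
    Integrable (fun D : Fin n → Ω => (∑ j, X (D j)) ^ 2) (Measure.pi fun _ => P) ∧
    ∫ D, (∑ j, X (D j)) ^ 2 ∂(Measure.pi fun _ : Fin n => P) ≤
      n * ∫ ω, X ω ^ 2 ∂P + n ^ 2 * (∫ ω, X ω ∂P) ^ 2 := by
  have hmp : ∀ j : Fin n, MeasurePreserving (fun D : Fin n → Ω => D j)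
      (Measure.pi fun _ => P) P := fun j => measurePreserving_eval (fun _ : Fin n => P) j
  have hj : ∀ j : Fin n, MemLp (fun D : Fin n → Ω => X (D j)) 2 (Measure.pi fun _ => P) :=
    fun j => hX.comp_measurePreserving (hmp j)
  have hs : MemLp (fun D : Fin n → Ω => ∑ j, X (D j)) 2 (Measure.pi fun _ => P) :=
    memLp_finsetSum _ fun j _ => hj j
  refine ⟨hs.integrable_sq, ?_⟩
  have h1 := variance_sum_pi (μ := fun _ : Fin n => P) (X := fun _ => X) fun _ => hX
  have he : (∑ i : Fin n, fun ω : Fin n → Ω => X (ω i)) = fun D => ∑ j, X (D j) := by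
    ext D; simp
  rw [he, variance_eq_sub hs, variance_eq_sub hX] at h1
  have hm : ∫ D, ∑ j, X (D j) ∂(Measure.pi fun _ : Fin n => P) = n * ∫ ω, X ω ∂P := by
    rw [integral_finsetSum _ fun j _ => (hj j).integrable (by norm_num)]
    have : ∀ j : Fin n, ∫ D, X (D j) ∂(Measure.pi fun _ : Fin n => P) = ∫ ω, X ω ∂P := fun j => by
      have hXm : AEStronglyMeasurable X (Measure.map (fun D : Fin n → Ω => D j)
          (Measure.pi fun _ => P)) := by
        rw [(hmp j).map_eq]
        exact hX.aestronglyMeasurable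
      rw [← integral_map (hmp j).measurable.aemeasurable hXm, (hmp j).map_eq]
    simp [this]
  simp only [Pi.pow_apply, Finset.sum_const, Finset.card_univ, Fintype.card_fin, nsmul_eq_mul,
    hm] at h1
  have h2 : 0 ≤ (n : ℝ) * (∫ ω, X ω ∂P) ^ 2 := by positivity
  nlinarith

/-- Norm-sub-Gaussian vectors are square integrable. The centering in the definition may involve the
junk value `0` of the integral of a function not yet known to be integrable; this is harmless, as
the tails are those of the distance to a fixed vector in any case. -/
lemma NormSubGaussian.memLp_two [IsProbabilityMeasure P] {m : ℕ} {X : Ω → Vec m} {σ : ℝ}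
    (hσ : 0 < σ) (h : NormSubGaussian X σ P) : MemLp X 2 P := by
  set c := ∫ ω', X ω' ∂P with hc
  have hXm : AEMeasurable (fun ω => ‖X ω - c‖) P := (h.1.sub_const c).norm
  have hlc := lintegral_rpow_eq_lintegral_meas_le_mul P
    (ae_of_all _ fun ω => norm_nonneg (X ω - c)) hXm (p := 2) two_pos
  have hint : Integrable (fun t : ℝ => 2 * (t * Real.exp (-(1 / (2 * σ ^ 2)) * t ^ 2))) :=
    (integrable_mul_exp_neg_mul_sq (by positivity)).const_mul 2
  have hfin : ∫⁻ ω, ENNReal.ofReal (‖X ω - c‖ ^ (2 : ℝ)) ∂P < ∞ := by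
    rw [hlc]
    refine ENNReal.mul_lt_top ENNReal.ofReal_lt_top ?_
    refine lt_of_le_of_lt ?_ hint.lintegral_lt_top
    refine le_trans (setLIntegral_mono' measurableSet_Ioi fun t ht => ?_)
      (setLIntegral_le_lintegral (Set.Ioi 0) _)
    have ht0 : (0 : ℝ) < t := ht
    refine (mul_le_mul_left (h.2 t ht0.le) _).trans ?_
    rw [← ENNReal.ofReal_mul (by positivity)]
    refine ENNReal.ofReal_le_ofReal (le_of_eq ?_)
    rw [show (2 : ℝ) - 1 = 1 by norm_num, Real.rpow_one,
      show -(1 / (2 * σ ^ 2)) * t ^ 2 = -t ^ 2 / (2 * σ ^ 2) by ring]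
    ring
  have hsub : MemLp (fun ω => X ω - c) 2 P := by
    rw [← memLp_norm_iff (h.1.sub_const c).aestronglyMeasurable,
      memLp_two_iff_integrable_sq hXm.aestronglyMeasurable]
    refine ⟨(hXm.pow_const 2).aestronglyMeasurable, ?_⟩
    rw [hasFiniteIntegral_iff_ofReal (ae_of_all _ fun ω => sq_nonneg _)]
    simpa using hfin
  have he : (fun ω => X ω - c) + (fun _ => c) = X := by
    ext1 ω
    simp
  rw [← he]
  exact hsub.add (memLp_const c)

end Moments

/-! ### The score and the test gradient at the true parameter -/

namespace Population

variable {K : Consts} {M : Model}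

lemma memLp_grad (h : Population K M) : MemLp (fun x => M.grad x M.betaStar) 2 M.px := by
  obtain ⟨-, -, -, -, -, -, -, -, -, -, -, -, hσ, -⟩ := K.pos
  exact h.grad_nSG.memLp_two hσ

lemma memLp_inner_grad (h : Population K M) (v : Vec M.d) :
    MemLp (fun x => ⟪v, M.grad x M.betaStar⟫_ℝ) 2 M.px :=
  h.memLp_grad.const_inner v

lemma integral_inner_grad_sq_le (h : Population K M) (v : Vec M.d) :
    ∫ x, ⟪v, M.grad x M.betaStar⟫_ℝ ^ 2 ∂M.px ≤ K.Csec / ‖M.betaStar‖ ^ 2 * ‖v‖ ^ 2 := by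
  rcases eq_or_ne v 0 with h0 | h0
  · subst h0; simp
  have hv : 0 < ‖v‖ := norm_pos_iff.2 h0
  have h1 := h.grad_second (‖v‖⁻¹ • v) (by rw [norm_smul, norm_inv, norm_norm]; field_simp)
  have he : ∀ x, ⟪‖v‖⁻¹ • v, M.grad x M.betaStar⟫_ℝ ^ 2 =
      (‖v‖ ^ 2)⁻¹ * ⟪v, M.grad x M.betaStar⟫_ℝ ^ 2 := fun x => by
    rw [real_inner_smul_left, mul_pow, inv_pow]
  simp only [he] at h1
  rw [integral_const_mul, inv_mul_le_iff₀ (by positivity)] at h1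
  linarith

/-- The gradient at an independent test feature is nearly orthogonal to a fixed vector. -/
lemma px_inner_grad_le (h : Population K M) (v : Vec M.d) {t : ℝ} (ht : 0 < t) :
    M.px {x | t * (√K.Csec / ‖M.betaStar‖) * ‖v‖ < |⟪v, M.grad x M.betaStar⟫_ℝ|} ≤
      ENNReal.ofReal (1 / t ^ 2) := by
  obtain ⟨-, -, -, -, -, -, -, -, -, -, -, -, -, hC⟩ := K.pos
  have hb := Regular.norm_betaStar_pos M
  rcases eq_or_ne v 0 with h0 | h0
  · subst h0; simp
  have hv : 0 < ‖v‖ := norm_pos_iff.2 h0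
  have hs : 0 < √K.Csec := Real.sqrt_pos.2 hC
  refine (measure_lt_abs_le (h.memLp_inner_grad v).integrable_sq (h.integral_inner_grad_sq_le v)
    (by positivity)).trans (ENNReal.ofReal_le_ofReal (le_of_eq ?_))
  have h2 : √K.Csec ^ 2 = K.Csec := Real.sq_sqrt hC.le
  rw [mul_pow, mul_pow, div_pow, h2]
  field_simp

end Population

namespace Model

variable (M : Model)

/-- The contribution of one data point to the score at the true parameter, set to zero unless the
loss derivative is at most `τ₁` and the gradient has norm at most `τ₂`. -/
def truncScore (τ₁ τ₂ : ℝ) (z : M.Obs) : Vec M.d :=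
  if |M.dloss z.2 (M.f z.1 M.betaStar)| ≤ τ₁ ∧ ‖M.grad z.1 M.betaStar‖ ≤ τ₂ then
    M.dloss z.2 (M.f z.1 M.betaStar) • M.grad z.1 M.betaStar
  else 0

lemma measurable_truncScore (τ₁ τ₂ : ℝ) : Measurable (M.truncScore τ₁ τ₂) := by
  have h1 := M.measurable_dloss_star
  have h2 : Measurable fun z : M.Obs => M.grad z.1 M.betaStar :=
    M.measurable_grad_star.comp measurable_fst
  refine Measurable.ite ?_ (h1.smul h2) measurable_const
  exact (measurableSet_le h1.abs measurable_const).inter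
    (measurableSet_le h2.norm measurable_const)

lemma norm_truncScore_le {τ₁ τ₂ : ℝ} (h1 : 0 ≤ τ₁) (h2 : 0 ≤ τ₂) (z : M.Obs) :
    ‖M.truncScore τ₁ τ₂ z‖ ≤ τ₁ * τ₂ := by
  rw [truncScore]
  split_ifs with h
  · rw [norm_smul, Real.norm_eq_abs]
    exact mul_le_mul h.1 h.2 (norm_nonneg _) h1
  · rw [norm_zero]; positivity

lemma abs_inner_truncScore_le {τ₁ τ₂ : ℝ} (h1 : 0 ≤ τ₁) (v : Vec M.d) (z : M.Obs) :
    |⟪v, M.truncScore τ₁ τ₂ z⟫_ℝ| ≤ τ₁ * |⟪v, M.grad z.1 M.betaStar⟫_ℝ| := by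
  rw [truncScore]
  split_ifs with h
  · rw [real_inner_smul_right, abs_mul]
    exact mul_le_mul_of_nonneg_right h.1 (abs_nonneg _)
  · rw [inner_zero_right, abs_zero]; positivity

lemma memLp_truncScore_apply {τ₁ τ₂ : ℝ} (h1 : 0 ≤ τ₁) (h2 : 0 ≤ τ₂) (a : Fin M.d) :
    MemLp (fun z => M.truncScore τ₁ τ₂ z a) 2 M.law := by
  refine MemLp.of_bound (C := τ₁ * τ₂) ?_ (ae_of_all _ fun z =>
    (PiLp.norm_apply_le _ a).trans (M.norm_truncScore_le h1 h2 z))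
  have := M.measurable_truncScore τ₁ τ₂
  exact Measurable.aestronglyMeasurable (by fun_prop)

end Model

/-- The squared norm of the mean `m` of the truncated score of one data point. Testing the score
with `m` gives `‖m‖² ≤ τ₁ E|⟪m, ∇f⟫| ≤ τ₁ (E⟪m, ∇f⟫²)^(1/2)`, to which the second moment bound
for the gradient applies. -/
lemma Population.sum_sq_mean_truncScore_le {K : Consts} {M : Model} (h : Population K M)
    {τ₁ τ₂ : ℝ} (h1 : 0 ≤ τ₁) (h2 : 0 ≤ τ₂) :
    ∑ a, (∫ z, M.truncScore τ₁ τ₂ z a ∂M.law) ^ 2 ≤ τ₁ ^ 2 * (K.Csec / ‖M.betaStar‖ ^ 2) := by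
  have hCb : 0 ≤ K.Csec / ‖M.betaStar‖ ^ 2 := by
    obtain ⟨-, -, -, -, -, -, -, -, -, -, -, -, -, hC⟩ := K.pos
    positivity
  set m : Vec M.d := WithLp.toLp 2 fun a => ∫ z, M.truncScore τ₁ τ₂ z a ∂M.law with hm
  have hms : ∑ a, (∫ z, M.truncScore τ₁ τ₂ z a ∂M.law) ^ 2 = ‖m‖ ^ 2 := by
    rw [EuclideanSpace.real_norm_sq_eq]
  have hint : ∀ a, Integrable (fun z => M.truncScore τ₁ τ₂ z a) M.law := fun a =>
    (M.memLp_truncScore_apply h1 h2 a).integrable (by norm_num)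
  have e1 : ‖m‖ ^ 2 = ∫ z, ⟪m, M.truncScore τ₁ τ₂ z⟫_ℝ ∂M.law := by
    simp only [← sum_mul_eq_inner]
    rw [integral_finsetSum _ fun a _ => (hint a).const_mul _, ← hms]
    refine Finset.sum_congr rfl fun a _ => ?_
    rw [integral_const_mul, sq]
  have hY := h.memLp_inner_grad m
  set e := ∫ x, |⟪m, M.grad x M.betaStar⟫_ℝ| ∂M.px with he
  have e2 : ‖m‖ ^ 2 ≤ τ₁ * e := by
    have hi : Integrable (fun z : M.Obs => |⟪m, M.grad z.1 M.betaStar⟫_ℝ|) M.law :=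
      M.measurePreserving_fst_law.integrable_comp_of_integrable
        (hY.integrable (by norm_num)).abs
    have he' : e = ∫ z : M.Obs, |⟪m, M.grad z.1 M.betaStar⟫_ℝ| ∂M.law := by
      have hae : AEStronglyMeasurable (fun x => |⟪m, M.grad x M.betaStar⟫_ℝ|)
          (M.law.map Prod.fst) := by
        rw [M.law_map_fst]
        exact (hY.integrable (by norm_num)).abs.aestronglyMeasurable
      rw [he, ← M.law_map_fst, integral_map measurable_fst.aemeasurable hae]
    rw [e1, he', ← integral_const_mul]
    refine integral_mono ?_ (hi.const_mul _) ?_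
    · refine Integrable.mono' (hi.const_mul τ₁) ?_ (ae_of_all _ fun z => ?_)
      · have := M.measurable_truncScore τ₁ τ₂
        exact Measurable.aestronglyMeasurable (by fun_prop)
      · exact M.abs_inner_truncScore_le h1 m z
    · exact fun z => (le_abs_self _).trans (M.abs_inner_truncScore_le h1 m z)
  have e3 : e ^ 2 ≤ K.Csec / ‖M.betaStar‖ ^ 2 * ‖m‖ ^ 2 :=
    (sq_integral_abs_le hY).trans (h.integral_inner_grad_sq_le m)
  rw [hms]
  have hm0 : 0 ≤ ‖m‖ ^ 2 := sq_nonneg _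
  rcases hm0.eq_or_lt with h0 | h0
  · rw [← h0]; positivity
  · have e4 : (‖m‖ ^ 2) ^ 2 ≤ (τ₁ * e) ^ 2 := pow_le_pow_left₀ hm0 e2 2
    have e5 : ‖m‖ ^ 2 * ‖m‖ ^ 2 ≤ τ₁ ^ 2 * (K.Csec / ‖M.betaStar‖ ^ 2) * ‖m‖ ^ 2 := by
      calc ‖m‖ ^ 2 * ‖m‖ ^ 2 = (‖m‖ ^ 2) ^ 2 := (sq _).symm
        _ ≤ τ₁ ^ 2 * e ^ 2 := by rw [← mul_pow]; exact e4
        _ ≤ τ₁ ^ 2 * (K.Csec / ‖M.betaStar‖ ^ 2 * ‖m‖ ^ 2) :=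
            mul_le_mul_of_nonneg_left e3 (sq_nonneg _)
        _ = _ := by ring
    exact le_of_mul_le_mul_right e5 h0

/-- Tail bound for the truncated score. Its summands need not be centered: by Cauchy-Schwarz and the
bound for the second moments of the gradient, their mean is of order `1 / ‖βstar‖`, which is
small enough. -/
lemma Population.truncScore_tail {K : Consts} {M : Model} (h : Population K M) {n : ℕ}
    {τ₁ τ₂ t : ℝ} (h1 : 0 ≤ τ₁) (h2 : 0 ≤ τ₂) (ht : 0 < t) :
    (Measure.pi fun _ : Fin n => M.law) {D | t < ‖∑ j, M.truncScore τ₁ τ₂ (D j)‖} ≤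
      ENNReal.ofReal ((n * (τ₁ * τ₂) ^ 2 + n ^ 2 * (τ₁ ^ 2 * (K.Csec / ‖M.betaStar‖ ^ 2))) /
        t ^ 2) := by
  have hX := fun a => M.memLp_truncScore_apply h1 h2 a
  have hS := fun a => integral_sum_sq_pi_le (n := n) (hX a)
  have hn : ∀ D : Fin n → M.Obs, ‖∑ j, M.truncScore τ₁ τ₂ (D j)‖ ^ 2 =
      ∑ a, (∑ j, M.truncScore τ₁ τ₂ (D j) a) ^ 2 := fun D => by
    rw [EuclideanSpace.real_norm_sq_eq]
    simp
  have hsq : ∑ a, ∫ z, M.truncScore τ₁ τ₂ z a ^ 2 ∂M.law ≤ (τ₁ * τ₂) ^ 2 := by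
    rw [← integral_finsetSum _ fun a _ => (hX a).integrable_sq]
    have hb : ∀ z, ∑ a, M.truncScore τ₁ τ₂ z a ^ 2 ≤ (τ₁ * τ₂) ^ 2 := fun z => by
      rw [← EuclideanSpace.real_norm_sq_eq]
      exact pow_le_pow_left₀ (norm_nonneg _) (M.norm_truncScore_le h1 h2 z) 2
    calc _ ≤ ∫ _, (τ₁ * τ₂) ^ 2 ∂M.law :=
          integral_mono (integrable_finsetSum _ fun a _ => (hX a).integrable_sq)
            (integrable_const _) hb
      _ = _ := by simp
  have hint : Integrable (fun D : Fin n → M.Obs => ‖∑ j, M.truncScore τ₁ τ₂ (D j)‖ ^ 2)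
      (Measure.pi fun _ => M.law) := by
    simp only [hn]
    exact integrable_finsetSum _ fun a _ => (hS a).1
  have hbound : ∫ D : Fin n → M.Obs, ‖∑ j, M.truncScore τ₁ τ₂ (D j)‖ ^ 2
      ∂(Measure.pi fun _ => M.law) ≤
      n * (τ₁ * τ₂) ^ 2 + n ^ 2 * (τ₁ ^ 2 * (K.Csec / ‖M.betaStar‖ ^ 2)) := by
    simp only [hn]
    rw [integral_finsetSum _ fun a _ => (hS a).1]
    refine (Finset.sum_le_sum fun a _ => (hS a).2).trans ?_
    rw [Finset.sum_add_distrib, ← Finset.mul_sum, ← Finset.mul_sum]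
    have := h.sum_sq_mean_truncScore_le h1 h2
    gcongr
  have := measure_lt_abs_le hint hbound ht
  simpa only [abs_norm] using this

/-- With high probability the truncated score at the true parameter is at most of order
`n / ‖βstar‖`, up to logarithmic factors. -/
lemma Population.truncScore_bound {K : Consts} {M : Model} (h : Population K M) {n : ℕ}
    (hL : 1 ≤ Real.log n) (hbn : ‖M.betaStar‖ ^ 2 ≤ n) :
    (Measure.pi fun _ : Fin n => M.law) {D |
        K.Closs * √(K.Cgrad ^ 2 + K.Csec) * Real.log n ^ (2 * K.deg + 1) * (n / ‖M.betaStar‖) <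
        ‖∑ j, M.truncScore (K.Closs * Real.log n ^ K.deg) (K.Cgrad * Real.log n ^ K.deg) (D j)‖} ≤
      ENNReal.ofReal (1 / Real.log n ^ 2) := by
  obtain ⟨-, -, -, hCg, -, -, -, -, -, hCl, -, -, -, hC⟩ := K.pos
  have hb := Regular.norm_betaStar_pos M
  have hn : (0 : ℝ) < n := (by positivity : (0 : ℝ) < ‖M.betaStar‖ ^ 2).trans_le hbn
  set L := Real.log n
  set b := ‖M.betaStar‖
  have hx : 0 < √(K.Cgrad ^ 2 + K.Csec) := Real.sqrt_pos.2 (by positivity)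
  have hx2 : √(K.Cgrad ^ 2 + K.Csec) ^ 2 = K.Cgrad ^ 2 + K.Csec := Real.sq_sqrt (by positivity)
  have hL0 : 0 < L := by linarith
  refine (h.truncScore_tail (by positivity) (by positivity) (by positivity)).trans
    (ENNReal.ofReal_le_ofReal ?_)
  have hpow : L ^ (2 * K.deg + 1) = L * (L ^ K.deg * L ^ K.deg) := by ring
  rw [hpow, div_le_div_iff₀ (by positivity) (by positivity), one_mul]
  set y := L ^ K.deg with hy
  have hy1 : 1 ≤ y ^ 2 := one_le_pow₀ (one_le_pow₀ hL)
  have hnb : (n : ℝ) ≤ n ^ 2 / b ^ 2 := by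
    rw [le_div_iff₀ (by positivity)]
    nlinarith
  have key : n * (K.Cgrad * y) ^ 2 + n ^ 2 * (K.Csec / b ^ 2) ≤
      n ^ 2 / b ^ 2 * ((K.Cgrad ^ 2 + K.Csec) * y ^ 2) := by
    have t1 : n * (K.Cgrad * y) ^ 2 ≤ n ^ 2 / b ^ 2 * (K.Cgrad ^ 2 * y ^ 2) := by
      rw [mul_pow]
      exact mul_le_mul_of_nonneg_right hnb (by positivity)
    have t2 : n ^ 2 * (K.Csec / b ^ 2) ≤ n ^ 2 / b ^ 2 * (K.Csec * y ^ 2) := by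
      calc n ^ 2 * (K.Csec / b ^ 2) = n ^ 2 / b ^ 2 * (K.Csec * 1) := by ring
        _ ≤ _ := by gcongr
    linarith
  calc (n * (K.Closs * y * (K.Cgrad * y)) ^ 2 +
        n ^ 2 * ((K.Closs * y) ^ 2 * (K.Csec / b ^ 2))) * L ^ 2
      = (K.Closs * y) ^ 2 * L ^ 2 *
        (n * (K.Cgrad * y) ^ 2 + n ^ 2 * (K.Csec / b ^ 2)) := by ring
    _ ≤ (K.Closs * y) ^ 2 * L ^ 2 *
        (n ^ 2 / b ^ 2 * ((K.Cgrad ^ 2 + K.Csec) * y ^ 2)) :=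
        mul_le_mul_of_nonneg_left key (by positivity)
    _ = _ := by
        rw [mul_pow _ ((n : ℝ) / b), mul_pow _ (L * (y * y)),
          mul_pow K.Closs √(K.Cgrad ^ 2 + K.Csec), hx2]
        ring

/-- On a regular sample the truncation of the score has no effect. -/
lemma Regular.score_eq_truncScore {K : Consts} {M : Model} {n : ℕ} {T : Estimators M n}
    {D : Fin n → M.Obs} {xnew : Vec M.p} (h : Regular K T D xnew) :
    M.score D M.betaStar = ∑ j, M.truncScore (K.Closs * Real.log n ^ K.deg)
      (K.Cgrad * Real.log n ^ K.deg) (D j) := by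
  refine Finset.sum_congr rfl fun j _ => ?_
  rw [Model.truncScore, if_pos]
  exact ⟨h.dloss_bound j _ (Or.inr rfl),
    (h.grad_bound j _ (Or.inr (subset_convexHull ℝ _ (by simp)))).2 j⟩

/-! ### Exceptional events -/

section Fubini

variable {α β γ : Type*} [MeasurableSpace α] [MeasurableSpace β] [MeasurableSpace γ]

/-- A bound that holds for all sections of an event holds for the event. -/
lemma prod_measure_le_of_sections {μ : Measure α} [IsProbabilityMeasure μ] {ν : Measure β}
    [SFinite ν] {s : Set (α × β)} (hs : MeasurableSet s) {c : ℝ≥0∞}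
    (h : ∀ a, ν (Prod.mk a ⁻¹' s) ≤ c) : μ.prod ν s ≤ c := by
  rw [Measure.prod_apply hs]
  exact (lintegral_mono h).trans (by simp)

/-- A bound that holds conditionally on the first and the last of three independent variables holds
unconditionally. -/
lemma prod_measure_le_of_middle_sections {μ : Measure α} [IsProbabilityMeasure μ] {ν : Measure β}
    [IsProbabilityMeasure ν] {ρ : Measure γ} [IsProbabilityMeasure ρ] {s : Set ((α × β) × γ)}
    (hs : MeasurableSet s) {c : ℝ≥0∞} (h : ∀ a z, ν {b | ((a, b), z) ∈ s} ≤ c) :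
    (μ.prod ν).prod ρ s ≤ c := by
  rw [Measure.prod_apply_symm hs]
  refine (lintegral_mono fun z => ?_).trans (by simp : ∫⁻ _, c ∂ρ ≤ c)
  exact prod_measure_le_of_sections (measurable_prodMk_right hs) fun a => h a z

end Fubini

lemma measurable_weightedGram_apply {α : Type*} [MeasurableSpace α] {n m : ℕ}
    {Φ : α → Matrix (Fin n) (Fin m) ℝ} {w : α → Fin n → ℝ}
    (hΦ : ∀ i j, Measurable fun a => Φ a i j) (hw : ∀ i, Measurable fun a => w a i)
    (i j : Fin m) : Measurable fun a => weightedGram (Φ a) (w a) i j := by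
  refine measurable_mul_apply (measurable_mul_apply (fun i j => hΦ j i) fun i j => ?_) hΦ i j
  simp only [Matrix.diagonal_apply]
  split_ifs
  · exact hw i
  · exact measurable_const

section Events

variable {K : Consts} {M : Model} {n k : ℕ} (T : Estimators M n)

lemma measurable_gradMatrix_hat (i : Fin n) (a : Fin M.d) :
    Measurable fun D : Fin n → M.Obs => M.gradMatrix D (T.hat D) i a := by
  have h1 : Measurable fun D : Fin n → M.Obs => M.grad (D i).1 (T.hat D) :=
    M.measurable_grad.comp ((measurable_fst.comp (measurable_pi_apply i)).prodMk T.hat_measurable)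
  change Measurable fun D : Fin n → M.Obs => M.grad (D i).1 (T.hat D) a
  fun_prop

lemma measurable_secondDeriv (i : Fin n) :
    Measurable fun D : Fin n → M.Obs => secondDeriv T D i := by
  have hx : Measurable fun D : Fin n → M.Obs => (D i).1 := by fun_prop
  have h1 : Measurable fun D : Fin n → M.Obs => M.grad (D i).1 (T.hat D) :=
    M.measurable_grad.comp (hx.prodMk T.hat_measurable)
  have h2 : Measurable fun D : Fin n → M.Obs => M.f (D i).1 (T.hat D) :=
    M.f_measurable.comp (hx.prodMk T.hat_measurable)
  have h3 : Measurable fun D : Fin n → M.Obs => M.linPred (T.hat D) (D i).1 (T.breve D) :=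
    (h1.inner T.breve_measurable).add (h2.sub (h1.inner T.hat_measurable))
  have hy : Measurable fun D : Fin n → M.Obs => (D i).2 := by fun_prop
  exact M.measurable_ddloss.comp (hy.prodMk h3)

lemma measurable_sketchForm_grad (i : Fin n) :
    Measurable fun ω : ((Fin n → M.Obs) × M.Obs) × (Fin M.d → Fin k → ℝ) =>
      sketchForm 1 (Matrix.of ω.2) (M.gradMatrix ω.1.1 (T.hat ω.1.1) i) :=
  measurable_sketchForm (α := ((Fin n → M.Obs) × M.Obs) × (Fin M.d → Fin k → ℝ))
    (A := fun _ => 1) (S := fun ω => Matrix.of ω.2)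
    (u := fun ω => M.gradMatrix ω.1.1 (T.hat ω.1.1) i) (fun _ _ => measurable_const)
    (fun i j => by simp only [Matrix.of_apply]; fun_prop)
    (fun a => (measurable_gradMatrix_hat T i a).comp (measurable_fst.comp measurable_fst))

lemma measurable_normSq_grad (i : Fin n) :
    Measurable fun ω : ((Fin n → M.Obs) × M.Obs) × (Fin M.d → Fin k → ℝ) =>
      M.gradMatrix ω.1.1 (T.hat ω.1.1) i ⬝ᵥ M.gradMatrix ω.1.1 (T.hat ω.1.1) i := by
  have h : ∀ a, Measurable fun ω : ((Fin n → M.Obs) × M.Obs) × (Fin M.d → Fin k → ℝ) =>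
      M.gradMatrix ω.1.1 (T.hat ω.1.1) i a := fun a =>
    (measurable_gradMatrix_hat T i a).comp (measurable_fst.comp measurable_fst)
  exact Finset.measurable_sum _ fun a _ => (h a).mul (h a)

lemma measurable_sketchVec_grad (i : Fin n) :
    Measurable fun ω : ((Fin n → M.Obs) × M.Obs) × (Fin M.d → Fin k → ℝ) =>
      (WithLp.toLp 2 (sketchVec (weightedGram (M.gradMatrix ω.1.1 (T.hat ω.1.1))
        (secondDeriv T ω.1.1)) (Matrix.of ω.2) (M.gradMatrix ω.1.1 (T.hat ω.1.1) i)) :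
        Vec M.d) := by
  refine (WithLp.measurable_toLp 2 _).comp (measurable_pi_lambda _ fun a => ?_)
  have hp : Measurable fun ω : ((Fin n → M.Obs) × M.Obs) × (Fin M.d → Fin k → ℝ) => ω.1.1 :=
    measurable_fst.comp measurable_fst
  exact measurable_sketchVec_apply (α := ((Fin n → M.Obs) × M.Obs) × (Fin M.d → Fin k → ℝ))
    (A := fun ω => weightedGram (M.gradMatrix ω.1.1 (T.hat ω.1.1)) (secondDeriv T ω.1.1))
    (S := fun ω => Matrix.of ω.2) (u := fun ω => M.gradMatrix ω.1.1 (T.hat ω.1.1) i)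
    (measurable_weightedGram_apply (fun i j => (measurable_gradMatrix_hat T i j).comp hp)
      fun i => (measurable_secondDeriv T i).comp hp)
    (fun i j => by simp only [Matrix.of_apply]; fun_prop)
    (fun a => (measurable_gradMatrix_hat T i a).comp hp) a

lemma dim_ne_zero (M : Model) : M.d ≠ 0 := fun h => M.betaStar_ne_zero <| by
  ext a
  exact absurd a.2 (by omega)

lemma fullLaw_preimage_fst_le (s : Set ((Fin n → M.Obs) × M.Obs)) :
    fullLaw M n k {ω | ω.1 ∈ s} ≤ dataLaw M n s :=
  (measurePreserving_fst (μ := dataLaw M n) (ν := gaussianMatrix M.d k)).measure_preimage_le s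

lemma fullLaw_not_injective (hk : k ≤ M.d) :
    fullLaw M n k {ω | ¬ Function.Injective (Matrix.of ω.2).mulVec} = 0 :=
  ae_iff.1 ((measurePreserving_snd (μ := dataLaw M n)
    (ν := gaussianMatrix M.d k)).quasiMeasurePreserving.ae (ae_injective_gaussianMatrix hk))

/-- Conditionally on the data, the gradient at the `i`-th training point is fixed and the sketch is
still Gaussian, so that concentration applies with `δ = 1 / 2`. -/
lemma fullLaw_sketchForm_lt (hk : k ≤ M.d) (i : Fin n) :
    fullLaw M n k {ω | sketchForm 1 (Matrix.of ω.2) (M.gradMatrix ω.1.1 (T.hat ω.1.1) i) <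
      1 / 2 * ((k : ℝ) / M.d) *
        (M.gradMatrix ω.1.1 (T.hat ω.1.1) i ⬝ᵥ M.gradMatrix ω.1.1 (T.hat ω.1.1) i)} ≤
      ENNReal.ofReal (4 * Real.exp (-(1 / 288 * k))) := by
  refine prod_measure_le_of_sections (measurableSet_lt (measurable_sketchForm_grad T i)
    ((measurable_normSq_grad T i).const_mul _)) fun z => ?_
  set u := M.gradMatrix z.1 (T.hat z.1) i with hu
  rcases eq_or_ne u 0 with h0 | h0
  · have : (Prod.mk z ⁻¹' {ω : ((Fin n → M.Obs) × M.Obs) × (Fin M.d → Fin k → ℝ) |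
        sketchForm 1 (Matrix.of ω.2) (M.gradMatrix ω.1.1 (T.hat ω.1.1) i) <
        1 / 2 * ((k : ℝ) / M.d) * (M.gradMatrix ω.1.1 (T.hat ω.1.1) i ⬝ᵥ
          M.gradMatrix ω.1.1 (T.hat ω.1.1) i)}) = ∅ := by
      ext S
      simp only [Set.mem_preimage, Set.mem_ofPred_eq, ← hu, h0]
      simp [sketchForm]
    rw [this]
    simp
  · refine (measure_mono ?_).trans
      ((gaussianMatrix_sketchForm_concentration hk h0 (δ := 1 / 2) (by norm_num)
        (by norm_num)).trans (ENNReal.ofReal_le_ofReal (le_of_eq ?_)))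
    · intro S hS hgood
      have h1 : sketchForm 1 (Matrix.of S) u < 1 / 2 * ((k : ℝ) / M.d) * (u ⬝ᵥ u) := hS
      have h2 := hgood.1
      norm_num at h1 h2
      linarith
    · norm_num

/-- Markov's inequality for the sketched form, conditionally on the data. -/
lemma fullLaw_sketchForm_gt (hk : k ≤ M.d) (i : Fin n) {t : ℝ} (ht : 0 < t) :
    fullLaw M n k {ω | t * ((k : ℝ) / M.d *
        (M.gradMatrix ω.1.1 (T.hat ω.1.1) i ⬝ᵥ M.gradMatrix ω.1.1 (T.hat ω.1.1) i)) <
      sketchForm 1 (Matrix.of ω.2) (M.gradMatrix ω.1.1 (T.hat ω.1.1) i)} ≤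
      ENNReal.ofReal (1 / t) := by
  have hs := measurableSet_lt (((measurable_normSq_grad (k := k) T i).const_mul
    ((k : ℝ) / M.d)).const_mul t) (measurable_sketchForm_grad T i)
  refine prod_measure_le_of_sections hs fun z => ?_
  exact gaussianMatrix_sketchForm_markov hk (dim_ne_zero M) (M.gradMatrix z.1 (T.hat z.1) i) ht

/-- Conditionally on the training sample and the sketch, the vector `S (Sᵀ H S)⁻¹ Sᵀ g_i` is
fixed and the test feature still has its law. -/
lemma fullLaw_inner_gt (hP : Population K M) (i : Fin n) {t : ℝ} (ht : 0 < t) :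
    fullLaw M n k {ω | t * (√K.Csec / ‖M.betaStar‖) * ‖(WithLp.toLp 2 (sketchVec
        (weightedGram (M.gradMatrix ω.1.1 (T.hat ω.1.1)) (secondDeriv T ω.1.1)) (Matrix.of ω.2)
        (M.gradMatrix ω.1.1 (T.hat ω.1.1) i)) : Vec M.d)‖ <
      |⟪WithLp.toLp 2 (sketchVec (weightedGram (M.gradMatrix ω.1.1 (T.hat ω.1.1))
        (secondDeriv T ω.1.1)) (Matrix.of ω.2) (M.gradMatrix ω.1.1 (T.hat ω.1.1) i)),
        M.grad ω.1.2.1 M.betaStar⟫_ℝ|} ≤ ENNReal.ofReal (1 / t ^ 2) := by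
  have hv := measurable_sketchVec_grad (k := k) T i
  have hg : Measurable fun ω : ((Fin n → M.Obs) × M.Obs) × (Fin M.d → Fin k → ℝ) =>
      M.grad ω.1.2.1 M.betaStar := M.measurable_grad_star.comp (by fun_prop)
  have hs := measurableSet_lt (hv.norm.const_mul (t * (√K.Csec / ‖M.betaStar‖))) (hv.inner hg).abs
  refine prod_measure_le_of_middle_sections hs fun D S => ?_
  set v : Vec M.d := WithLp.toLp 2 (sketchVec
    (weightedGram (M.gradMatrix D (T.hat D)) (secondDeriv T D)) (Matrix.of S)
    (M.gradMatrix D (T.hat D) i)) with hv_def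
  exact (M.measurePreserving_fst_law.measure_preimage_le {x | t * (√K.Csec / ‖M.betaStar‖) * ‖v‖ <
    |⟪v, M.grad x M.betaStar⟫_ℝ|}).trans (hP.px_inner_grad_le v ht)

lemma fullLaw_score_gt (hP : Population K M) (hL : 1 ≤ Real.log n)
    (hbn : ‖M.betaStar‖ ^ 2 ≤ n) :
    fullLaw M n k {ω | K.Closs * √(K.Cgrad ^ 2 + K.Csec) * Real.log n ^ (2 * K.deg + 1) *
        (n / ‖M.betaStar‖) < ‖∑ j, M.truncScore (K.Closs * Real.log n ^ K.deg)
          (K.Cgrad * Real.log n ^ K.deg) (ω.1.1 j)‖} ≤ ENNReal.ofReal (1 / Real.log n ^ 2) :=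
  ((fullLaw_preimage_fst_le {z | _ < ‖∑ j, M.truncScore (K.Closs * Real.log n ^ K.deg)
      (K.Cgrad * Real.log n ^ K.deg) (z.1 j)‖}).trans
    ((measurePreserving_fst (μ := Measure.pi fun _ : Fin n => M.law)
      (ν := M.law)).measure_preimage_le _)).trans (hP.truncScore_bound hL hbn)

/-- Failure probability of the bound for the influence at an independent test point. -/
lemma fullLaw_test_influence (hk : k ≤ M.d) (hP : Population K M) (hL : 1 ≤ Real.log n)
    (hbn : ‖M.betaStar‖ ^ 2 ≤ n)
    (hη : K.Closs * Real.log n ^ K.deg * (K.Cgrad * Real.log n ^ K.deg) ^ 2 /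
        (n * (K.cH / ‖M.betaStar‖ ^ 2)) ≤ 1 / 2) (i : Fin n) :
    fullLaw M n k {ω | ¬ (AloDefined (projFeatures T ω.1.1 (Matrix.of ω.2))
          (secondDeriv T ω.1.1) i ∧
        |influenceTRAK T ω.1.1 (Matrix.of ω.2) i ω.1.2.1| ≤
          2 * K.Closs * K.Cgrad / K.cH *
            (√K.Csec + K.Chess * (K.Closs * √(K.Cgrad ^ 2 + K.Csec)) / K.cH) *
            Real.log n ^ (4 * K.deg + 2) * (‖M.betaStar‖ / n * √((k : ℝ) / M.d)))} ≤
      dataLaw M n {ω | ¬ Regular K T ω.1 ω.2.1} + ENNReal.ofReal (1 / Real.log n ^ 2) +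
        ENNReal.ofReal (1 / Real.log n) + ENNReal.ofReal (1 / Real.log n ^ 2) := by
  have hL0 : 0 < Real.log n := by linarith
  have hA : 0 ≤ K.Closs * √(K.Cgrad ^ 2 + K.Csec) := by
    obtain ⟨-, -, -, -, -, -, -, -, -, hCl, -⟩ := K.pos
    positivity
  refine le_trans (measure_mono_ae ?_) ((measure_union_le _ _).trans (add_le_add
    ((measure_union_le _ _).trans (add_le_add ((measure_union_le _ _).trans (add_le_add
      (fullLaw_preimage_fst_le (k := k) {ω | ¬ Regular K T ω.1 ω.2.1})
      (fullLaw_score_gt hP hL hbn))) (fullLaw_sketchForm_gt T hk i hL0)))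
    (fullLaw_inner_gt T hP i hL0)))
  have hinj := fullLaw_not_injective (n := n) hk
  rw [← compl_mem_ae_iff] at hinj
  filter_upwards [hinj] with ω hω hbad
  have hS : Function.Injective (Matrix.of ω.2).mulVec := not_not.1 hω
  by_contra hgood
  have hR : Regular K T ω.1.1 ω.1.2.1 := not_not.1 fun h => hgood (Or.inl (Or.inl (Or.inl h)))
  have h1 := fun h => hgood (Or.inl (Or.inl (Or.inr h)))
  rw [Set.mem_ofPred_eq, imp_false, not_lt] at h1
  have h2 := fun h => hgood (Or.inl (Or.inr h))
  rw [Set.mem_ofPred_eq, imp_false, not_lt] at h2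
  have h3 := fun h => hgood (Or.inr h)
  rw [Set.mem_ofPred_eq, imp_false, not_lt] at h3
  rw [← hR.score_eq_truncScore] at h1
  exact hbad ⟨hR.aloDefined_proj i hη hS, hR.test_influence_le i hη hL hS hA h1 h2 h3⟩

/-- Failure probability of the bound for the self-influence. -/
lemma fullLaw_self_influence (hk : k ≤ M.d)
    (hη : K.Closs * Real.log n ^ K.deg * (K.Cgrad * Real.log n ^ K.deg) ^ 2 /
        (n * (K.cH / ‖M.betaStar‖ ^ 2)) ≤ 1 / 2) (i : Fin n) :
    fullLaw M n k {ω | ¬ (AloDefined (projFeatures T ω.1.1 (Matrix.of ω.2))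
          (secondDeriv T ω.1.1) i ∧
        AloDefined (M.gradMatrix ω.1.1 (T.hat ω.1.1)) (secondDeriv T ω.1.1) i ∧
        (influenceALO T ω.1.1 i (ω.1.1 i).1 ≠ 0 →
          K.cH / (4 * K.CH) * ((k : ℝ) / M.d) ≤
            |influenceTRAK T ω.1.1 (Matrix.of ω.2) i (ω.1.1 i).1 /
              influenceALO T ω.1.1 i (ω.1.1 i).1|))} ≤
      dataLaw M n {ω | ¬ Regular K T ω.1 ω.2.1} +
        ENNReal.ofReal (4 * Real.exp (-(1 / 288 * k))) := by
  refine le_trans (measure_mono_ae ?_) ((measure_union_le _ _).trans (add_le_add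
      (fullLaw_preimage_fst_le (k := k) {ω | ¬ Regular K T ω.1 ω.2.1})
      (fullLaw_sketchForm_lt T hk i)))
  have hinj := fullLaw_not_injective (n := n) hk
  rw [← compl_mem_ae_iff] at hinj
  filter_upwards [hinj] with ω hω hbad
  have hS : Function.Injective (Matrix.of ω.2).mulVec := not_not.1 hω
  by_contra hgood
  have hR : Regular K T ω.1.1 ω.1.2.1 := not_not.1 fun h => hgood (Or.inl h)
  have h1 := fun h => hgood (Or.inr h)
  rw [Set.mem_ofPred_eq, imp_false, not_lt] at h1
  exact hbad ⟨hR.aloDefined_proj i hη hS, hR.aloDefined i hη,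
    fun hne => hR.self_influence_ratio i hη hS h1 hne⟩

end Events

/-! ### Asymptotics -/

/-- Powers of the logarithm are absorbed by any positive power of `n`. -/
lemma eventually_mul_log_pow_le (A : ℝ) (m : ℕ) {ε : ℝ} (hε : 0 < ε) :
    ∀ᶠ n : ℕ in atTop, A * Real.log n ^ m ≤ (n : ℝ) ^ ε := by
  have h := (isLittleO_log_rpow_rpow_atTop (m : ℝ) hε).const_mul_left A
  have h1 := (h.bound one_pos).and (eventually_ge_atTop (1 : ℝ))
  filter_upwards [tendsto_natCast_atTop_atTop.eventually h1] with n hn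
  obtain ⟨h2, h3⟩ := hn
  rw [Real.rpow_natCast, one_mul, Real.norm_of_nonneg (Real.rpow_nonneg (by linarith) _)] at h2
  exact (le_abs_self _).trans h2

lemma eventually_one_le_log : ∀ᶠ n : ℕ in atTop, 1 ≤ Real.log n :=
  (Real.tendsto_log_atTop.comp tendsto_natCast_atTop_atTop).eventually_ge_atTop 1

lemma tendsto_ofReal_one_div_log_pow {m : ℕ} (hm : m ≠ 0) :
    Tendsto (fun n : ℕ => ENNReal.ofReal (1 / Real.log n ^ m)) atTop (𝓝 0) := by
  rw [← ENNReal.ofReal_zero]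
  refine ENNReal.tendsto_ofReal (Tendsto.div_atTop tendsto_const_nhds ?_)
  exact (tendsto_pow_atTop hm).comp (Real.tendsto_log_atTop.comp tendsto_natCast_atTop_atTop)

/-- The bound for the leverages tends to zero. -/
lemma eventually_leverage_le (K : Consts) (M : ℕ → Model) {ε : ℝ} (hε : 0 < ε)
    (hb : ∀ᶠ n : ℕ in atTop, ‖(M n).betaStar‖ ^ 2 ≤ (n : ℝ) ^ (1 - ε)) :
    ∀ᶠ n : ℕ in atTop, K.Closs * Real.log n ^ K.deg * (K.Cgrad * Real.log n ^ K.deg) ^ 2 /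
        (n * (K.cH / ‖(M n).betaStar‖ ^ 2)) ≤ 1 / 2 := by
  obtain ⟨-, -, -, hCg, -, -, hcH, -, -, hCl, -⟩ := K.pos
  filter_upwards [hb, eventually_mul_log_pow_le (2 * (K.Closs * K.Cgrad ^ 2) / K.cH) (3 * K.deg) hε,
    eventually_gt_atTop 0, eventually_one_le_log] with n h1 h2 h3 h4
  have hn : (0 : ℝ) < n := by exact_mod_cast h3
  have hL : 0 < Real.log n := by linarith
  have hbp := Regular.norm_betaStar_pos (M n)
  have e1 : (n : ℝ) ^ ε * (n : ℝ) ^ (1 - ε) = n := by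
    rw [← Real.rpow_add hn, add_sub_cancel, Real.rpow_one]
  have h5 : 2 * (K.Closs * K.Cgrad ^ 2) / K.cH * Real.log n ^ (3 * K.deg) *
      ‖(M n).betaStar‖ ^ 2 ≤ n := by
    calc _ ≤ (n : ℝ) ^ ε * (n : ℝ) ^ (1 - ε) := by gcongr
      _ = n := e1
  have e2 : K.Closs * Real.log n ^ K.deg * (K.Cgrad * Real.log n ^ K.deg) ^ 2 /
      (n * (K.cH / ‖(M n).betaStar‖ ^ 2)) = 1 / 2 * ((2 * (K.Closs * K.Cgrad ^ 2) / K.cH *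
        Real.log n ^ (3 * K.deg) * ‖(M n).betaStar‖ ^ 2) / n) := by
    field_simp
    ring
  rw [e2]
  have := (div_le_one hn).2 h5
  linarith

lemma eventually_sq_norm_le (M : ℕ → Model) {ε : ℝ} (hε : 0 < ε)
    (hb : ∀ᶠ n : ℕ in atTop, ‖(M n).betaStar‖ ^ 2 ≤ (n : ℝ) ^ (1 - ε)) :
    ∀ᶠ n : ℕ in atTop, ‖(M n).betaStar‖ ^ 2 ≤ n := by
  filter_upwards [hb, eventually_ge_atTop 1] with n h1 h2
  refine h1.trans ?_
  have hn : (1 : ℝ) ≤ n := by exact_mod_cast h2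
  calc (n : ℝ) ^ (1 - ε) ≤ (n : ℝ) ^ (1 : ℝ) := Real.rpow_le_rpow_of_exponent_le hn (by linarith)
    _ = n := Real.rpow_one _

end TRAK

end

open TRAK in
theorem mainTheorem1 :
    -- quadratic forms under a Gaussian sketch
    (∃ C c : ℝ, 0 < C ∧ 0 < c ∧
      ∀ (d k : ℕ) (A : Matrix (Fin d) (Fin d) ℝ) (hA : A.PosDef) (κ δ : ℝ) (u : Fin d → ℝ),
        k ≤ d → 0 < κ →
        (∀ a b, hA.isHermitian.eigenvalues a / hA.isHermitian.eigenvalues b ≤ κ) →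
        0 < δ → δ < 1 → u ≠ 0 →
        TRAK.gaussianMatrix d k {S : Fin d → Fin k → ℝ |
          ¬ (1 / κ * (1 - δ) * (k / d) ≤
              (((Matrix.of S)ᵀ *ᵥ u) ⬝ᵥ
                (((Matrix.of S)ᵀ * A * Matrix.of S)⁻¹ *ᵥ ((Matrix.of S)ᵀ *ᵥ u))) /
                (u ⬝ᵥ (A⁻¹ *ᵥ u)) ∧
            (((Matrix.of S)ᵀ *ᵥ u) ⬝ᵥ
                (((Matrix.of S)ᵀ * A * Matrix.of S)⁻¹ *ᵥ ((Matrix.of S)ᵀ *ᵥ u))) /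
                (u ⬝ᵥ (A⁻¹ *ᵥ u)) ≤
              min (κ * (1 + δ) * (k / d)) 1)}
          ≤ ENNReal.ofReal (C * Real.exp (-(c * δ ^ 2 * k)))) ∧
    -- the two bounds for the influence after projection
    (∀ (K : TRAK.Consts) (ε : ℝ), 0 < ε →
      ∃ C c : ℝ, 0 < C ∧ 0 < c ∧
        ∀ (M : ℕ → TRAK.Model) (T : ∀ n, TRAK.Estimators (M n) n) (k : ℕ → ℕ),
          (∀ n, k n ≤ (M n).d) →
          (∀ᶠ n : ℕ in atTop, ‖(M n).betaStar‖ ^ 2 ≤ (n : ℝ) ^ (1 - ε)) →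
          (∀ n, TRAK.Population K (M n)) →
          Tendsto (fun n => TRAK.dataLaw (M n) n
            {ω | ¬ TRAK.Regular K (T n) ω.1 ω.2.1}) atTop (𝓝 0) →
          -- test point independent of the training sample
          Tendsto (fun n => ⨆ i : Fin n, TRAK.fullLaw (M n) n (k n)
            {ω | ¬ (TRAK.AloDefined (TRAK.projFeatures (T n) ω.1.1 (Matrix.of ω.2))
                  (TRAK.secondDeriv (T n) ω.1.1) i ∧
                |TRAK.influenceTRAK (T n) ω.1.1 (Matrix.of ω.2) i ω.1.2.1| ≤
                  C * (‖(M n).betaStar‖ * √(k n)) / ((n : ℝ) ^ (1 - ε) * √((M n).d)))})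
            atTop (𝓝 0) ∧
          -- test point equal to the training point
          (Tendsto k atTop atTop →
            Tendsto (fun n => ⨆ i : Fin n, TRAK.fullLaw (M n) n (k n)
              {ω | ¬ (TRAK.AloDefined (TRAK.projFeatures (T n) ω.1.1 (Matrix.of ω.2))
                    (TRAK.secondDeriv (T n) ω.1.1) i ∧
                  TRAK.AloDefined ((M n).gradMatrix ω.1.1 ((T n).hat ω.1.1))
                    (TRAK.secondDeriv (T n) ω.1.1) i ∧
                  (TRAK.influenceALO (T n) ω.1.1 i (ω.1.1 i).1 ≠ 0 →
                    c * ((k n : ℝ) / (M n).d) ≤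
                      |TRAK.influenceTRAK (T n) ω.1.1 (Matrix.of ω.2) i (ω.1.1 i).1 /
                        TRAK.influenceALO (T n) ω.1.1 i (ω.1.1 i).1|))})
              atTop (𝓝 0))) := by
  refine ⟨⟨4, 1 / 72, by norm_num, by norm_num, fun d k A hA κ δ u hkd _ hκ h0 h1 hu =>
    gaussian_sketch_ratio d k A hA κ δ u hkd hκ h0 h1 hu⟩, fun K ε hε => ?_⟩
  obtain ⟨-, -, -, -, -, -, hcH, hCH, -⟩ := K.pos
  refine ⟨1, K.cH / (4 * K.CH), one_pos, by positivity, ?_⟩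
  intro M T k hk hb hP hreg
  have hη := eventually_leverage_le K M hε hb
  constructor
  · have hlim : Tendsto (fun n => dataLaw (M n) n {ω | ¬ Regular K (T n) ω.1 ω.2.1} +
        ENNReal.ofReal (1 / Real.log n ^ 2) + ENNReal.ofReal (1 / Real.log n) +
        ENNReal.ofReal (1 / Real.log n ^ 2)) atTop (𝓝 0) := by
      have h2 := tendsto_ofReal_one_div_log_pow two_ne_zero
      have h1 := tendsto_ofReal_one_div_log_pow one_ne_zero
      simp only [pow_one] at h1
      simpa using ((hreg.add h2).add h1).add h2
    refine tendsto_of_tendsto_of_tendsto_of_le_of_le' tendsto_const_nhds hlim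
      (Eventually.of_forall fun _ => zero_le) ?_
    -- the slack `n ^ ε` absorbs the logarithmic factors and all constants
    filter_upwards [hη, eventually_sq_norm_le M hε hb, eventually_one_le_log,
      eventually_gt_atTop 0, eventually_mul_log_pow_le (2 * K.Closs * K.Cgrad / K.cH *
        (√K.Csec + K.Chess * (K.Closs * √(K.Cgrad ^ 2 + K.Csec)) / K.cH)) (4 * K.deg + 2) hε]
      with n h1 h2 h3 h4 h5
    refine iSup_le fun i => ?_
    refine (measure_mono ?_).trans (fullLaw_test_influence (T n) (hk n) (hP n) h3 h2 h1 i)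
    intro ω hω hgood
    refine hω ⟨hgood.1, hgood.2.trans ?_⟩
    have hn : (0 : ℝ) < n := by exact_mod_cast h4
    have hd : (0 : ℝ) < (M n).d := by exact_mod_cast Nat.pos_of_ne_zero (dim_ne_zero (M n))
    have e1 : (n : ℝ) ^ ε * (n : ℝ) ^ (1 - ε) = n := by
      rw [← Real.rpow_add hn, add_sub_cancel, Real.rpow_one]
    refine (mul_le_mul_of_nonneg_right h5 (by positivity)).trans (le_of_eq ?_)
    have hp : 0 < (n : ℝ) ^ (1 - ε) := Real.rpow_pos_of_pos hn _
    have hsd : 0 < √((M n).d : ℝ) := Real.sqrt_pos.2 hd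
    rw [Real.sqrt_div (Nat.cast_nonneg _), one_mul, eq_div_iff (by positivity)]
    calc (n : ℝ) ^ ε * (‖(M n).betaStar‖ / n * (√(k n) / √((M n).d))) *
          ((n : ℝ) ^ (1 - ε) * √((M n).d))
        = ((n : ℝ) ^ ε * (n : ℝ) ^ (1 - ε)) * (‖(M n).betaStar‖ / n * (√(k n) / √((M n).d))) *
            √((M n).d) := by ring
      _ = ‖(M n).betaStar‖ * √(k n) := by
          rw [e1]
          field_simp
  · intro hkinf
    have hlim : Tendsto (fun n => dataLaw (M n) n {ω | ¬ Regular K (T n) ω.1 ω.2.1} +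
        ENNReal.ofReal (4 * Real.exp (-(1 / 288 * (k n : ℝ))))) atTop (𝓝 0) := by
      have h1 : Tendsto (fun n => 4 * Real.exp (-(1 / 288 * (k n : ℝ)))) atTop (𝓝 0) := by
        have h2 : Tendsto (fun n => 1 / 288 * (k n : ℝ)) atTop atTop :=
          (tendsto_natCast_atTop_atTop.comp hkinf).const_mul_atTop (by norm_num)
        simpa using (Real.tendsto_exp_neg_atTop_nhds_zero.comp h2).const_mul 4
      have h3 := ENNReal.tendsto_ofReal h1
      rw [ENNReal.ofReal_zero] at h3
      simpa using hreg.add h3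
    refine tendsto_of_tendsto_of_tendsto_of_le_of_le' tendsto_const_nhds hlim
      (Eventually.of_forall fun _ => zero_le) ?_
    filter_upwards [hη] with n h1
    exact iSup_le fun i => fullLaw_self_influence (T n) (hk n) h1 i
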